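/- Let $n\ge 1$, $1\le k\le n$, $\Pi=\{(x,t): 0<x<1,\ t>0\}$, $\overline\Pi=[0,1]\times[0,\infty)$, and consider the problem $$\partial_t u_i+\lambda_i(x,t)\,\partial_x u_i=f_i(x,t,u),\quad 1\le i\le n,\ (x,t)\in\Pi,\qquad u(x,0)=\varphi(x),\quad x\in(0,1),$$ $$u_i(0,t)=h_i(t,v(t)),\ \ k+1\le i\le n,\qquad u_i(1,t)=h_i(t,v(t)),\ \ 1\le i\le k,\qquad t>0,$$ for $u=(u_1,\dots,u_n)$ with real components, where $v(t)=(u_1(0,t),\dots,u_k(0,t),u_{k+1}(1,t),\dots,u_n(1,t))$. Assume: (i) $\lambda_i$ is continuous on $\overline\Pi$ with $\partial_x\lambda_i$ existing and continuous on $\overline\Pi$; $\lambda_1,\dots,\lambda_k<0$ and $\lambda_{k+1},\dots,\lambda_n>0$ on $\overline\Pi$; (ii) $f=(f_1,\dots,f_n)$ is continuous on $\overline\Pi\times\mathbb R^n$, with $\partial_x f$ and $\nabla_y f(x,t,y)$ existing and continuous there; $\varphi\in C^1([0,1])^n$; $h=(h_1,\dots,h_n)$ is $C^1$ on $[0,\infty)\times\mathbb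 R^n$; (iii) for every $T>0$ there are constants $C_f,C_h>0$ and polynomials $F(x,t,r)=\sum_{j\le N}a_j(x,t)r^j$ and $H(t,r)=\sum_{j\le M}b_j(t)r^j$ in $r$ with $a_j\in C^1([0,1]\times[0,T])$ and $b_j\in C^1([0,T])$, such that for all $(x,t)\in[0,1]\times[0,T]$ and $y,z\in\mathbb R^n$ one has $F(x,t,\|y\|)\ge e$, $H(t,\|z\|)\ge e$ and $$\|\nabla_y f(x,t,y)\|\le C_f\bigl(\log\log F(x,t,\|y\|)\bigr)^{1/4},\qquad \|\nabla_z h(t,z)\|\le C_h\bigl(\log\log H(t,\|z\|)\bigr)^{1/4};$$ (iv) the zero-order and first-order compatibility conditions hold. That is, with $x_i=0$, $y_i=1$ for $1\le i\le k$ and $x_i=1$, $y_i=0$ for $k+1\le i\le n$, and with $v^0,v^1\in\mathbb R^n$ defined by $v^0_i=\varphi_i(x_i)$ and $v^1_i=f_i(x_i,0,\varphi(x_i))-\lambda_i(x_i,0)\varphi_i'(x_i)$, for all $1\le i\le n$ $$\varphi_i(y_i)=h_i(0,v^0),\qquad f_i(y_i,0,\varphi(y_i))-\lambda_i(y_i,0)\varphi_i'(y_i)=\partial_t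 h_i(0,v^0)+\nabla_v h_i(0,v^0)\cdot v^1 .$$ Then the problem has a unique (global) classical solution in $\Pi$: there is a function $u\in C^1(\overline\Pi)^n$ satisfying it, and every $w\in C(\overline\Pi)^n\cap C^1(\Pi)^n$ satisfying it coincides with $u$ on $\overline\Pi$. -/

import Mathlib

open Set

noncomputable section

/-- The space `ℝⁿ` with its Euclidean norm. -/
abbrev EVec (n : ℕ) : Type := EuclideanSpace ℝ (Fin n)

/-- The open half-strip `Π = {(x,t) : 0 < x < 1, t > 0}`. -/
def strip : Set (ℝ × ℝ) := Ioo 0 1 ×ˢ Ioi 0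

/-- The closed half-strip `[0,1] × [0,∞)`, the closure of `Π`. -/
def stripBar : Set (ℝ × ℝ) := Icc 0 1 ×ˢ Ici 0

/-- The closed rectangle `[0,1] × [0,T]`, the closure of `Π^T`. -/
def rectBar (T : ℝ) : Set (ℝ × ℝ) := Icc 0 1 ×ˢ Icc 0 T

/-- The vector whose first `k` components are those of `a` (values at `x = 0`) and whose other
components are those of `b` (values at `x = 1`). The index `i : Fin n` stands for the
component number `i + 1`, so the first `k` components are those with `(i : ℕ) < k`. -/
def outVec {n : ℕ} (k : ℕ) (a b : EVec n) : EVec n :=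
  WithLp.toLp 2 (fun i => if (i : ℕ) < k then a i else b i)

/-- The characteristic speeds: each `λ_i` is continuous on `[0,1] × [0,∞)`, `C¹` in `x`
(with `∂ₓλ_i` continuous in `(x,t)`), the first `k` are negative, the others positive. -/
structure SpeedsOK {n : ℕ} (k : ℕ) (lam : Fin n → ℝ → ℝ → ℝ) : Prop where
  cont : ∀ i, ContinuousOn (fun p : ℝ × ℝ => lam i p.1 p.2) stripBar
  diff : ∀ i, ∀ t, 0 ≤ t → DifferentiableOn ℝ (fun x => lam i x t) (Icc 0 1)
  cont_deriv : ∀ i, ContinuousOn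
    (fun p : ℝ × ℝ => derivWithin (fun x => lam i x p.2) (Icc 0 1) p.1) stripBar
  neg : ∀ i : Fin n, (i : ℕ) < k → ∀ x t, (x, t) ∈ stripBar → lam i x t < 0
  pos : ∀ i : Fin n, k ≤ (i : ℕ) → ∀ x t, (x, t) ∈ stripBar → 0 < lam i x t

/-- The right-hand side `f(x,t,y)` is continuous on `[0,1] × [0,∞) × ℝⁿ` and `C¹` in `x` and `y`
(with `∂ₓf` and `∇_y f` continuous in `(x,t,y)`). -/
structure SourceOK {n : ℕ} (f : ℝ → ℝ → EVec n → EVec n) : Prop where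
  cont : ContinuousOn (fun p : (ℝ × ℝ) × EVec n => f p.1.1 p.1.2 p.2) (stripBar ×ˢ univ)
  diff_x : ∀ t, 0 ≤ t → ∀ y, DifferentiableOn ℝ (fun x => f x t y) (Icc 0 1)
  cont_deriv_x : ContinuousOn
    (fun p : (ℝ × ℝ) × EVec n => derivWithin (fun x => f x p.1.2 p.2) (Icc 0 1) p.1.1)
    (stripBar ×ˢ univ)
  diff_y : ∀ x t, (x, t) ∈ stripBar → Differentiable ℝ (f x t)
  cont_deriv_y : ContinuousOn
    (fun p : (ℝ × ℝ) × EVec n => fderiv ℝ (f p.1.1 p.1.2) p.2) (stripBar ×ˢ univ)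

/-- For every `T > 0` there are `C > 0` and a polynomial `F(x,t,r) = ∑ⱼ aⱼ(x,t) rʲ` in `r` with
coefficients in `C¹([0,1] × [0,T])` such that `‖∇_y f(x,t,y)‖ ≤ C (log log F(x,t,‖y‖))^{1/4}`.
The bound `F ≥ e` says that the right-hand side makes sense. -/
def SourceGrowth {n : ℕ} (f : ℝ → ℝ → EVec n → EVec n) : Prop :=
  ∀ T : ℝ, 0 < T → ∃ C : ℝ, 0 < C ∧ ∃ (N : ℕ) (a : ℕ → ℝ × ℝ → ℝ),
    (∀ j, ContDiffOn ℝ 1 (a j) (rectBar T)) ∧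
    ∀ x t, (x, t) ∈ rectBar T → ∀ y : EVec n,
      Real.exp 1 ≤ ∑ j ∈ Finset.range (N + 1), a j (x, t) * ‖y‖ ^ j ∧
      ‖fderiv ℝ (f x t) y‖ ≤
        C * (Real.log (Real.log
          (∑ j ∈ Finset.range (N + 1), a j (x, t) * ‖y‖ ^ j))) ^ (1 / 4 : ℝ)

/-- For every `T > 0` there are `C > 0` and a polynomial `H(t,r) = ∑ⱼ bⱼ(t) rʲ` in `r` with
coefficients in `C¹[0,T]` such that `‖∇_z h(t,z)‖ ≤ C (log log H(t,‖z‖))^{1/4}`.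
The bound `H ≥ e` says that the right-hand side makes sense. -/
def BoundaryGrowth {n : ℕ} (h : ℝ → EVec n → EVec n) : Prop :=
  ∀ T : ℝ, 0 < T → ∃ C : ℝ, 0 < C ∧ ∃ (N : ℕ) (b : ℕ → ℝ → ℝ),
    (∀ j, ContDiffOn ℝ 1 (b j) (Icc 0 T)) ∧
    ∀ t, t ∈ Icc 0 T → ∀ z : EVec n,
      Real.exp 1 ≤ ∑ j ∈ Finset.range (N + 1), b j t * ‖z‖ ^ j ∧
      ‖fderiv ℝ (h t) z‖ ≤
        C * (Real.log (Real.log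
          (∑ j ∈ Finset.range (N + 1), b j t * ‖z‖ ^ j))) ^ (1 / 4 : ℝ)

/-- The vector with components `f_i(x,0,φ(x)) - λ_i(x,0) φ_i'(x)`, that is, the value of
`∂ₜu(x,0)` that the system prescribes. The derivative is one-sided at `x = 0` and `x = 1`. -/
def initialRate {n : ℕ} (lam : Fin n → ℝ → ℝ → ℝ) (f : ℝ → ℝ → EVec n → EVec n)
    (φ : ℝ → EVec n) (x : ℝ) : EVec n :=
  WithLp.toLp 2 (fun i => f x 0 (φ x) i - lam i x 0 * derivWithin φ (Icc 0 1) x i)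

/-- The zero-order compatibility conditions, with
`v(0) = (φ_1(0), …, φ_k(0), φ_{k+1}(1), …, φ_n(1))`. -/
def CompatZero {n : ℕ} (k : ℕ) (φ : ℝ → EVec n) (h : ℝ → EVec n → EVec n) : Prop :=
  ∀ i : Fin n,
    (k ≤ (i : ℕ) → φ 0 i = h 0 (outVec k (φ 0) (φ 1)) i) ∧
    ((i : ℕ) < k → φ 1 i = h 0 (outVec k (φ 0) (φ 1)) i)

/-- The vector `∂ₜh(0,v(0)) + ∇_v h(0,v(0)) · v'(0)` of the first-order compatibility
conditions (the derivative in `t` at `t = 0` is from the right). -/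
def boundaryRate {n : ℕ} (k : ℕ) (lam : Fin n → ℝ → ℝ → ℝ) (f : ℝ → ℝ → EVec n → EVec n)
    (φ : ℝ → EVec n) (h : ℝ → EVec n → EVec n) : EVec n :=
  derivWithin (fun t => h t (outVec k (φ 0) (φ 1))) (Ici 0) 0 +
    fderiv ℝ (h 0) (outVec k (φ 0) (φ 1))
      (outVec k (initialRate lam f φ 0) (initialRate lam f φ 1))

/-- The first-order compatibility conditions. -/
def CompatOne {n : ℕ} (k : ℕ) (lam : Fin n → ℝ → ℝ → ℝ) (f : ℝ → ℝ → EVec n → EVec n)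
    (φ : ℝ → EVec n) (h : ℝ → EVec n → EVec n) : Prop :=
  ∀ i : Fin n,
    (k ≤ (i : ℕ) → initialRate lam f φ 0 i = boundaryRate k lam f φ h i) ∧
    ((i : ℕ) < k → initialRate lam f φ 1 i = boundaryRate k lam f φ h i)

/-- `u` is a classical solution of the initial-boundary problem in `Π`: it is continuous on the
closure of `Π`, `C¹` in `Π`, and satisfies the system, the initial and the boundary conditions
pointwise. -/
structure IsClassicalSolution {n : ℕ} (k : ℕ) (lam : Fin n → ℝ → ℝ → ℝ)
    (f : ℝ → ℝ → EVec n → EVec n) (φ : ℝ → EVec n) (h : ℝ → EVec n → EVec n)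
    (u : ℝ × ℝ → EVec n) : Prop where
  cont : ContinuousOn u stripBar
  smooth : ContDiffOn ℝ 1 u strip
  system : ∀ x t, (x, t) ∈ strip → ∀ i : Fin n,
    deriv (fun s => u (x, s) i) t + lam i x t * deriv (fun ξ => u (ξ, t) i) x
      = f x t (u (x, t)) i
  initial : ∀ x ∈ Ioo (0 : ℝ) 1, u (x, 0) = φ x
  left : ∀ t, 0 < t → ∀ i : Fin n, k ≤ (i : ℕ) →
    u (0, t) i = h t (outVec k (u (0, t)) (u (1, t))) i
  right : ∀ t, 0 < t → ∀ i : Fin n, (i : ℕ) < k →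
    u (1, t) i = h t (outVec k (u (0, t)) (u (1, t))) i

end

/-!
Global classical solvability of an initial-boundary problem for a first-order semilinear hyperbolic
system on a half-strip.

Reflecting `x ↦ 1 - x` in the components of negative speed makes every component enter at `x = 0`
and leave at `x = 1`; the boundary condition then expresses the entering values by the leaving ones
(`RectProblem`). On a rectangle of height `T` the problem is equivalent to a fixed point equation
for `RectProblem.step`, which integrates the sources along the characteristics (`CharFlow`).

The norm `sup |U_i(x,t)| e^{α x - μ t}` makes this map a contraction on functions with bounded
values, whatever the Lipschitz constant `K` of the data (`CharFlow.abs_integral_le`): leaving values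
carry the weight `e^{-α}`, so `e^α ~ K` disposes of the boundary condition, and integration in time
gains a factor `1 / μ`, so `μ ~ K e^α ~ K²` disposes of the source. The Lipschitz constant depends
on the size of `U`, which may reach `R e^{μ T}`. The growth condition bounds it by a multiple of
`(log R + μ T)^{1/4} ~ K^{1/2}`, hence for `K` large the ball of radius `R` is invariant
(`exists_invariant_radius`). No truncation of the data is needed, and the bound on the solution
excludes blow-up.

The Picard iterates are continuously differentiable because of the compatibility conditions at the
corner (`RectProblem.exists_smooth_step`). Their derivatives satisfy a linear recursion with
coefficients determined by the iterates, and the same weighted estimate shows that they converge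
uniformly (`RectProblem.uniformCauchySeqOn_iterx`). So the limit is a fixed point with continuous
derivatives, and a last application of the iteration makes it `C¹` in both variables.

Conversely every classical solution is a fixed point, by integration along characteristics, and
fixed points are unique (`IsSolutionOn.eqOn`). Therefore the solutions on rectangles of growing
height agree and fit together to the global one.
-/

noncomputable section

/-! ### Calculus with partial derivatives -/

open Filter Topology Asymptotics in
theorem isLittleO_sub_sub_partial {E G : Type*} [NormedAddCommGroup E] [NormedSpace ℝ E]
    [NormedAddCommGroup G] [NormedSpace ℝ G] {F : ℝ → E → G} {Fy : ℝ → E → E →L[ℝ] G}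
    (hy : ∀ χ y, HasFDerivAt (F χ) (Fy χ y) y)
    (hc : Continuous fun p : ℝ × E => Fy p.1 p.2)
    {u : ℝ → E} {u₀ : E} {x : ℝ} {l : Filter ℝ} (hl : l ≤ 𝓝 x) (hu : Tendsto u l (𝓝 u₀)) :
    (fun χ => F χ (u χ) - F χ u₀ - Fy x u₀ (u χ - u₀)) =o[l] (fun χ => u χ - u₀) := by
  rw [isLittleO_iff]
  intro ε hε
  have h0 : ContinuousAt (fun p : ℝ × E => Fy p.1 p.2) (x, u₀) := hc.continuousAt
  rw [Metric.continuousAt_iff] at h0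
  obtain ⟨δ, hδ, h0⟩ := h0 ε hε
  have h1 : ∀ᶠ χ in l, dist χ x < δ := hl (Metric.ball_mem_nhds x hδ)
  have h2 : ∀ᶠ χ in l, dist (u χ) u₀ < δ := hu (Metric.ball_mem_nhds u₀ hδ)
  filter_upwards [h1, h2] with χ h1 h2
  refine Convex.norm_image_sub_le_of_norm_hasFDerivWithin_le' (s := Metric.ball u₀ δ)
    (f' := fun y => Fy χ y) (fun y _ => (hy χ y).hasFDerivWithinAt) ?_ (convex_ball u₀ δ)
    (Metric.mem_ball_self hδ) h2
  intro y hyb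
  have := h0 (x := (χ, y)) (by rw [Prod.dist_eq]; exact max_lt h1 hyb)
  rw [dist_eq_norm] at this
  exact this.le

open Filter Topology Asymptotics in
/-- Chain rule for `χ ↦ F χ (u χ)` where `F` has a one-sided partial derivative in `χ` and a
partial derivative in the second variable which is jointly continuous. -/
theorem HasDerivWithinAt.comp_partial {E G : Type*} [NormedAddCommGroup E] [NormedSpace ℝ E]
    [NormedAddCommGroup G] [NormedSpace ℝ G] {F : ℝ → E → G} {Fy : ℝ → E → E →L[ℝ] G} {Fx : G}
    {u : ℝ → E} {u' : E} {s : Set ℝ} {x : ℝ}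
    (hx : HasDerivWithinAt (fun χ => F χ (u x)) Fx s x)
    (hy : ∀ χ y, HasFDerivAt (F χ) (Fy χ y) y)
    (hc : Continuous fun p : ℝ × E => Fy p.1 p.2)
    (hu : HasDerivWithinAt u u' s x) :
    HasDerivWithinAt (fun χ => F χ (u χ)) (Fx + Fy x (u x) u') s x := by
  have h1 := isLittleO_sub_sub_partial hy hc nhdsWithin_le_nhds hu.continuousWithinAt.tendsto
  rw [hasDerivWithinAt_iff_isLittleO] at hx hu ⊢
  have h2 : (fun χ => u χ - u x) =O[𝓝[s] x] fun χ => χ - x := by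
    have : (fun χ => (χ - x) • u') =O[𝓝[s] x] fun χ => χ - x :=
      IsBigO.of_bound ‖u'‖ (Eventually.of_forall fun χ => by rw [norm_smul, mul_comm])
    simpa using hu.isBigO.add this
  have h3 : (fun χ => Fy x (u x) (u χ - u x - (χ - x) • u')) =o[𝓝[s] x] fun χ => χ - x :=
    ((Fy x (u x)).isBigO_comp _ _).trans_isLittleO hu
  have := ((h1.trans_isBigO h2).add h3).add hx
  refine this.congr_left fun χ => ?_
  simp only [map_sub, map_smul, smul_add]
  abel

theorem continuous_toSpanSingleton {X : Type*} [TopologicalSpace X] {a : X → ℝ}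
    (ha : Continuous a) :
    Continuous fun p => ContinuousLinearMap.toSpanSingleton ℝ (a p) := by
  have : (fun p => ContinuousLinearMap.toSpanSingleton ℝ (a p))
      = fun p => a p • ContinuousLinearMap.toSpanSingleton ℝ (1 : ℝ) := by
    funext p
    ext
    simp
  rw [this]
  exact ha.smul continuous_const

theorem hasStrictFDerivAt_of_partials {F Fx Fy : ℝ → ℝ → ℝ}
    (hx : ∀ x y, HasDerivAt (fun χ => F χ y) (Fx x y) x)
    (hy : ∀ x y, HasDerivAt (F x) (Fy x y) y)
    (hcx : Continuous fun p : ℝ × ℝ => Fx p.1 p.2)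
    (hcy : Continuous fun p : ℝ × ℝ => Fy p.1 p.2) (p : ℝ × ℝ) :
    HasStrictFDerivAt (fun p : ℝ × ℝ => F p.1 p.2)
      ((ContinuousLinearMap.toSpanSingleton ℝ (Fx p.1 p.2)).coprod
        (ContinuousLinearMap.toSpanSingleton ℝ (Fy p.1 p.2))) p := by
  have := hasStrictFDerivAt_uncurry_coprod (𝕜 := ℝ) (u := p) (f := F)
    (f₁ := fun x y => ContinuousLinearMap.toSpanSingleton ℝ (Fx x y))
    (f₂ := fun x y => ContinuousLinearMap.toSpanSingleton ℝ (Fy x y))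
    (Filter.Eventually.of_forall fun v => (hx v.1 v.2).hasFDerivAt)
    (Filter.Eventually.of_forall fun v => (hy v.1 v.2).hasFDerivAt)
    (continuous_toSpanSingleton hcx).continuousAt (continuous_toSpanSingleton hcy).continuousAt
  exact this

theorem contDiff_one_of_partials {F Fx Fy : ℝ → ℝ → ℝ}
    (hx : ∀ x y, HasDerivAt (fun χ => F χ y) (Fx x y) x)
    (hy : ∀ x y, HasDerivAt (F x) (Fy x y) y)
    (hcx : Continuous fun p : ℝ × ℝ => Fx p.1 p.2)
    (hcy : Continuous fun p : ℝ × ℝ => Fy p.1 p.2) :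
    ContDiff ℝ 1 (fun p : ℝ × ℝ => F p.1 p.2) := by
  rw [contDiff_one_iff_hasFDerivAt]
  refine ⟨_, ?_, fun p => (hasStrictFDerivAt_of_partials hx hy hcx hcy p).hasFDerivAt⟩
  have e : (fun p : ℝ × ℝ => (ContinuousLinearMap.toSpanSingleton ℝ (Fx p.1 p.2)).coprod
      (ContinuousLinearMap.toSpanSingleton ℝ (Fy p.1 p.2)))
      = fun p => Fx p.1 p.2 • ContinuousLinearMap.fst ℝ ℝ ℝ
        + Fy p.1 p.2 • ContinuousLinearMap.snd ℝ ℝ ℝ := by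
    funext p
    ext <;> simp
  rw [e]
  exact (hcx.smul continuous_const).add (hcy.smul continuous_const)

theorem HasDerivAt.comp_partials {F Fx Fy : ℝ → ℝ → ℝ} {a b : ℝ → ℝ} {a' b' s : ℝ}
    (hx : ∀ x y, HasDerivAt (fun χ => F χ y) (Fx x y) x)
    (hy : ∀ x y, HasDerivAt (F x) (Fy x y) y)
    (hcx : Continuous fun p : ℝ × ℝ => Fx p.1 p.2)
    (hcy : Continuous fun p : ℝ × ℝ => Fy p.1 p.2)
    (ha : HasDerivAt a a' s) (hb : HasDerivAt b b' s) :
    HasDerivAt (fun s => F (a s) (b s)) (Fx (a s) (b s) * a' + Fy (a s) (b s) * b') s := by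
  have := (hasStrictFDerivAt_of_partials hx hy hcx hcy (a s, b s)).hasFDerivAt.comp_hasDerivAt s
    (ha.prodMk hb)
  simpa [Function.comp_def, mul_comm] using this

open Filter Topology Asymptotics in
/-- Implicit differentiation of a continuous function `a` with `F (a s) s` constant. -/
theorem HasDerivAt.of_implicit {F Fx Fy : ℝ → ℝ → ℝ} {a : ℝ → ℝ} {s c : ℝ}
    (hx : ∀ x y, HasDerivAt (fun χ => F χ y) (Fx x y) x)
    (hy : ∀ x y, HasDerivAt (F x) (Fy x y) y)
    (hcx : Continuous fun p : ℝ × ℝ => Fx p.1 p.2)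
    (ha : ContinuousAt a s) (hF : ∀ s, F (a s) s = c) (h0 : Fx (a s) s ≠ 0) :
    HasDerivAt a (-Fy (a s) s / Fx (a s) s) s := by
  have h1 := isLittleO_sub_sub_partial (F := fun y x => F x y)
    (Fy := fun y x => ContinuousLinearMap.toSpanSingleton ℝ (Fx x y))
    (fun y x => (hx x y).hasFDerivAt) (continuous_toSpanSingleton (hcx.comp continuous_swap))
    (le_refl (𝓝 s)) ha.tendsto
  have h2 := hy (a s) s
  rw [hasDerivAt_iff_isLittleO] at h2 ⊢
  set A := Fx (a s) s with hA
  set B := Fy (a s) s with hB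
  set P : ℝ → ℝ := fun t => F (a s) t - F (a s) s with hP
  have h3 : (fun t => -P t - A * (a t - a s)) =o[𝓝 s] fun t => A * (a t - a s) := by
    refine (h1.congr_left fun t => ?_).trans_isBigO (isBigO_const_mul_self A⁻¹ _ _ |>.congr_left
      fun t => ?_)
    · simp only [hP, ContinuousLinearMap.toSpanSingleton_apply, smul_eq_mul]
      rw [hF t, ← hF s]
      ring
    · field_simp
  have h4 : (fun t => A * (a t - a s)) =O[𝓝 s] fun t => t - s := by
    have : IsEquivalent (𝓝 s) (fun t => -P t) (fun t => A * (a t - a s)) := h3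
    refine this.isBigO_symm.trans ?_
    have h5 : (fun t => (t - s) • B) =O[𝓝 s] fun t => t - s :=
      IsBigO.of_bound ‖B‖ (Eventually.of_forall fun χ => by rw [norm_smul, mul_comm])
    have := (h2.isBigO.add h5).neg_left
    refine this.congr_left fun t => ?_
    simp only [hP]; ring
  have h6 := ((h3.trans_isBigO h4).add h2).const_mul_left (-A⁻¹)
  refine h6.congr_left fun t => ?_
  simp only [hP, smul_eq_mul]
  field_simp
  ring

/-! ### Extension from an interval and limits of derivatives -/

/-- The nearest point to `x` in `[a, b]`. -/
def clamp (a b x : ℝ) : ℝ := max a (min b x)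

theorem clamp_mem {a b : ℝ} (hab : a ≤ b) (x : ℝ) : clamp a b x ∈ Icc a b :=
  ⟨le_max_left _ _, max_le hab (min_le_left _ _)⟩

theorem clamp_of_mem {a b x : ℝ} (hx : x ∈ Icc a b) : clamp a b x = x := by
  rw [clamp, min_eq_right hx.2, max_eq_right hx.1]

@[fun_prop]
theorem continuous_clamp (a b : ℝ) : Continuous (clamp a b) :=
  continuous_const.max (continuous_const.min continuous_id)

theorem ContinuousOn.comp_clamp {a b : ℝ} (hab : a ≤ b) {F : ℝ → ℝ}
    (hF : ContinuousOn F (Icc a b)) :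
    Continuous fun x => F (clamp a b x) :=
  hF.comp_continuous (continuous_clamp a b) (clamp_mem hab)

/-- A function on `ℝ` which has the given one-sided derivatives on the two rays and on the interval
cut out by `a < b` is differentiable. -/
theorem hasDerivAt_of_three_pieces {a b : ℝ} (hab : a < b) {F : ℝ → ℝ} {F' : ℝ → ℝ}
    (hl : ∀ x ≤ a, HasDerivWithinAt F (F' x) (Iic a) x)
    (hm : ∀ x ∈ Icc a b, HasDerivWithinAt F (F' x) (Icc a b) x)
    (hr : ∀ x, b ≤ x → HasDerivWithinAt F (F' x) (Ici b) x) (x : ℝ) :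
    HasDerivAt F (F' x) x := by
  rcases lt_trichotomy x a with h | h | h
  · exact (hl x h.le).hasDerivAt (Iic_mem_nhds h)
  · subst h
    refine ((hl x le_rfl).union (hm x (left_mem_Icc.2 hab.le))).hasDerivAt ?_
    rw [Iic_union_Icc_eq_Iic hab.le]
    exact Iic_mem_nhds hab
  · rcases lt_trichotomy x b with h' | h' | h'
    · exact (hm x ⟨h.le, h'.le⟩).hasDerivAt (Icc_mem_nhds h h')
    · subst h'
      refine ((hm x (right_mem_Icc.2 hab.le)).union (hr x le_rfl)).hasDerivAt ?_
      rw [Icc_union_Ici_eq_Ici hab.le]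
      exact Ici_mem_nhds hab
    · exact (hr x h'.le).hasDerivAt (Ici_mem_nhds h')

theorem clamp_of_le {a b x : ℝ} (hab : a ≤ b) (hx : x ≤ a) : clamp a b x = a := by
  rw [clamp, min_eq_right (hx.trans hab), max_eq_left hx]

theorem clamp_of_ge {a b x : ℝ} (hab : a ≤ b) (hx : b ≤ x) : clamp a b x = b := by
  rw [clamp, min_eq_left hx, max_eq_right hab]

/-- The extension of `G` from `[a, b]` by its tangents at the two ends. -/
theorem hasDerivAt_clamp_ext {a b : ℝ} (hab : a < b) {G G' : ℝ → ℝ}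
    (hG : ∀ x ∈ Icc a b, HasDerivWithinAt G (G' x) (Icc a b) x) (x : ℝ) :
    HasDerivAt (fun x => G (clamp a b x) + (x - clamp a b x) * G' (clamp a b x))
      (G' (clamp a b x)) x := by
  refine hasDerivAt_of_three_pieces hab (F' := fun x => G' (clamp a b x)) ?_ ?_ ?_ x
  · intro x hx
    rw [clamp_of_le hab.le hx]
    have : HasDerivWithinAt (fun x => G a + (x - a) * G' a) (G' a) (Iic a) x := by
      simpa using
        ((((hasDerivAt_id x).sub_const a).mul_const (G' a)).const_add (G a)).hasDerivWithinAt
    refine this.congr_of_mem (fun y hy => ?_) hx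
    rw [clamp_of_le hab.le hy]
  · intro x hx
    rw [clamp_of_mem hx]
    refine (hG x hx).congr_of_mem (fun y hy => ?_) hx
    rw [clamp_of_mem hy]; ring
  · intro x hx
    rw [clamp_of_ge hab.le hx]
    have : HasDerivWithinAt (fun x => G b + (x - b) * G' b) (G' b) (Ici b) x := by
      simpa using
        ((((hasDerivAt_id x).sub_const b).mul_const (G' b)).const_add (G b)).hasDerivWithinAt
    refine this.congr_of_mem (fun y hy => ?_) hx
    rw [clamp_of_ge hab.le hy]

open Filter Topology in
/-- The uniform limit of derivatives on a compact interval is the derivative of the limit. -/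
theorem hasDerivWithinAt_of_tendstoUniformlyOn {a b : ℝ} (hab : a ≤ b) {F F' : ℕ → ℝ → ℝ}
    {G G' : ℝ → ℝ}
    (hF : ∀ m, ∀ x ∈ Icc a b, HasDerivWithinAt (F m) (F' m x) (Icc a b) x)
    (hF' : ∀ m, ContinuousOn (F' m) (Icc a b))
    (hG : ∀ x ∈ Icc a b, Tendsto (fun m => F m x) atTop (𝓝 (G x)))
    (hG' : TendstoUniformlyOn F' G' atTop (Icc a b)) :
    ∀ x ∈ Icc a b, HasDerivWithinAt G (G' x) (Icc a b) x := by
  have hcont : ContinuousOn G' (Icc a b) :=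
    hG'.continuousOn (Frequently.of_forall hF')
  have key : ∀ x ∈ Icc a b, G x = G a + ∫ s in a..x, G' (clamp a b s) := by
    intro x hx
    have h1 : ∀ m, F m x = F m a + ∫ s in a..x, F' m s := by
      intro m
      rw [intervalIntegral.integral_eq_sub_of_hasDeriv_right_of_le hx.1 (f := F m)]
      · ring
      · exact fun y hy => ((hF m y ⟨hy.1, hy.2.trans hx.2⟩).continuousWithinAt).mono
          (Icc_subset_Icc_right hx.2)
      · intro y hy
        exact ((hF m y ⟨hy.1.le, hy.2.le.trans hx.2⟩).hasDerivAt
          (Icc_mem_nhds hy.1 (hy.2.trans_le hx.2))).hasDerivWithinAt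
      · exact ((hF' m).mono (Icc_subset_Icc_right hx.2)).intervalIntegrable_of_Icc hx.1
    have hsub : uIcc a x ⊆ Icc a b := by
      rw [uIcc_of_le hx.1]; exact Icc_subset_Icc_right hx.2
    have h2 : Tendsto (fun m => ∫ s in a..x, F' m s) atTop (𝓝 (∫ s in a..x, G' s)) :=
      TendstoUniformlyOn.tendsto_intervalIntegral_of_continuousOn
        (Eventually.of_forall fun m => (hF' m).mono hsub) (hG'.mono hsub)
    have h3 : ∫ s in a..x, G' (clamp a b s) = ∫ s in a..x, G' s :=
      intervalIntegral.integral_congr fun s hs => by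
        rw [clamp_of_mem (hsub hs)]
    rw [h3]
    refine tendsto_nhds_unique (hG x hx) ?_
    simp_rw [h1]
    exact (hG a (left_mem_Icc.2 hab)).add h2
  intro x hx
  have hc : Continuous fun s => G' (clamp a b s) := hcont.comp_clamp hab
  have h4 : HasDerivAt (fun x => G a + ∫ s in a..x, G' (clamp a b s)) (G' (clamp a b x)) x :=
    (intervalIntegral.integral_hasDerivAt_right (hc.intervalIntegrable _ _)
      (hc.stronglyMeasurableAtFilter _ _) hc.continuousAt).const_add _
  rw [clamp_of_mem hx] at h4
  exact h4.hasDerivWithinAt.congr_of_mem key hx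

/-! ### Characteristics of a scalar speed -/

/-- A positive speed `l` on the whole plane, bounded above and below, with bounded continuous
`x`-derivative `lx`. -/
structure IsSpeed (l lx : ℝ → ℝ → ℝ) (l₀ Λ D : ℝ) : Prop where
  cont : Continuous fun p : ℝ × ℝ => l p.1 p.2
  contx : Continuous fun p : ℝ × ℝ => lx p.1 p.2
  deriv : ∀ x t, HasDerivAt (fun x => l x t) (lx x t) x
  pos : 0 < l₀
  lower : ∀ x t, l₀ ≤ l x t
  upper : ∀ x t, l x t ≤ Λ
  bound : ∀ x t, |lx x t| ≤ D

/-- The characteristics of the speed `l`, labelled by their position at time `0`: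
`Ψ y t` is the position at time `t` of the characteristic `y`, `J = ∂Ψ/∂y`, `Y x t` is the label of
the characteristic through `(x, t)`, and `τ y` is the (possibly negative) time at which the
characteristic `y` crosses `x = 0`. -/
structure CharFlow (l : ℝ → ℝ → ℝ) (l₀ Λ D : ℝ) where
  Ψ : ℝ → ℝ → ℝ
  J : ℝ → ℝ → ℝ
  Y : ℝ → ℝ → ℝ
  τ : ℝ → ℝ
  zero : ∀ y, Ψ y 0 = y
  deriv_t : ∀ y t, HasDerivAt (Ψ y) (l (Ψ y t) t) t
  deriv_y : ∀ y t, HasDerivAt (fun y => Ψ y t) (J y t) y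
  contΨ : Continuous fun p : ℝ × ℝ => Ψ p.1 p.2
  contJ : Continuous fun p : ℝ × ℝ => J p.1 p.2
  contY : Continuous fun p : ℝ × ℝ => Y p.1 p.2
  contτ : Continuous τ
  J_pos : ∀ y t, 0 < J y t
  J_zero : ∀ y, J y 0 = 1
  J_le : ∀ y s t, s ≤ t → J y s ≤ Real.exp (D * (t - s)) * J y t
  ΨY : ∀ x t, Ψ (Y x t) t = x
  YΨ : ∀ y t, Y (Ψ y t) t = y
  Ψτ : ∀ y, Ψ y (τ y) = 0
  le_sub : ∀ y s t, s ≤ t → l₀ * (t - s) ≤ Ψ y t - Ψ y s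
  sub_le : ∀ y s t, s ≤ t → Ψ y t - Ψ y s ≤ Λ * (t - s)

namespace IsSpeed

variable {l lx : ℝ → ℝ → ℝ} {l₀ Λ D : ℝ}

theorem lipschitz (h : IsSpeed l lx l₀ Λ D) (t : ℝ) :
    LipschitzWith (Real.toNNReal D) (fun x => l x t) := by
  refine lipschitzWith_of_nnnorm_deriv_le (fun x => (h.deriv x t).differentiableAt) fun x => ?_
  rw [(h.deriv x t).deriv, ← NNReal.coe_le_coe, coe_nnnorm, Real.coe_toNNReal']
  exact (h.bound x t).trans (le_max_left _ _)

theorem exists_local_curve (h : IsSpeed l lx l₀ Λ D) (y N : ℝ) (hN : 0 ≤ N) :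
    ∃ α : ℝ → ℝ, α 0 = y ∧
      ∀ t ∈ Icc (-N) N, HasDerivWithinAt α (l (α t) t) (Icc (-N) N) t := by
  have hΛ : 0 ≤ Λ := (h.pos.le.trans (h.lower 0 0)).trans (h.upper 0 0)
  have h0 : (0 : ℝ) ∈ Icc (-N) N := ⟨by linarith, hN⟩
  have : IsPicardLindelof (fun t x => l x t) (⟨0, h0⟩ : Icc (-N) N) y
      (Real.toNNReal (Λ * N)) 0 (Real.toNNReal Λ) (Real.toNNReal D) := by
    refine ⟨fun t _ => (h.lipschitz t).lipschitzOnWith, fun x _ => ?_, fun t _ x _ => ?_, ?_⟩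
    · exact (h.cont.comp (continuous_const.prodMk continuous_id)).continuousOn
    · rw [Real.coe_toNNReal _ hΛ, Real.norm_eq_abs, abs_of_nonneg (h.pos.le.trans (h.lower x t))]
      exact h.upper x t
    · rw [Real.coe_toNNReal _ hΛ, Real.coe_toNNReal _ (mul_nonneg hΛ hN)]
      simp
  exact this.exists_eq_forall_mem_Icc_hasDerivWithinAt₀

theorem exists_curve (h : IsSpeed l lx l₀ Λ D) (y : ℝ) :
    ∃ α : ℝ → ℝ, α 0 = y ∧ ∀ t, HasDerivAt α (l (α t) t) t := by
  choose α hα0 hα using fun N : ℕ => h.exists_local_curve y (N + 1) (by positivity)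
  have hd : ∀ N : ℕ, ∀ t ∈ Ioo (-((N : ℝ) + 1)) (N + 1), HasDerivAt (α N) (l (α N t) t) t :=
    fun N t ht => (hα N t (Ioo_subset_Icc_self ht)).hasDerivAt (Icc_mem_nhds ht.1 ht.2)
  have heq : ∀ N M : ℕ, N ≤ M → ∀ t ∈ Ioo (-((N : ℝ) + 1)) (N + 1), α N t = α M t := by
    intro N M hNM t ht
    have hc : (N : ℝ) ≤ M := by exact_mod_cast hNM
    refine ODE_solution_unique_of_mem_Ioo (v := fun t x => l x t) (s := fun _ => univ)
      (K := Real.toNNReal D) (t₀ := 0) (fun t _ => (h.lipschitz t).lipschitzOnWith)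
      (by constructor <;> [(have := N.cast_nonneg (α := ℝ); linarith); positivity])
      (fun t ht => ⟨hd N t ht, trivial⟩)
      (fun t ht => ⟨hd M t ⟨by linarith [ht.1], by linarith [ht.2]⟩, trivial⟩) ?_ ht
    rw [hα0, hα0]
  have hmem : ∀ t : ℝ, t ∈ Ioo (-((⌈|t|⌉₊ : ℝ) + 1)) (⌈|t|⌉₊ + 1) := by
    intro t
    have := Nat.le_ceil |t|
    have := abs_le.1 this
    exact ⟨by linarith [this.1], by linarith [this.2]⟩
  have heq' : ∀ N : ℕ, ∀ t ∈ Ioo (-((N : ℝ) + 1)) (N + 1), α ⌈|t|⌉₊ t = α N t := by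
    intro N t ht
    rcases le_total ⌈|t|⌉₊ N with hN | hN
    · exact heq _ _ hN t (hmem t)
    · exact (heq _ _ hN t ht).symm
  refine ⟨fun t => α ⌈|t|⌉₊ t, by simpa using hα0 0, fun t => ?_⟩
  refine (hd _ t (hmem t)).congr_of_eventuallyEq ?_
  filter_upwards [Ioo_mem_nhds (hmem t).1 (hmem t).2] with s hs
  exact heq' _ s hs

/-- The divided difference `(l p s - l q s) / (p - q)`, as a continuous function. -/
def meanSlope (lx : ℝ → ℝ → ℝ) (p q s : ℝ) : ℝ := ∫ θ in (0 : ℝ)..1, lx (q + θ * (p - q)) s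

theorem continuous_meanSlope (h : IsSpeed l lx l₀ Λ D) {X : Type*} [TopologicalSpace X]
    [FirstCountableTopology X] {p q s : X → ℝ}
    (hp : Continuous p) (hq : Continuous q) (hs : Continuous s) :
    Continuous fun x => meanSlope lx (p x) (q x) (s x) := by
  refine intervalIntegral.continuous_parametric_intervalIntegral_of_continuous' ?_ 0 1
  exact h.contx.comp (f := fun z : X × ℝ => (q z.1 + z.2 * (p z.1 - q z.1), s z.1)) (by fun_prop)

theorem sub_eq_meanSlope (h : IsSpeed l lx l₀ Λ D) (p q s : ℝ) :
    l p s - l q s = (p - q) * meanSlope lx p q s := by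
  have h1 : ∀ θ : ℝ, HasDerivAt (fun θ => l (q + θ * (p - q)) s)
      (lx (q + θ * (p - q)) s * (p - q)) θ := fun θ => by
    have h2 : HasDerivAt (fun θ : ℝ => q + θ * (p - q)) (p - q) θ := by
      simpa using ((hasDerivAt_id θ).mul_const (p - q)).const_add q
    exact (h.deriv (q + θ * (p - q)) s).comp θ h2
  have hc : Continuous fun θ : ℝ => lx (q + θ * (p - q)) s * (p - q) :=
    (h.contx.comp (f := fun θ : ℝ => (q + θ * (p - q), s)) (by fun_prop)).mul continuous_const
  have := intervalIntegral.integral_eq_sub_of_hasDerivAt (a := 0) (b := 1)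
    (fun θ _ => h1 θ) (hc.intervalIntegrable _ _)
  rw [intervalIntegral.integral_mul_const] at this
  rw [meanSlope, mul_comm, this]
  simp

theorem abs_meanSlope_le (h : IsSpeed l lx l₀ Λ D) (p q s : ℝ) : |meanSlope lx p q s| ≤ D := by
  have := intervalIntegral.norm_integral_le_of_norm_le_const (a := 0) (b := 1) (C := D)
    (f := fun θ => lx (q + θ * (p - q)) s) (fun θ _ => h.bound _ _)
  simpa [meanSlope] using this

theorem abs_integral_le_mul {f : ℝ → ℝ} (hf : ∀ s, |f s| ≤ D) (s t : ℝ) :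
    |∫ r in s..t, f r| ≤ D * |t - s| := by
  rw [← Real.norm_eq_abs]
  exact intervalIntegral.norm_integral_le_of_norm_le_const (fun r _ => hf r)

/-- The difference of two characteristics solves a linear equation, whence it is the exponential of
an integral; this gives at once Lipschitz dependence on the label and the derivative `J`. -/
theorem flow_sub (h : IsSpeed l lx l₀ Λ D) {α β : ℝ → ℝ}
    (hα : ∀ t, HasDerivAt α (l (α t) t) t) (hβ : ∀ t, HasDerivAt β (l (β t) t) t) (t : ℝ) :
    α t - β t = (α 0 - β 0) * Real.exp (∫ s in (0 : ℝ)..t, meanSlope lx (α s) (β s) s) := by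
  have hαc : Continuous α := continuous_iff_continuousAt.2 fun t => (hα t).continuousAt
  have hβc : Continuous β := continuous_iff_continuousAt.2 fun t => (hβ t).continuousAt
  have hM : Continuous fun s => meanSlope lx (α s) (β s) s :=
    h.continuous_meanSlope hαc hβc continuous_id
  set I : ℝ → ℝ := fun t => ∫ s in (0 : ℝ)..t, meanSlope lx (α s) (β s) s with hI
  have hId : ∀ t, HasDerivAt I (meanSlope lx (α t) (β t) t) t := fun t =>
    intervalIntegral.integral_hasDerivAt_right (hM.intervalIntegrable _ _)
      (hM.stronglyMeasurableAtFilter _ _) hM.continuousAt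
  have hQ : ∀ t, HasDerivAt (fun t => (α t - β t) * Real.exp (-I t)) 0 t := by
    intro t
    have := ((hα t).sub (hβ t)).mul (hId t).neg.exp
    refine this.congr_deriv ?_
    rw [h.sub_eq_meanSlope]
    simp only [Pi.sub_apply]
    ring
  have hconst := is_const_of_deriv_eq_zero (fun t => (hQ t).differentiableAt)
    (fun t => (hQ t).deriv) t 0
  have hI0 : I 0 = 0 := by simp [hI]
  simp only [hI0, neg_zero, Real.exp_zero, mul_one] at hconst
  rw [← hconst, mul_assoc, ← Real.exp_add, neg_add_cancel, Real.exp_zero, mul_one]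

open Filter Topology in
/-- The characteristics of a speed. Each of them crosses `x = 0` once, because the speed is bounded
away from zero, and they fill the plane, because it is bounded. -/
theorem exists_charFlow (h : IsSpeed l lx l₀ Λ D) : Nonempty (CharFlow l l₀ Λ D) := by
  choose Ψ hΨ0 hΨ using h.exists_curve
  set q : ℝ → ℝ → ℝ → ℝ := fun y₁ y₂ t =>
    Real.exp (∫ s in (0 : ℝ)..t, meanSlope lx (Ψ y₁ s) (Ψ y₂ s) s) with hq
  have hsub : ∀ y₁ y₂ t, Ψ y₁ t - Ψ y₂ t = (y₁ - y₂) * q y₁ y₂ t := fun y₁ y₂ t => by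
    rw [h.flow_sub (hΨ y₁) (hΨ y₂) t, hΨ0, hΨ0]
  have hint : ∀ y₁ y₂ t, |∫ s in (0 : ℝ)..t, meanSlope lx (Ψ y₁ s) (Ψ y₂ s) s| ≤ D * |t| :=
    fun y₁ y₂ t => by
      simpa using abs_integral_le_mul (f := fun s => meanSlope lx (Ψ y₁ s) (Ψ y₂ s) s)
        (fun s => h.abs_meanSlope_le _ _ s) 0 t
  have hqle : ∀ y₁ y₂ t, q y₁ y₂ t ≤ Real.exp (D * |t|) := fun y₁ y₂ t =>
    Real.exp_le_exp.2 (abs_le.1 (hint y₁ y₂ t)).2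
  have hleq : ∀ y₁ y₂ t, Real.exp (-(D * |t|)) ≤ q y₁ y₂ t := fun y₁ y₂ t =>
    Real.exp_le_exp.2 (abs_le.1 (hint y₁ y₂ t)).1
  have hqpos : ∀ y₁ y₂ t, 0 < q y₁ y₂ t := fun _ _ _ => Real.exp_pos _
  have hΨt : ∀ y, Continuous (Ψ y) := fun y =>
    continuous_iff_continuousAt.2 fun t => (hΨ y t).continuousAt
  -- joint continuity, from the Lipschitz dependence on the label
  have hΨc : Continuous fun p : ℝ × ℝ => Ψ p.1 p.2 := by
    rw [continuous_iff_continuousAt]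
    rintro ⟨y₀, t₀⟩
    have h1 : Tendsto (fun p : ℝ × ℝ => (p.1 - y₀) * q p.1 y₀ p.2) (𝓝 (y₀, t₀)) (𝓝 0) := by
      refine squeeze_zero_norm (a := fun p : ℝ × ℝ => |p.1 - y₀| * Real.exp (D * |p.2|))
        (fun p => ?_) ?_
      · rw [norm_mul, Real.norm_eq_abs, Real.norm_of_nonneg (hqpos _ _ _).le]
        exact mul_le_mul_of_nonneg_left (hqle _ _ _) (abs_nonneg _)
      · have : Continuous fun p : ℝ × ℝ => |p.1 - y₀| * Real.exp (D * |p.2|) := by fun_prop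
        simpa using this.tendsto (y₀, t₀)
    have h2 : Tendsto (fun p : ℝ × ℝ => Ψ y₀ p.2) (𝓝 (y₀, t₀)) (𝓝 (Ψ y₀ t₀)) :=
      ((hΨt y₀).comp continuous_snd).tendsto (y₀, t₀)
    have h3 := h1.add h2
    rw [zero_add] at h3
    refine h3.congr fun p => ?_
    rw [← hsub]; ring
  have hqc : Continuous fun p : (ℝ × ℝ) × ℝ => q p.1.1 p.1.2 p.2 := by
    refine Real.continuous_exp.comp ?_
    refine intervalIntegral.continuous_parametric_intervalIntegral_of_continuous
      (f := fun (p : (ℝ × ℝ) × ℝ) s => meanSlope lx (Ψ p.1.1 s) (Ψ p.1.2 s) s) ?_ continuous_snd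
    exact h.continuous_meanSlope
      (hΨc.comp (f := fun z : ((ℝ × ℝ) × ℝ) × ℝ => (z.1.1.1, z.2)) (by fun_prop))
      (hΨc.comp (f := fun z : ((ℝ × ℝ) × ℝ) × ℝ => (z.1.1.2, z.2)) (by fun_prop)) continuous_snd
  have hmono_t : ∀ y s t, s ≤ t → l₀ * (t - s) ≤ Ψ y t - Ψ y s := fun y s t hst =>
    (convex_univ.mul_sub_le_image_sub_of_le_deriv (hΨt y).continuousOn
      (fun t _ => (hΨ y t).differentiableAt.differentiableWithinAt)
      (fun t _ => by rw [(hΨ y t).deriv]; exact h.lower _ _) s trivial t trivial hst)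
  have hup_t : ∀ y s t, s ≤ t → Ψ y t - Ψ y s ≤ Λ * (t - s) := fun y s t hst =>
    (convex_univ.image_sub_le_mul_sub_of_deriv_le (hΨt y).continuousOn
      (fun t _ => (hΨ y t).differentiableAt.differentiableWithinAt)
      (fun t _ => by rw [(hΨ y t).deriv]; exact h.upper _ _) s trivial t trivial hst)
  have hsurj_y : ∀ x t, ∃ y, Ψ y t = x := by
    intro x t
    have hc : Continuous fun y => Ψ y t := hΨc.comp (continuous_id.prodMk continuous_const)
    have hb : ∀ y, |Ψ y t - y| ≤ Λ * |t| := by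
      intro y
      have hΛ : l₀ ≤ Λ := (h.lower 0 0).trans (h.upper 0 0)
      have hp := h.pos
      rcases le_total 0 t with ht | ht
      · have h1 := hmono_t y 0 t ht
        have h2 := hup_t y 0 t ht
        rw [hΨ0] at h1 h2
        rw [abs_of_nonneg ht, abs_le]
        constructor <;> nlinarith
      · have h1 := hmono_t y t 0 ht
        have h2 := hup_t y t 0 ht
        rw [hΨ0] at h1 h2
        rw [abs_of_nonpos ht, abs_le]
        constructor <;> nlinarith
    have h1 := (abs_le.1 (hb (x - Λ * |t|))).2
    have h2 := (abs_le.1 (hb (x + Λ * |t|))).1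
    have := intermediate_value_univ (x - Λ * |t|) (x + Λ * |t|) hc
    exact this ⟨by linarith, by linarith⟩
  choose Y hY using hsurj_y
  have hinj_y : ∀ y₁ y₂ t, Ψ y₁ t = Ψ y₂ t → y₁ = y₂ := by
    intro y₁ y₂ t he
    have := hsub y₁ y₂ t
    rw [he, sub_self] at this
    rcases mul_eq_zero.1 this.symm with h1 | h1
    · linarith
    · exact absurd h1 (hqpos _ _ _).ne'
  have hsurj_t : ∀ y, ∃ t, Ψ y t = 0 := by
    intro y
    have hp := h.pos
    have h1 := hmono_t y (-(|y| / l₀)) 0 (by simp; positivity)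
    have h2 := hmono_t y 0 (|y| / l₀) (by positivity)
    rw [hΨ0] at h1 h2
    have e : l₀ * (|y| / l₀) = |y| := by field_simp
    have := intermediate_value_univ (-(|y| / l₀)) (|y| / l₀) (hΨt y)
    exact this ⟨by linarith [le_abs_self y], by linarith [neg_abs_le y]⟩
  choose τ hτ using hsurj_t
  refine ⟨⟨Ψ, fun y t => q y y t, Y, τ, hΨ0, hΨ, ?_, hΨc, ?_, ?_, ?_,
    fun y t => hqpos y y t, ?_, ?_,
    hY, fun y t => hinj_y _ _ t (hY _ _), hτ, hmono_t, hup_t⟩⟩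
  · intro y t
    rw [hasDerivAt_iff_tendsto_slope]
    have h1 : Tendsto (fun y' => q y' y t) (𝓝[≠] y) (𝓝 (q y y t)) :=
      ((hqc.comp (f := fun y' : ℝ => ((y', y), t)) (by fun_prop)).tendsto y).mono_left
        nhdsWithin_le_nhds
    refine h1.congr' ?_
    filter_upwards [self_mem_nhdsWithin] with y' hy'
    have : y' - y ≠ 0 := sub_ne_zero.2 hy'
    rw [slope_def_field, hsub]
    field_simp
  · exact hqc.comp (f := fun p : ℝ × ℝ => ((p.1, p.1), p.2)) (by fun_prop)
  · rw [continuous_iff_continuousAt]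
    rintro ⟨x₀, t₀⟩
    rw [ContinuousAt, tendsto_iff_norm_sub_tendsto_zero]
    refine squeeze_zero (fun _ => norm_nonneg _)
      (g := fun p : ℝ × ℝ => Real.exp (D * |p.2|) * |p.1 - Ψ (Y x₀ t₀) p.2|) (fun p => ?_) ?_
    · have h1 := hsub (Y p.1 p.2) (Y x₀ t₀) p.2
      rw [hY] at h1
      rw [h1, abs_mul, abs_of_pos (hqpos _ _ _), Real.norm_eq_abs]
      have h2 := mul_le_mul_of_nonneg_left (hleq (Y p.1 p.2) (Y x₀ t₀) p.2)
        (mul_nonneg (Real.exp_pos (D * |p.2|)).le (abs_nonneg (Y p.1 p.2 - Y x₀ t₀)))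
      have h3 : Real.exp (D * |p.2|) * Real.exp (-(D * |p.2|)) = 1 := by
        rw [← Real.exp_add]; simp
      calc |Y p.1 p.2 - Y x₀ t₀|
          = Real.exp (D * |p.2|) * |Y p.1 p.2 - Y x₀ t₀| * Real.exp (-(D * |p.2|)) := by
            rw [mul_right_comm, h3, one_mul]
        _ ≤ _ := by rw [← mul_assoc]; exact h2
    · have hc : Continuous fun p : ℝ × ℝ => Real.exp (D * |p.2|) * |p.1 - Ψ (Y x₀ t₀) p.2| := by
        have := (hΨt (Y x₀ t₀)).comp (continuous_snd (X := ℝ) (Y := ℝ))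
        have h2 : Continuous fun p : ℝ × ℝ => Ψ (Y x₀ t₀) p.2 := this
        fun_prop
      have := hc.tendsto (x₀, t₀)
      simpa [hY] using this
  · rw [continuous_iff_continuousAt]
    intro y₀
    rw [ContinuousAt, tendsto_iff_norm_sub_tendsto_zero]
    refine squeeze_zero (fun _ => norm_nonneg _) (g := fun y => |Ψ y (τ y₀)| / l₀)
      (fun y => ?_) ?_
    · rw [le_div_iff₀ h.pos, Real.norm_eq_abs]
      rcases le_total (τ y) (τ y₀) with ht | ht
      · have := hmono_t y _ _ ht
        rw [hτ] at this
        rw [abs_of_nonpos (by linarith)]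
        exact le_trans (by linarith) (le_abs_self _)
      · have := hmono_t y _ _ ht
        rw [hτ] at this
        rw [abs_of_nonneg (by linarith)]
        exact le_trans (by linarith) (neg_le_abs _)
    · have hc : Continuous fun y => |Ψ y (τ y₀)| / l₀ :=
        (hΨc.comp (continuous_id.prodMk continuous_const)).abs.div_const _
      have := hc.tendsto y₀
      simpa [hτ] using this
  · intro y; simp [hq]
  · intro y s t hst
    simp only [hq]
    rw [← Real.exp_add]
    refine Real.exp_le_exp.2 ?_
    have hM : Continuous fun s => meanSlope lx (Ψ y s) (Ψ y s) s :=
      h.continuous_meanSlope (hΨt y) (hΨt y) continuous_id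
    have h1 := intervalIntegral.integral_add_adjacent_intervals
      (hM.intervalIntegrable (μ := MeasureTheory.volume) 0 s) (hM.intervalIntegrable s t)
    have h2 := abs_integral_le_mul (f := fun s => meanSlope lx (Ψ y s) (Ψ y s) s)
        (fun s => h.abs_meanSlope_le _ _ s) s t
    rw [abs_of_nonneg (sub_nonneg.2 hst)] at h2
    have := (abs_le.1 h2).1
    linarith

end IsSpeed

/-! ### The scalar transport problem -/

namespace CharFlow

variable {l lx : ℝ → ℝ → ℝ} {l₀ Λ D : ℝ}

/-- The time at which the characteristic `y` enters the quadrant `x ≥ 0`, `t ≥ 0`. -/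
def entry (c : CharFlow l l₀ Λ D) (y : ℝ) : ℝ := max (c.τ y) 0

theorem entry_nonneg (c : CharFlow l l₀ Λ D) (y : ℝ) : 0 ≤ c.entry y := le_max_right _ _

@[fun_prop]
theorem continuous_entry (c : CharFlow l l₀ Λ D) : Continuous c.entry :=
  c.contτ.max continuous_const

theorem lt_of_lt (c : CharFlow l l₀ Λ D) (h : IsSpeed l lx l₀ Λ D) {y s t : ℝ}
    (hst : s < t) : c.Ψ y s < c.Ψ y t := by
  have := c.le_sub y s t hst.le
  have := mul_pos h.pos (sub_pos.2 hst)
  linarith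

theorem le_of_Ψ_le (c : CharFlow l l₀ Λ D) (h : IsSpeed l lx l₀ Λ D) {y s t : ℝ}
    (hst : c.Ψ y s ≤ c.Ψ y t) : s ≤ t := by
  by_contra! hlt
  exact absurd (c.lt_of_lt h (y := y) hlt) (not_lt.2 hst)

theorem mono (c : CharFlow l l₀ Λ D) (h : IsSpeed l lx l₀ Λ D) {y s t : ℝ}
    (hst : s ≤ t) : c.Ψ y s ≤ c.Ψ y t := by
  have := c.le_sub y s t hst
  have := mul_nonneg h.pos.le (sub_nonneg.2 hst)
  linarith

theorem τ_eq (c : CharFlow l l₀ Λ D) (h : IsSpeed l lx l₀ Λ D) {y t : ℝ} (ht : c.Ψ y t = 0) :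
    c.τ y = t :=
  le_antisymm (c.le_of_Ψ_le h (by rw [c.Ψτ, ht])) (c.le_of_Ψ_le h (by rw [c.Ψτ, ht]))

theorem τ_zero (c : CharFlow l l₀ Λ D) (h : IsSpeed l lx l₀ Λ D) : c.τ 0 = 0 :=
  c.τ_eq h (c.zero 0)

theorem τ_nonpos (c : CharFlow l l₀ Λ D) (h : IsSpeed l lx l₀ Λ D) {y : ℝ} (hy : 0 ≤ y) :
    c.τ y ≤ 0 :=
  c.le_of_Ψ_le h (by rwa [c.Ψτ, c.zero])

theorem τ_pos (c : CharFlow l l₀ Λ D) (h : IsSpeed l lx l₀ Λ D) {y : ℝ} (hy : y < 0) :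
    0 < c.τ y := by
  by_contra! h0
  have := c.mono h (y := y) h0
  rw [c.Ψτ, c.zero] at this
  linarith

theorem entry_of_nonneg (c : CharFlow l l₀ Λ D) (h : IsSpeed l lx l₀ Λ D) {y : ℝ} (hy : 0 ≤ y) :
    c.entry y = 0 := max_eq_right (c.τ_nonpos h hy)

theorem entry_of_neg (c : CharFlow l l₀ Λ D) (h : IsSpeed l lx l₀ Λ D) {y : ℝ} (hy : y < 0) :
    c.entry y = c.τ y := max_eq_left (c.τ_pos h hy).le

/-- A characteristic through a point of the quadrant `x ≥ 0`, `t ≥ 0` has entered it before. -/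
theorem entry_le (c : CharFlow l l₀ Λ D) (h : IsSpeed l lx l₀ Λ D) {x t : ℝ} (hx : 0 ≤ x)
    (ht : 0 ≤ t) : c.entry (c.Y x t) ≤ t :=
  max_le (c.le_of_Ψ_le h (by rwa [c.Ψτ, c.ΨY])) ht

theorem Ψ_nonneg (c : CharFlow l l₀ Λ D) (h : IsSpeed l lx l₀ Λ D) {y s : ℝ}
    (hs : c.entry y ≤ s) : 0 ≤ c.Ψ y s := by
  rw [← c.Ψτ y]
  exact c.mono h ((le_max_left _ _).trans hs)

theorem hasDerivAt_Y_x (c : CharFlow l l₀ Λ D) (x t : ℝ) :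
    HasDerivAt (fun x => c.Y x t) (c.J (c.Y x t) t)⁻¹ x :=
  HasDerivAt.of_local_left_inverse
    (c.contY.comp (continuous_id.prodMk continuous_const)).continuousAt
    (c.deriv_y (c.Y x t) t) (c.J_pos _ _).ne' (Filter.Eventually.of_forall fun x => c.ΨY x t)

theorem continuous_velocity (c : CharFlow l l₀ Λ D) (h : IsSpeed l lx l₀ Λ D) :
    Continuous fun p : ℝ × ℝ => l (c.Ψ p.1 p.2) p.2 :=
  h.cont.comp (c.contΨ.prodMk continuous_snd)

theorem hasDerivAt_Y_t (c : CharFlow l l₀ Λ D) (x t : ℝ) :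
    HasDerivAt (fun t => c.Y x t) (-l x t / c.J (c.Y x t) t) t := by
  have := HasDerivAt.of_implicit (F := c.Ψ) (a := fun t => c.Y x t) (s := t) (c := x)
    (fun y t => c.deriv_y y t) (fun y t => c.deriv_t y t) c.contJ
    (c.contY.comp (continuous_const.prodMk continuous_id)).continuousAt
    (fun t => c.ΨY x t) (c.J_pos _ _).ne'
  simpa only [c.ΨY] using this

theorem hasDerivAt_τ (c : CharFlow l l₀ Λ D) (h : IsSpeed l lx l₀ Λ D) (y : ℝ) :
    HasDerivAt c.τ (-c.J y (c.τ y) / l 0 (c.τ y)) y := by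
  have := HasDerivAt.of_implicit (F := fun t y => c.Ψ y t) (a := c.τ) (s := y) (c := 0)
    (fun t y => c.deriv_t y t) (fun t y => c.deriv_y y t)
    ((c.continuous_velocity h).comp continuous_swap)
    c.contτ.continuousAt c.Ψτ (by
      rw [c.Ψτ]; exact (h.pos.trans_le (h.lower _ _)).ne')
  simpa only [c.Ψτ] using this

end CharFlow

/-- Data `φ`, `b`, `g` for the transport problem `z_t + l z_x = g`, `z(x,0) = φ(x)`,
`z(0,t) = b(t)`, with their derivatives `φ'`, `b'`, `gx = ∂g/∂x`, continuously differentiable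
in this sense and compatible to first order at the corner. -/
structure TransportData (l : ℝ → ℝ → ℝ) (φ φ' b b' : ℝ → ℝ) (g gx : ℝ → ℝ → ℝ) : Prop where
  derivφ : ∀ x, HasDerivAt φ (φ' x) x
  contφ' : Continuous φ'
  derivb : ∀ t, HasDerivAt b (b' t) t
  contb' : Continuous b'
  contg : Continuous fun p : ℝ × ℝ => g p.1 p.2
  derivg : ∀ x t, HasDerivAt (fun x => g x t) (gx x t) x
  contgx : Continuous fun p : ℝ × ℝ => gx p.1 p.2
  compat₀ : φ 0 = b 0
  compat₁ : b' 0 = g 0 0 - l 0 0 * φ' 0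

namespace CharFlow

variable {l lx : ℝ → ℝ → ℝ} {l₀ Λ D : ℝ} {φ φ' b b' : ℝ → ℝ} {g gx : ℝ → ℝ → ℝ}

/-- The datum carried into the quadrant by the characteristic `y`: initial for `y ≥ 0`,
boundary for `y < 0`. -/
def inflow (c : CharFlow l l₀ Λ D) (φ b : ℝ → ℝ) (y : ℝ) : ℝ :=
  if 0 ≤ y then φ y else b (c.τ y)

/-- The `x`-derivative of the solution at the point where the characteristic `y` enters. -/
def inflowDeriv (c : CharFlow l l₀ Λ D) (φ' b' : ℝ → ℝ) (g : ℝ → ℝ → ℝ) (y : ℝ) : ℝ :=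
  if 0 ≤ y then φ' y else (g 0 (c.τ y) - b' (c.τ y)) / l 0 (c.τ y)

/-- The solution of the transport problem, by integration along characteristics. -/
def sol (c : CharFlow l l₀ Λ D) (φ b : ℝ → ℝ) (g : ℝ → ℝ → ℝ) (x t : ℝ) : ℝ :=
  c.inflow φ b (c.Y x t) + ∫ s in c.entry (c.Y x t)..t, g (c.Ψ (c.Y x t) s) s

/-- The `x`-derivative of `CharFlow.sol`. -/
def solx (c : CharFlow l l₀ Λ D) (φ' b' : ℝ → ℝ) (g gx : ℝ → ℝ → ℝ) (x t : ℝ) : ℝ :=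
  (c.J (c.Y x t) (c.entry (c.Y x t)) * c.inflowDeriv φ' b' g (c.Y x t) +
    ∫ s in c.entry (c.Y x t)..t, c.J (c.Y x t) s * gx (c.Ψ (c.Y x t) s) s) / c.J (c.Y x t) t

theorem hasDerivAt_integral_label (c : CharFlow l l₀ Λ D)
    (hd : TransportData l φ φ' b b' g gx) (y t : ℝ) :
    HasDerivAt (fun y => ∫ s in (0 : ℝ)..t, g (c.Ψ y s) s)
      (∫ s in (0 : ℝ)..t, c.J y s * gx (c.Ψ y s) s) y := by
  have hF : Continuous fun p : ℝ × ℝ => g (c.Ψ p.1 p.2) p.2 :=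
    hd.contg.comp (c.contΨ.prodMk continuous_snd)
  have hF' : Continuous fun p : ℝ × ℝ => c.J p.1 p.2 * gx (c.Ψ p.1 p.2) p.2 :=
    c.contJ.mul (hd.contgx.comp (c.contΨ.prodMk continuous_snd))
  obtain ⟨C, hC⟩ := ((isCompact_closedBall y 1).prod
    (isCompact_uIcc (a := 0) (b := t))).exists_bound_of_continuousOn
    hF'.continuousOn
  refine (intervalIntegral.hasDerivAt_integral_of_dominated_loc_of_deriv_le
    (F := fun y s => g (c.Ψ y s) s) (F' := fun y s => c.J y s * gx (c.Ψ y s) s)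
    (Metric.closedBall_mem_nhds y one_pos) (bound := fun _ => C) ?_ ?_ ?_ ?_ ?_ ?_).2
  · exact Filter.Eventually.of_forall fun y =>
      (hF.comp (continuous_const.prodMk continuous_id)).aestronglyMeasurable
  · exact (hF.comp (continuous_const.prodMk continuous_id)).intervalIntegrable _ _
  · exact (hF'.comp (continuous_const.prodMk continuous_id)).aestronglyMeasurable
  · exact Filter.Eventually.of_forall fun s hs y hy => hC (y, s) ⟨hy, uIoc_subset_uIcc hs⟩
  · exact intervalIntegrable_const
  · refine Filter.Eventually.of_forall fun s _ y _ => ?_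
    rw [mul_comm]
    exact (hd.derivg (c.Ψ y s) s).comp y (c.deriv_y y s)

/-- The solution in the coordinates (label, time), and its derivative in the label. -/
theorem exists_label_form (c : CharFlow l l₀ Λ D) (h : IsSpeed l lx l₀ Λ D)
    (hd : TransportData l φ φ' b b' g gx) :
    ∃ N Ny : ℝ → ℝ → ℝ, (∀ x t, c.sol φ b g x t = N (c.Y x t) t) ∧
      (∀ x t, c.solx φ' b' g gx x t = Ny (c.Y x t) t / c.J (c.Y x t) t) ∧
      (∀ y t, HasDerivAt (fun y => N y t) (Ny y t) y) ∧
      (∀ y t, HasDerivAt (N y) (g (c.Ψ y t) t) t) ∧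
      (Continuous fun p : ℝ × ℝ => Ny p.1 p.2) := by
  have hg : Continuous fun p : ℝ × ℝ => g (c.Ψ p.1 p.2) p.2 :=
    hd.contg.comp (c.contΨ.prodMk continuous_snd)
  have hgx : Continuous fun p : ℝ × ℝ => c.J p.1 p.2 * gx (c.Ψ p.1 p.2) p.2 :=
    c.contJ.mul (hd.contgx.comp (c.contΨ.prodMk continuous_snd))
  have hcφ : Continuous φ := continuous_iff_continuousAt.2 fun x => (hd.derivφ x).continuousAt
  have hcb : Continuous b := continuous_iff_continuousAt.2 fun x => (hd.derivb x).continuousAt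
  have hl0 : ∀ x t, l x t ≠ 0 := fun x t => (h.pos.trans_le (h.lower x t)).ne'
  set P : ℝ → ℝ → ℝ := fun y t => ∫ s in (0 : ℝ)..t, g (c.Ψ y s) s with hP
  set Py : ℝ → ℝ → ℝ := fun y t => ∫ s in (0 : ℝ)..t, c.J y s * gx (c.Ψ y s) s with hPy
  have hPc : Continuous fun p : ℝ × ℝ => P p.1 p.2 :=
    intervalIntegral.continuous_parametric_intervalIntegral_of_continuous
      (f := fun (p : ℝ × ℝ) s => g (c.Ψ p.1 s) s)
      (hg.comp (f := fun z : (ℝ × ℝ) × ℝ => (z.1.1, z.2)) (by fun_prop)) continuous_snd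
  have hPyc : Continuous fun p : ℝ × ℝ => Py p.1 p.2 :=
    intervalIntegral.continuous_parametric_intervalIntegral_of_continuous
      (f := fun (p : ℝ × ℝ) s => c.J p.1 s * gx (c.Ψ p.1 s) s)
      (hgx.comp (f := fun z : (ℝ × ℝ) × ℝ => (z.1.1, z.2)) (by fun_prop)) continuous_snd
  have hgs : ∀ y, Continuous fun s => g (c.Ψ y s) s := fun y =>
    hg.comp (continuous_const.prodMk continuous_id)
  have hgxs : ∀ y, Continuous fun s => c.J y s * gx (c.Ψ y s) s := fun y =>
    hgx.comp (continuous_const.prodMk continuous_id)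
  have hPd : ∀ y t, HasDerivAt (fun y => P y t) (Py y t) y := fun y t =>
    c.hasDerivAt_integral_label hd y t
  have hPt : ∀ y t, HasDerivAt (P y) (g (c.Ψ y t) t) t := fun y t =>
    intervalIntegral.integral_hasDerivAt_right ((hgs y).intervalIntegrable _ _)
      ((hgs y).stronglyMeasurableAtFilter _ _) (hgs y).continuousAt
  set N : ℝ → ℝ → ℝ := fun y t => c.inflow φ b y + (P y t - P y (c.entry y)) with hN
  set Ny : ℝ → ℝ → ℝ := fun y t => c.J y (c.entry y) * c.inflowDeriv φ' b' g y
    + (Py y t - Py y (c.entry y)) with hNy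
  have hin : Continuous (c.inflow φ b) := by
    refine Continuous.if_le hcφ (hcb.comp c.contτ) continuous_const continuous_id ?_
    intro y hy
    rw [← show (0 : ℝ) = y from hy, c.τ_zero h, hd.compat₀]
  have hin' : Continuous (c.inflowDeriv φ' b' g) := by
    refine Continuous.if_le hd.contφ' ?_ continuous_const continuous_id ?_
    · have h1 : Continuous fun y => g 0 (c.τ y) :=
        hd.contg.comp (continuous_const.prodMk c.contτ)
      have h2 : Continuous fun y => l 0 (c.τ y) := h.cont.comp (continuous_const.prodMk c.contτ)
      exact (h1.sub (hd.contb'.comp c.contτ)).div h2 fun y => hl0 _ _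
    · intro y hy
      rw [← show (0 : ℝ) = y from hy, c.τ_zero h, hd.compat₁]
      field_simp [hl0 0 0]
      ring
  have hNc : Continuous fun p : ℝ × ℝ => N p.1 p.2 :=
    (hin.comp continuous_fst).add (hPc.sub
      (hPc.comp (continuous_fst.prodMk (c.continuous_entry.comp continuous_fst))))
  have hNyc : Continuous fun p : ℝ × ℝ => Ny p.1 p.2 :=
    ((c.contJ.comp (continuous_fst.prodMk (c.continuous_entry.comp continuous_fst))).mul
      (hin'.comp continuous_fst)).add (hPyc.sub
      (hPyc.comp (continuous_fst.prodMk (c.continuous_entry.comp continuous_fst))))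
  refine ⟨N, Ny, fun x t => ?_, fun x t => ?_, fun y t => ?_, fun y t => ?_, hNyc⟩
  · simp only [sol, hN, hP]
    rw [intervalIntegral.integral_interval_sub_left ((hgs _).intervalIntegrable _ _)
      ((hgs _).intervalIntegrable _ _)]
  · simp only [solx, hNy, hPy]
    rw [intervalIntegral.integral_interval_sub_left ((hgxs _).intervalIntegrable _ _)
      ((hgxs _).intervalIntegrable _ _)]
  · -- away from the label `0` the formula is differentiable; at `0` its pieces match
    refine hasDerivAt_of_hasDerivAt_of_ne' (f := fun y => N y t) (g := fun y => Ny y t) (x := 0)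
      ?_ (hNc.comp (continuous_id.prodMk continuous_const)).continuousAt
      (hNyc.comp (continuous_id.prodMk continuous_const)).continuousAt y
    intro y hy
    rcases lt_or_gt_of_ne hy with hy | hy
    · have hτ := c.hasDerivAt_τ h y
      have h1 := HasDerivAt.comp_partials (F := P) (fun y t => hPd y t) (fun y t => hPt y t)
        hPyc hg (hasDerivAt_id y) hτ
      have h2 := ((hd.derivb (c.τ y)).comp y hτ).add ((hPd y t).sub h1)
      refine (h2.congr_of_eventuallyEq ?_).congr_deriv ?_
      · filter_upwards [Iio_mem_nhds hy] with y' hy'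
        simp [hN, inflow, not_le.2 (show y' < 0 from hy'), c.entry_of_neg h hy']
      · simp only [hNy, inflowDeriv, not_le.2 hy, if_false, c.entry_of_neg h hy, c.Ψτ, id]
        field_simp [hl0 0 (c.τ y)]
        ring
    · have h2 := (hd.derivφ y).add (hPd y t)
      have e0 : ∀ y', P y' 0 = 0 := fun y' => by simp [hP]
      have e0' : ∀ y', Py y' 0 = 0 := fun y' => by simp [hPy]
      refine (h2.congr_of_eventuallyEq ?_).congr_deriv ?_
      · filter_upwards [Ioi_mem_nhds hy] with y' hy'
        have hy'' : 0 ≤ y' := le_of_lt hy'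
        simp [hN, inflow, hy'', c.entry_of_nonneg h hy'', e0]
      · simp [hNy, inflowDeriv, hy.le, c.entry_of_nonneg h hy.le, e0', c.J_zero]
  · have := ((hPt y t).sub_const (P y (c.entry y))).const_add (c.inflow φ b y)
    exact this

theorem continuous_solx (c : CharFlow l l₀ Λ D) (h : IsSpeed l lx l₀ Λ D)
    (hd : TransportData l φ φ' b b' g gx) :
    Continuous fun p : ℝ × ℝ => c.solx φ' b' g gx p.1 p.2 := by
  obtain ⟨N, Ny, -, h2, -, -, h5⟩ := c.exists_label_form h hd
  simp_rw [h2]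
  exact (h5.comp (c.contY.prodMk continuous_snd)).div
    (c.contJ.comp (c.contY.prodMk continuous_snd)) fun p => (c.J_pos _ _).ne'

theorem hasDerivAt_sol_x (c : CharFlow l l₀ Λ D) (h : IsSpeed l lx l₀ Λ D)
    (hd : TransportData l φ φ' b b' g gx) (x t : ℝ) :
    HasDerivAt (fun x => c.sol φ b g x t) (c.solx φ' b' g gx x t) x := by
  obtain ⟨N, Ny, h1, h2, h3, -, -⟩ := c.exists_label_form h hd
  simp_rw [h1, h2]
  exact (h3 (c.Y x t) t).comp x (c.hasDerivAt_Y_x x t)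

/-- `CharFlow.sol` satisfies the transport equation. -/
theorem hasDerivAt_sol_t (c : CharFlow l l₀ Λ D) (h : IsSpeed l lx l₀ Λ D)
    (hd : TransportData l φ φ' b b' g gx) (x t : ℝ) :
    HasDerivAt (fun t => c.sol φ b g x t) (g x t - l x t * c.solx φ' b' g gx x t) t := by
  obtain ⟨N, Ny, h1, h2, h3, h4, h5⟩ := c.exists_label_form h hd
  simp_rw [h1, h2]
  have := HasDerivAt.comp_partials (F := N) h3 h4 h5
    (hd.contg.comp (c.contΨ.prodMk continuous_snd)) (c.hasDerivAt_Y_t x t) (hasDerivAt_id t)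
  refine this.congr_deriv ?_
  simp only [id, c.ΨY]
  ring

theorem contDiff_sol (c : CharFlow l l₀ Λ D) (h : IsSpeed l lx l₀ Λ D)
    (hd : TransportData l φ φ' b b' g gx) :
    ContDiff ℝ 1 fun p : ℝ × ℝ => c.sol φ b g p.1 p.2 :=
  contDiff_one_of_partials (c.hasDerivAt_sol_x h hd) (c.hasDerivAt_sol_t h hd)
    (c.continuous_solx h hd)
    (hd.contg.sub (h.cont.mul (c.continuous_solx h hd)))

theorem Y_zero (c : CharFlow l l₀ Λ D) (x : ℝ) : c.Y x 0 = x := by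
  conv_lhs => rw [← c.zero x]
  exact c.YΨ x 0

theorem sol_initial (c : CharFlow l l₀ Λ D) (h : IsSpeed l lx l₀ Λ D) {x : ℝ} (hx : 0 ≤ x) :
    c.sol φ b g x 0 = φ x := by
  simp [sol, c.Y_zero, inflow, hx, c.entry_of_nonneg h hx]

theorem entry_Y_zero (c : CharFlow l l₀ Λ D) (h : IsSpeed l lx l₀ Λ D) {t : ℝ} (ht : 0 ≤ t) :
    c.entry (c.Y 0 t) = t := by
  rw [entry, c.τ_eq h (c.ΨY 0 t), max_eq_left ht]

theorem sol_boundary (c : CharFlow l l₀ Λ D) (h : IsSpeed l lx l₀ Λ D)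
    (h0 : φ 0 = b 0) {t : ℝ} (ht : 0 ≤ t) :
    c.sol φ b g 0 t = b t := by
  have hτ := c.τ_eq h (c.ΨY 0 t)
  rw [sol, c.entry_Y_zero h ht, intervalIntegral.integral_same, add_zero, inflow, hτ]
  split_ifs with hy
  · have h1 := c.τ_nonpos h hy
    rw [hτ] at h1
    obtain rfl : t = 0 := le_antisymm h1 ht
    rw [c.Y_zero, h0]
  · rfl

end CharFlow

/-! ### Weighted estimates along characteristics -/

/-- Exponents `α`, `μ` for which integration along characteristics of speed at most `Λ`, with
coefficients at most `K`, halves the weighted norm `sup |U_i(x,t)| e^{α x - μ t}`. -/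
structure IsWeight (K Λ α μ : ℝ) : Prop where
  α_nonneg : 0 ≤ α
  μ_pos : 0 < μ
  speed_le : α * Λ ≤ μ
  boundary_le : 4 * K ≤ Real.exp α
  source_le : 4 * K * Real.exp α ≤ μ

theorem exists_isWeight (K Λ : ℝ) : ∃ α μ, IsWeight K Λ α μ := by
  obtain ⟨α, hα⟩ : ∃ α : ℝ, α = |4 * K| := ⟨_, rfl⟩
  refine ⟨α, |α * Λ| + |4 * K * Real.exp α| + 1, by rw [hα]; exact abs_nonneg _, by positivity,
    ?_, ?_, ?_⟩
  · have := le_abs_self (α * Λ); have := abs_nonneg (4 * K * Real.exp α); linarith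
  · have := le_abs_self (4 * K); have := Real.add_one_le_exp α; linarith
  · have := abs_nonneg (α * Λ); have := le_abs_self (4 * K * Real.exp α); linarith

theorem IsWeight.exp_neg_le {K Λ α μ x t : ℝ} (hw : IsWeight K Λ α μ) (hx : x ≤ 1) (ht : 0 ≤ t) :
    Real.exp (-α) ≤ Real.exp (μ * t - α * x) := by
  have := hw.α_nonneg
  have := mul_nonneg hw.μ_pos.le ht
  exact Real.exp_le_exp.2 (by nlinarith)

theorem IsWeight.le_exp {K Λ α μ x t : ℝ} (hw : IsWeight K Λ α μ) (hx : 0 ≤ x) :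
    Real.exp (μ * t - α * x) ≤ Real.exp (μ * t) := by
  have := mul_nonneg hw.α_nonneg hx
  exact Real.exp_le_exp.2 (by linarith)

/-- The basic weighted estimate. The boundary datum of a characteristic is controlled by outgoing
values, which carry the small weight `e^{-α}`; the source by values anywhere. -/
theorem CharFlow.abs_integral_le {l lx : ℝ → ℝ → ℝ} {l₀ Λ D : ℝ} (c : CharFlow l l₀ Λ D)
    (h : IsSpeed l lx l₀ Λ D) {T x t : ℝ} (hx : x ∈ Icc (0 : ℝ) 1) (ht : t ∈ Icc 0 T)
    {κ G : ℝ → ℝ} {θ A K M E α μ : ℝ} (hA : 0 ≤ A) (hK : 0 ≤ K) (hM : 0 ≤ M)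
    (hw : IsWeight (E * K) Λ α μ)
    (hκ : ∀ s ∈ Icc (c.entry (c.Y x t)) t, 0 ≤ κ s ∧ κ s ≤ E)
    (hθ₀ : 0 ≤ c.Y x t → |θ| ≤ A)
    (hθ₁ : c.Y x t < 0 → |θ| ≤ A + K * (M * Real.exp (μ * c.entry (c.Y x t) - α)))
    (hG : ∀ s ∈ Icc (c.entry (c.Y x t)) t, |G s| ≤ A + K * (M * Real.exp (μ * s))) :
    |κ (c.entry (c.Y x t)) * θ + ∫ s in c.entry (c.Y x t)..t, κ s * G s|
      ≤ E * A * (1 + T) + M / 2 * Real.exp (μ * t - α * x) := by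
  set y := c.Y x t with hy
  set e := c.entry y with he
  have het : e ≤ t := c.entry_le h hx.1 ht.1
  have he0 : 0 ≤ e := c.entry_nonneg y
  have hκe := hκ e ⟨le_rfl, het⟩
  have hE : 0 ≤ E := hκe.1.trans hκe.2
  have hμ := hw.μ_pos
  set W := Real.exp (μ * t - α * x) with hW
  have hW0 : 0 < W := Real.exp_pos _
  have hθ : |κ e * θ| ≤ E * A + M / 4 * W := by
    rw [abs_mul, abs_of_nonneg hκe.1]
    have h1 : κ e * |θ| ≤ E * |θ| := mul_le_mul_of_nonneg_right hκe.2 (abs_nonneg _)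
    rcases le_or_gt 0 y with hy0 | hy0
    · have := mul_le_mul_of_nonneg_left (hθ₀ hy0) hE
      have : 0 ≤ M / 4 * W := by positivity
      linarith
    · have h2 := mul_le_mul_of_nonneg_left (hθ₁ hy0) hE
      have h3 : Real.exp (μ * e) ≤ W := by
        have h4 := c.sub_le y e t het
        have h5 : c.Ψ y e = 0 := by rw [he, c.entry_of_neg h hy0, c.Ψτ]
        rw [h5, hy, c.ΨY, sub_zero] at h4
        have h6 := mul_le_mul_of_nonneg_left h4 hw.α_nonneg
        have h7 := mul_le_mul_of_nonneg_right hw.speed_le (sub_nonneg.2 het)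
        exact Real.exp_le_exp.2 (by nlinarith)
      have h8 : E * K * Real.exp (μ * e - α) ≤ Real.exp (μ * e) / 4 := by
        rw [Real.exp_sub, ← mul_div_assoc, div_le_iff₀ (Real.exp_pos _)]
        nlinarith [hw.boundary_le, Real.exp_pos (μ * e)]
      have h9 : E * (K * (M * Real.exp (μ * e - α))) ≤ M / 4 * W := by
        calc E * (K * (M * Real.exp (μ * e - α))) = M * (E * K * Real.exp (μ * e - α)) := by ring
          _ ≤ M * (W / 4) := mul_le_mul_of_nonneg_left (by linarith) hM
          _ = M / 4 * W := by ring
      linarith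
  have hint : |∫ s in e..t, κ s * G s| ≤ E * A * T + M / 4 * W := by
    have hcont : Continuous fun s => E * (A + K * (M * Real.exp (μ * s))) := by fun_prop
    have h1 : |∫ s in e..t, κ s * G s| ≤ ∫ s in e..t, E * (A + K * (M * Real.exp (μ * s))) := by
      rw [← Real.norm_eq_abs]
      refine intervalIntegral.norm_integral_le_of_norm_le het
        (Filter.Eventually.of_forall fun s hs => ?_) (hcont.intervalIntegrable _ _)
      have hs' : s ∈ Icc e t := ⟨hs.1.le, hs.2⟩
      rw [norm_mul, Real.norm_eq_abs, Real.norm_eq_abs, abs_of_nonneg (hκ s hs').1]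
      exact mul_le_mul (hκ s hs').2 (hG s hs') (abs_nonneg _) hE
    have h2 : ∫ s in e..t, E * (A + K * (M * Real.exp (μ * s)))
        = E * A * (t - e) + E * K * M * ((Real.exp (μ * t) - Real.exp (μ * e)) / μ) := by
      have hd : ∀ s ∈ uIcc e t, HasDerivAt
          (fun s => E * A * s + E * K * M * (Real.exp (μ * s) / μ))
          (E * (A + K * (M * Real.exp (μ * s)))) s := by
        intro s _
        have h3 : HasDerivAt (fun s => Real.exp (μ * s)) (Real.exp (μ * s) * μ) s := by
          simpa using ((hasDerivAt_id s).const_mul μ).exp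
        refine (((hasDerivAt_id s).const_mul (E * A)).add
          ((h3.div_const μ).const_mul (E * K * M))).congr_deriv ?_
        field_simp
      rw [intervalIntegral.integral_eq_sub_of_hasDerivAt hd (hcont.intervalIntegrable _ _)]
      ring
    have h3 : E * A * (t - e) ≤ E * A * T :=
      mul_le_mul_of_nonneg_left (by linarith [ht.2]) (mul_nonneg hE hA)
    have h4 : E * K * M * ((Real.exp (μ * t) - Real.exp (μ * e)) / μ) ≤ M / 4 * W := by
      have h5 : Real.exp (μ * t) ≤ Real.exp α * W := by
        rw [hW, ← Real.exp_add]
        have := mul_le_mul_of_nonneg_left hx.2 hw.α_nonneg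
        exact Real.exp_le_exp.2 (by linarith)
      have h6 : E * K * ((Real.exp (μ * t) - Real.exp (μ * e)) / μ) ≤ W / 4 := by
        rw [← mul_div_assoc, div_le_iff₀ hμ]
        have h7 := mul_le_mul_of_nonneg_right hw.source_le hW0.le
        have h8 : 0 ≤ E * K := mul_nonneg hE hK
        have h9 := mul_le_mul_of_nonneg_left h5 h8
        have := mul_nonneg h8 (Real.exp_pos (μ * e)).le
        nlinarith
      calc E * K * M * ((Real.exp (μ * t) - Real.exp (μ * e)) / μ)
          = M * (E * K * ((Real.exp (μ * t) - Real.exp (μ * e)) / μ)) := by ring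
        _ ≤ M * (W / 4) := mul_le_mul_of_nonneg_left h6 hM
        _ = M / 4 * W := by ring
    linarith
  calc |κ e * θ + ∫ s in e..t, κ s * G s| ≤ |κ e * θ| + |∫ s in e..t, κ s * G s| := abs_add_le _ _
    _ ≤ (E * A + M / 4 * W) + (E * A * T + M / 4 * W) := add_le_add hθ hint
    _ = _ := by ring

/-- If the gradients grow at most like the fourth root of the logarithm, the constants of the
weighted estimate can be chosen together with the radius `R` of an invariant set: the admissible
coefficient is `K ~ (log R + μ T)^{1/4}`, while only `μ ~ K²` is needed. -/
theorem exists_invariant_radius (n : ℕ) {C A Λ T : ℝ} (hA : 0 ≤ A) (hΛ : 0 ≤ Λ)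
    (hT : 0 ≤ T) :
    ∃ K α μ R : ℝ, 0 ≤ K ∧ 0 ≤ R ∧ IsWeight K Λ α μ ∧ 2 * A * (1 + T) * Real.exp α ≤ R ∧
      n * (C * (1 + Real.log (1 + n * (R * Real.exp (μ * T)))) ^ (1 / 4 : ℝ)) ≤ K := by
  have hn : (0 : ℝ) ≤ n := n.cast_nonneg
  obtain ⟨c, hc⟩ : ∃ c : ℝ, c = n * (8 * A * (1 + T)) + T * (4 * Λ + 16) := ⟨_, rfl⟩
  have hc0 : 0 ≤ c := by rw [hc]; positivity
  obtain ⟨K, hKdef⟩ : ∃ K : ℝ, K = 1 + (n * C) ^ 4 * (1 + c) := ⟨_, rfl⟩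
  have hK1 : 1 ≤ K := by
    have : 0 ≤ (n * C) ^ 4 * (1 + c) := by positivity
    linarith
  have h4K : 0 < 4 * K := by linarith
  -- the smallest `α` allowed by the boundary term, then `μ` of order `K ^ 2`
  obtain ⟨α, hα⟩ : ∃ α, α = Real.log (4 * K) := ⟨_, rfl⟩
  have hexp : Real.exp α = 4 * K := by rw [hα, Real.exp_log h4K]
  have hα0 : 0 ≤ α := by rw [hα]; exact Real.log_nonneg (by linarith)
  have hαle : α ≤ 4 * K := by
    have := Real.log_le_sub_one_of_pos h4K
    rw [← hα] at this
    linarith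
  obtain ⟨μ, hμ⟩ : ∃ μ, μ = Λ * α + 16 * K ^ 2 := ⟨_, rfl⟩
  have hμ0 : 0 < μ := by rw [hμ]; positivity
  obtain ⟨R, hR⟩ : ∃ R, R = 2 * A * (1 + T) * (4 * K) := ⟨_, rfl⟩
  have hR0 : 0 ≤ R := by rw [hR]; positivity
  refine ⟨K, α, μ, R, by linarith, hR0, ⟨hα0, hμ0, ?_, hexp.ge, ?_⟩, ?_, ?_⟩
  · rw [hμ]; linarith [sq_nonneg K]
  · rw [hexp, hμ]; linarith [mul_nonneg hΛ hα0]
  · rw [hexp, hR]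
  · have hKK : K ≤ K ^ 2 := by nlinarith
    have h1 : Real.log (1 + n * (R * Real.exp (μ * T))) ≤ c * K ^ 2 := by
      have hE1 : 1 ≤ Real.exp (μ * T) := Real.one_le_exp (by positivity)
      have h2 : 1 + n * (R * Real.exp (μ * T)) ≤ (1 + n * R) * Real.exp (μ * T) := by
        have : (1 + n * R) * Real.exp (μ * T)
            = Real.exp (μ * T) + n * (R * Real.exp (μ * T)) := by ring
        linarith
      have h3 : 0 < 1 + n * R := by positivity
      have h4 : 0 < 1 + n * (R * Real.exp (μ * T)) := by positivity
      have h5 := Real.log_le_log h4 h2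
      rw [Real.log_mul h3.ne' (Real.exp_pos _).ne', Real.log_exp] at h5
      have h6 := Real.log_le_sub_one_of_pos h3
      have h7 : n * R ≤ n * (8 * A * (1 + T)) * K ^ 2 := by
        have : n * R = n * (8 * A * (1 + T)) * K := by rw [hR]; ring
        rw [this]
        exact mul_le_mul_of_nonneg_left hKK (by positivity)
      have h8 : μ ≤ (4 * Λ + 16) * K ^ 2 := by
        rw [hμ]
        have := mul_le_mul_of_nonneg_left
          (hαle.trans (mul_le_mul_of_nonneg_left hKK (by norm_num))) hΛ
        rw [add_mul]; linarith
      have h9 := mul_le_mul_of_nonneg_right h8 hT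
      have : c * K ^ 2 = n * (8 * A * (1 + T)) * K ^ 2 + (4 * Λ + 16) * K ^ 2 * T := by
        rw [hc]; ring
      linarith
    have h0 : 0 ≤ Real.log (1 + n * (R * Real.exp (μ * T))) :=
      Real.log_nonneg (by
        have : 0 ≤ n * (R * Real.exp (μ * T)) := by positivity
        linarith)
    set X := 1 + Real.log (1 + n * (R * Real.exp (μ * T))) with hX
    have hX0 : 0 ≤ X := by linarith
    have h2 : (n * C) ^ 4 * X ≤ K ^ 4 := by
      have h3 : X ≤ (1 + c) * K ^ 2 := by rw [add_mul]; linarith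
      have h4 : (n * C) ^ 4 * (1 + c) ≤ K ^ 2 := by linarith
      calc (n * C) ^ 4 * X ≤ (n * C) ^ 4 * ((1 + c) * K ^ 2) :=
            mul_le_mul_of_nonneg_left h3 (by positivity)
        _ = ((n * C) ^ 4 * (1 + c)) * K ^ 2 := by ring
        _ ≤ K ^ 2 * K ^ 2 := mul_le_mul_of_nonneg_right h4 (by positivity)
        _ = K ^ 4 := by ring
    have h3 : (n * C * X ^ (1 / 4 : ℝ)) ^ 4 ≤ K ^ 4 := by
      have h4 : (X ^ (1 / 4 : ℝ)) ^ 4 = X := by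
        rw [← Real.rpow_natCast, ← Real.rpow_mul hX0]; norm_num
      rw [mul_pow, h4]
      exact h2
    have := le_of_pow_le_pow_left₀ (n := 4) (by norm_num) (by linarith) h3
    linarith

/-! ### The reflected problem on a rectangle -/

/-- The reflection `x ↦ 1 - x` for the components of negative speed, the identity for the others.
After it every component enters at `0` and leaves at `1`. -/
def flipCoord {n : ℕ} (k : ℕ) (i : Fin n) (x : ℝ) : ℝ := if (i : ℕ) < k then 1 - x else x

/-- The derivative of `flipCoord k i`. -/
def flipSign {n : ℕ} (k : ℕ) (i : Fin n) : ℝ := if (i : ℕ) < k then -1 else 1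

section Reflection

variable {n k : ℕ}

theorem flipCoord_flipCoord (i : Fin n) (x : ℝ) : flipCoord k i (flipCoord k i x) = x := by
  unfold flipCoord; split_ifs <;> ring

theorem flipCoord_mem {i : Fin n} {x : ℝ} (hx : x ∈ Icc (0 : ℝ) 1) :
    flipCoord k i x ∈ Icc (0 : ℝ) 1 := by
  unfold flipCoord; split_ifs
  · exact ⟨by linarith [hx.2], by linarith [hx.1]⟩
  · exact hx

@[fun_prop]
theorem continuous_flipCoord (i : Fin n) : Continuous (flipCoord k i) := by
  unfold flipCoord; split_ifs <;> fun_prop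

theorem hasDerivAt_flipCoord (i : Fin n) (x : ℝ) : HasDerivAt (flipCoord k i) (flipSign k i) x := by
  unfold flipCoord flipSign; split_ifs
  · simpa using (hasDerivAt_id x).const_sub 1
  · exact hasDerivAt_id x

theorem abs_flipSign (i : Fin n) : |flipSign k i| = 1 := by
  unfold flipSign; split_ifs <;> simp

theorem flipSign_mul_self (i : Fin n) : flipSign k i * flipSign k i = 1 := by
  unfold flipSign; split_ifs <;> simp

end Reflection

theorem EVec.abs_apply_le {n : ℕ} (y : EVec n) (i : Fin n) : |y i| ≤ ‖y‖ :=
  PiLp.norm_apply_le y i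

theorem EVec.norm_le {n : ℕ} {y : EVec n} {B : ℝ} (hB : 0 ≤ B) (hy : ∀ i, |y i| ≤ B) :
    ‖y‖ ≤ n * B := by
  have hn : (0 : ℝ) ≤ n := n.cast_nonneg
  rw [EuclideanSpace.norm_eq]
  refine Real.sqrt_le_iff.2 ⟨by positivity, ?_⟩
  calc ∑ i, ‖y i‖ ^ 2 ≤ ∑ _i : Fin n, B ^ 2 :=
        Finset.sum_le_sum fun i _ => pow_le_pow_left₀ (norm_nonneg _) (hy i) 2
    _ = n * B ^ 2 := by simp
    _ ≤ (n * B) ^ 2 := by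
        rw [mul_pow]
        refine mul_le_mul_of_nonneg_right ?_ (sq_nonneg B)
        rcases n.eq_zero_or_pos with h | h
        · simp [h]
        · have : (1 : ℝ) ≤ n := by exact_mod_cast h
          nlinarith

/-- Data of the initial-boundary problem on `[0,1] × [0,T]`, in coordinates where every component
has positive speed `l i`. The nonlinearities `f`, `h` and the initial data `φ` are given together
with their derivatives and are extended continuously to all `x` and `t`; `f` keeps the original
variable `x`, whereas `l`, `φ` use the reflected one. Of the growth condition only the fourth root
of a single logarithm is retained. The fields `compat₀`, `compat₁` are the compatibility
conditions; in reflected coordinates the outgoing vector at time `0` is `φ j 1`. -/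
structure RectProblem (n k : ℕ) (T : ℝ) where
  T_pos : 0 < T
  l : Fin n → ℝ → ℝ → ℝ
  lx : Fin n → ℝ → ℝ → ℝ
  l₀ : ℝ
  Λ : ℝ
  D : ℝ
  speed : ∀ i, IsSpeed (l i) (lx i) l₀ Λ D
  flow : ∀ i, CharFlow (l i) l₀ Λ D
  f : ℝ → ℝ → EVec n → EVec n
  fx : ℝ → ℝ → EVec n → EVec n
  fy : ℝ → ℝ → EVec n → EVec n →L[ℝ] EVec n
  h : ℝ → EVec n → EVec n
  ht : ℝ → EVec n → EVec n
  hz : ℝ → EVec n → EVec n →L[ℝ] EVec n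
  φ : Fin n → ℝ → ℝ
  φ' : Fin n → ℝ → ℝ
  C : ℝ
  contf : Continuous fun p : (ℝ × ℝ) × EVec n => f p.1.1 p.1.2 p.2
  contfx : Continuous fun p : (ℝ × ℝ) × EVec n => fx p.1.1 p.1.2 p.2
  contfy : Continuous fun p : (ℝ × ℝ) × EVec n => fy p.1.1 p.1.2 p.2
  derivfx : ∀ x ∈ Icc (0 : ℝ) 1, ∀ t ∈ Icc 0 T, ∀ y,
    HasDerivWithinAt (fun x => f x t y) (fx x t y) (Icc 0 1) x
  derivfy : ∀ x t y, HasFDerivAt (f x t) (fy x t y) y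
  conth : Continuous fun p : ℝ × EVec n => h p.1 p.2
  contht : Continuous fun p : ℝ × EVec n => ht p.1 p.2
  conthz : Continuous fun p : ℝ × EVec n => hz p.1 p.2
  derivht : ∀ t ∈ Icc 0 T, ∀ z, HasDerivWithinAt (fun t => h t z) (ht t z) (Icc 0 T) t
  derivhz : ∀ t z, HasFDerivAt (h t) (hz t z) z
  derivφ : ∀ i x, HasDerivAt (φ i) (φ' i x) x
  contφ' : ∀ i, Continuous (φ' i)
  growthf : ∀ x t y, ‖fy x t y‖ ≤ C * (1 + Real.log (1 + ‖y‖)) ^ (1 / 4 : ℝ)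
  growthh : ∀ t z, ‖hz t z‖ ≤ C * (1 + Real.log (1 + ‖z‖)) ^ (1 / 4 : ℝ)
  compat₀ : ∀ i, φ i 0 = h 0 (WithLp.toLp 2 fun j => φ j 1) i
  compat₁ : ∀ i, (ht 0 (WithLp.toLp 2 fun j => φ j 1) + hz 0 (WithLp.toLp 2 fun j => φ j 1)
      (WithLp.toLp 2 fun j =>
        f (flipCoord k j 1) 0 (WithLp.toLp 2 fun m => φ m (flipCoord k m (flipCoord k j 1))) j
        - l j 1 0 * φ' j 1)) i
    = f (flipCoord k i 0) 0 (WithLp.toLp 2 fun m => φ m (flipCoord k m (flipCoord k i 0))) i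
      - l i 0 0 * φ' i 0

/-- The vector of the components `U` (in reflected coordinates) at the point `(x, t)`. -/
def profile {n : ℕ} (k : ℕ) (U : Fin n → ℝ → ℝ → ℝ) (x t : ℝ) : EVec n :=
  WithLp.toLp 2 fun j => U j (flipCoord k j x) t

/-- The vector of the outgoing values. -/
def outgoing {n : ℕ} (U : Fin n → ℝ → ℝ → ℝ) (t : ℝ) : EVec n := WithLp.toLp 2 fun j => U j 1 t

/-- Continuity of all components on the rectangle. -/
def ContOnRect {n : ℕ} (T : ℝ) (U : Fin n → ℝ → ℝ → ℝ) : Prop :=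
  ∀ i, ContinuousOn (fun p : ℝ × ℝ => U i p.1 p.2) (rectBar T)

section Profile

variable {n k : ℕ} {T : ℝ} {U V : Fin n → ℝ → ℝ → ℝ}

theorem isCompact_rectBar (T : ℝ) : IsCompact (rectBar T) := isCompact_Icc.prod isCompact_Icc

theorem continuous_toLp_iff {X : Type*} [TopologicalSpace X] {s : Set X} {u : X → Fin n → ℝ} :
    ContinuousOn (fun p => (WithLp.toLp 2 (u p) : EVec n)) s ↔
      ∀ j, ContinuousOn (fun p => u p j) s := by
  constructor
  · intro h j
    exact (PiLp.continuous_apply 2 (fun _ : Fin n => ℝ) j).comp_continuousOn h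
  · intro h
    exact (PiLp.continuous_toLp 2 (fun _ : Fin n => ℝ)).comp_continuousOn (continuousOn_pi.2 h)

theorem ContOnRect.profile (hU : ContOnRect T U) :
    ContinuousOn (fun p : ℝ × ℝ => profile k U p.1 p.2) (rectBar T) := by
  refine continuous_toLp_iff.2 fun j => ?_
  refine (hU j).comp (f := fun p : ℝ × ℝ => (flipCoord k j p.1, p.2)) (by fun_prop) ?_
  exact fun p hp => ⟨flipCoord_mem hp.1, hp.2⟩

theorem ContOnRect.outgoing (hU : ContOnRect T U) :
    ContinuousOn (fun t => outgoing U t) (Icc 0 T) := by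
  refine continuous_toLp_iff.2 fun j => ?_
  refine (hU j).comp (f := fun t : ℝ => (1, t)) (by fun_prop) ?_
  exact fun t ht => ⟨⟨zero_le_one, le_rfl⟩, ht⟩

theorem profile_sub (x t : ℝ) : profile k U x t - profile k V x t
    = profile k (fun i x t => U i x t - V i x t) x t := by
  ext; simp [profile]

theorem outgoing_sub (t : ℝ) : outgoing U t - outgoing V t
    = outgoing (fun i x t => U i x t - V i x t) t := by
  ext; simp [outgoing]

theorem norm_profile_le {B x t : ℝ} (hB : 0 ≤ B) (hx : x ∈ Icc (0 : ℝ) 1)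
    (hU : ∀ j, ∀ ξ ∈ Icc (0 : ℝ) 1, |U j ξ t| ≤ B) : ‖profile k U x t‖ ≤ n * B :=
  EVec.norm_le hB fun j => hU j _ (flipCoord_mem hx)

theorem norm_outgoing_le {B t : ℝ} (hB : 0 ≤ B) (hU : ∀ j, |U j 1 t| ≤ B) :
    ‖outgoing U t‖ ≤ n * B :=
  EVec.norm_le hB hU

theorem hasDerivWithinAt_toLp {u : ℝ → Fin n → ℝ} {u' : Fin n → ℝ} {s : Set ℝ} {x : ℝ}
    (h : ∀ j, HasDerivWithinAt (fun x => u x j) (u' j) s x) :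
    HasDerivWithinAt (fun x => (WithLp.toLp 2 (u x) : EVec n)) (WithLp.toLp 2 u') s x := by
  have h1 : HasDerivWithinAt u u' s x := hasDerivWithinAt_pi.2 h
  exact (PiLp.continuousLinearEquiv 2 ℝ
    (fun _ : Fin n => ℝ)).symm.toContinuousLinearMap.hasFDerivAt.comp_hasDerivWithinAt x h1

end Profile

/-- Weighted bound `|U_i(x,t)| ≤ M e^{μ t - α x}` on the rectangle. -/
def WBound {n : ℕ} (T α μ M : ℝ) (U : Fin n → ℝ → ℝ → ℝ) : Prop :=
  ∀ i, ∀ x ∈ Icc (0 : ℝ) 1, ∀ t ∈ Icc 0 T, |U i x t| ≤ M * Real.exp (μ * t - α * x)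

namespace WBound

variable {n k : ℕ} {T α μ M : ℝ} {U : Fin n → ℝ → ℝ → ℝ} {K Λ : ℝ}

theorem mono {M' : ℝ} (h : WBound T α μ M U) (hM : M ≤ M') : WBound T α μ M' U :=
  fun i x hx t ht => (h i x hx t ht).trans (mul_le_mul_of_nonneg_right hM (Real.exp_pos _).le)

theorem abs_le (h : WBound T α μ M U) (hw : IsWeight K Λ α μ) (hM : 0 ≤ M) {i : Fin n} {x t : ℝ}
    (hx : x ∈ Icc (0 : ℝ) 1) (ht : t ∈ Icc 0 T) : |U i x t| ≤ M * Real.exp (μ * t) :=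
  (h i x hx t ht).trans (mul_le_mul_of_nonneg_left (hw.le_exp hx.1) hM)

theorem norm_profile (h : WBound T α μ M U) (hw : IsWeight K Λ α μ) (hM : 0 ≤ M) {x t : ℝ}
    (hx : x ∈ Icc (0 : ℝ) 1) (ht : t ∈ Icc 0 T) :
    ‖profile k U x t‖ ≤ n * (M * Real.exp (μ * t)) :=
  norm_profile_le (by positivity) hx fun _ _ hξ => h.abs_le hw hM hξ ht

theorem norm_outgoing (h : WBound T α μ M U) (hM : 0 ≤ M) {t : ℝ} (ht : t ∈ Icc 0 T) :
    ‖outgoing U t‖ ≤ n * (M * Real.exp (μ * t - α)) :=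
  norm_outgoing_le (by positivity) fun j => by
    simpa using h j 1 ⟨zero_le_one, le_rfl⟩ t ht

end WBound

theorem ContOnRect.exists_wbound {n : ℕ} {T : ℝ} {U : Fin n → ℝ → ℝ → ℝ} (hU : ContOnRect T U)
    {K Λ α μ : ℝ} (hw : IsWeight K Λ α μ) : ∃ M, 0 ≤ M ∧ WBound T α μ M U := by
  choose B hB using fun i => (isCompact_rectBar T).exists_bound_of_continuousOn (hU i)
  have hs : 0 ≤ ∑ i, |B i| := Finset.sum_nonneg fun i _ => abs_nonneg _
  refine ⟨(∑ i, |B i|) * Real.exp α, by positivity, fun i x hx t ht => ?_⟩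
  have h1 : |U i x t| ≤ ∑ i, |B i| :=
    (hB i (x, t) ⟨hx, ht⟩).trans ((le_abs_self _).trans
      (Finset.single_le_sum (f := fun i => |B i|) (fun i _ => abs_nonneg _) (Finset.mem_univ i)))
  have h2 : 1 ≤ Real.exp α * Real.exp (μ * t - α * x) := by
    have h3 := hw.exp_neg_le hx.2 ht.1
    calc (1 : ℝ) = Real.exp α * Real.exp (-α) := by rw [← Real.exp_add]; simp
      _ ≤ _ := mul_le_mul_of_nonneg_left h3 (Real.exp_pos _).le
  rw [mul_assoc]
  nlinarith [h1, h2, hs]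

namespace RectProblem

variable {n k : ℕ} {T : ℝ} (P : RectProblem n k T)

/-- The admissible Lipschitz constant of `f` and `h` on the ball of radius `ρ`. -/
def lip (ρ : ℝ) : ℝ := P.C * (1 + Real.log (1 + ρ)) ^ (1 / 4 : ℝ)

theorem C_nonneg : 0 ≤ P.C := by
  have := (norm_nonneg _).trans (P.growthh 0 0)
  simpa using this

theorem lip_mono {ρ ρ' : ℝ} (h0 : 0 ≤ ρ) (h : ρ ≤ ρ') : P.lip ρ ≤ P.lip ρ' := by
  refine mul_le_mul_of_nonneg_left (Real.rpow_le_rpow ?_ ?_ (by norm_num)) P.C_nonneg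
  · have := Real.log_nonneg (show 1 ≤ 1 + ρ by linarith); linarith
  · have := Real.log_le_log (show 0 < 1 + ρ by linarith) (show 1 + ρ ≤ 1 + ρ' by linarith)
    linarith

theorem lip_nonneg {ρ : ℝ} (h0 : 0 ≤ ρ) : 0 ≤ P.lip ρ := by
  refine mul_nonneg P.C_nonneg (Real.rpow_nonneg ?_ _)
  have := Real.log_nonneg (show 1 ≤ 1 + ρ by linarith); linarith

theorem Λ_nonneg (i : Fin n) : 0 ≤ P.Λ :=
  ((P.speed i).pos.le.trans ((P.speed i).lower 0 0)).trans ((P.speed i).upper 0 0)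

theorem norm_f_sub_le {ρ : ℝ} {y z : EVec n} (hy : ‖y‖ ≤ ρ) (hz : ‖z‖ ≤ ρ) (x t : ℝ) :
    ‖P.f x t y - P.f x t z‖ ≤ P.lip ρ * ‖y - z‖ :=
  (convex_closedBall (0 : EVec n) ρ).norm_image_sub_le_of_norm_hasFDerivWithin_le
    (fun v _ => (P.derivfy x t v).hasFDerivWithinAt)
    (fun v hv => (P.growthf x t v).trans (P.lip_mono (norm_nonneg _) (by simpa using hv)))
    (by simpa using hz) (by simpa using hy)

theorem norm_h_sub_le {ρ : ℝ} {y z : EVec n} (hy : ‖y‖ ≤ ρ) (hz : ‖z‖ ≤ ρ) (t : ℝ) :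
    ‖P.h t y - P.h t z‖ ≤ P.lip ρ * ‖y - z‖ :=
  (convex_closedBall (0 : EVec n) ρ).norm_image_sub_le_of_norm_hasFDerivWithin_le
    (fun v _ => (P.derivhz t v).hasFDerivWithinAt)
    (fun v hv => (P.growthh t v).trans (P.lip_mono (norm_nonneg _) (by simpa using hv)))
    (by simpa using hz) (by simpa using hy)

/-- The source of the `i`-th equation for the iterate following `U`. -/
def src (U : Fin n → ℝ → ℝ → ℝ) (i : Fin n) (ξ t : ℝ) : ℝ :=
  P.f (flipCoord k i ξ) t (profile k U (flipCoord k i ξ) t) i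

/-- The boundary datum of the `i`-th equation for the iterate following `U`. -/
def bdry (U : Fin n → ℝ → ℝ → ℝ) (i : Fin n) (t : ℝ) : ℝ := P.h t (outgoing U t) i

/-- The Picard iteration: solve the transport equations with source and boundary data taken
from `U`. -/
def step (U : Fin n → ℝ → ℝ → ℝ) (i : Fin n) : ℝ → ℝ → ℝ :=
  (P.flow i).sol (P.φ i) (P.bdry U i) (P.src U i)

theorem continuousOn_src {U : Fin n → ℝ → ℝ → ℝ} (hU : ContOnRect T U) (i : Fin n) :
    ContinuousOn (fun p : ℝ × ℝ => P.src U i p.1 p.2) (rectBar T) := by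
  have h1 : ContinuousOn (fun p : ℝ × ℝ => profile k U (flipCoord k i p.1) p.2) (rectBar T) :=
    hU.profile.comp (f := fun p : ℝ × ℝ => (flipCoord k i p.1, p.2)) (by fun_prop)
      fun p hp => ⟨flipCoord_mem hp.1, hp.2⟩
  have h2 : ContinuousOn
      (fun p : ℝ × ℝ => ((flipCoord k i p.1, p.2), profile k U (flipCoord k i p.1) p.2))
      (rectBar T) := ContinuousOn.prodMk (by fun_prop) h1
  exact (PiLp.continuous_apply 2 (fun _ : Fin n => ℝ) i).comp_continuousOn
    (P.contf.comp_continuousOn h2)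

/-- A characteristic stays in the rectangle between its entry and a point of the rectangle. -/
theorem char_mem (i : Fin n) {x t s : ℝ} (hx : x ∈ Icc (0 : ℝ) 1) (ht : t ∈ Icc 0 T)
    (hs : s ∈ Icc ((P.flow i).entry ((P.flow i).Y x t)) t) :
    (P.flow i).Ψ ((P.flow i).Y x t) s ∈ Icc (0 : ℝ) 1 ∧ s ∈ Icc 0 T := by
  refine ⟨⟨(P.flow i).Ψ_nonneg (P.speed i) hs.1, ?_⟩, ((P.flow i).entry_nonneg _).trans hs.1,
    hs.2.trans ht.2⟩
  have := (P.flow i).mono (P.speed i) (y := (P.flow i).Y x t) hs.2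
  rw [(P.flow i).ΨY] at this
  exact this.trans hx.2

theorem intervalIntegrable_char (i : Fin n) {x t : ℝ} (hx : x ∈ Icc (0 : ℝ) 1) (ht : t ∈ Icc 0 T)
    {g : ℝ → ℝ → ℝ} (hg : ContinuousOn (fun p : ℝ × ℝ => g p.1 p.2) (rectBar T)) :
    ContinuousOn (fun s => g ((P.flow i).Ψ ((P.flow i).Y x t) s) s)
      (uIcc ((P.flow i).entry ((P.flow i).Y x t)) t) := by
  rw [uIcc_of_le ((P.flow i).entry_le (P.speed i) hx.1 ht.1)]
  have hc : Continuous fun s => ((P.flow i).Ψ ((P.flow i).Y x t) s, s) :=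
    ((P.flow i).contΨ.comp (continuous_const.prodMk continuous_id)).prodMk continuous_id
  exact hg.comp (f := fun s => ((P.flow i).Ψ ((P.flow i).Y x t) s, s)) hc.continuousOn
    fun s hs => P.char_mem i hx ht hs

/-- A bound of `f(·,·,0)`, `h(·,0)`, `φ` and of the initial rate of change of the outgoing
values. -/
theorem exists_data_bound : ∃ A, 0 ≤ A ∧ (∀ x ∈ Icc (0 : ℝ) 1, ∀ t ∈ Icc 0 T, ‖P.f x t 0‖ ≤ A) ∧
    (∀ t ∈ Icc 0 T, ‖P.h t 0‖ ≤ A) ∧ (∀ i, ∀ x ∈ Icc (0 : ℝ) 1, |P.φ i x| ≤ A) := by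
  obtain ⟨A₁, h₁⟩ := (isCompact_rectBar T).exists_bound_of_continuousOn
    (P.contf.comp (f := fun p : ℝ × ℝ => (p, (0 : EVec n))) (by fun_prop)).continuousOn
  obtain ⟨A₂, h₂⟩ := (isCompact_Icc (a := 0) (b := T)).exists_bound_of_continuousOn
    (P.conth.comp (f := fun t : ℝ => (t, (0 : EVec n))) (by fun_prop)).continuousOn
  have hc : ∀ i, Continuous (P.φ i) := fun i =>
    continuous_iff_continuousAt.2 fun x => (P.derivφ i x).continuousAt
  choose B hB using fun i => (isCompact_Icc (a := (0 : ℝ)) (b := 1)).exists_bound_of_continuousOn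
    (hc i).continuousOn
  have hs : 0 ≤ ∑ i, |B i| := Finset.sum_nonneg fun i _ => abs_nonneg _
  have a1 := abs_nonneg A₁
  have a2 := abs_nonneg A₂
  refine ⟨|A₁| + |A₂| + ∑ i, |B i|, by positivity, fun x hx t ht => ?_, fun t ht => ?_,
    fun i x hx => ?_⟩
  · have := (h₁ (x, t) ⟨hx, ht⟩).trans (le_abs_self _)
    simp only [Function.comp_apply] at this
    linarith
  · have := (h₂ t ht).trans (le_abs_self _)
    simp only [Function.comp_apply] at this
    linarith
  · have h1 := (hB i x hx).trans ((le_abs_self _).trans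
      (Finset.single_le_sum (f := fun i => |B i|) (fun i _ => abs_nonneg _) (Finset.mem_univ i)))
    rw [Real.norm_eq_abs] at h1
    linarith

variable {U V : Fin n → ℝ → ℝ → ℝ} {α μ K M ρ : ℝ}

theorem step_contraction (hU : ContOnRect T U) (hV : ContOnRect T V)
    (hρ : 0 ≤ ρ)
    (hUρ : ∀ x ∈ Icc (0 : ℝ) 1, ∀ t ∈ Icc 0 T, ‖profile k U x t‖ ≤ ρ ∧ ‖outgoing U t‖ ≤ ρ)
    (hVρ : ∀ x ∈ Icc (0 : ℝ) 1, ∀ t ∈ Icc 0 T, ‖profile k V x t‖ ≤ ρ ∧ ‖outgoing V t‖ ≤ ρ)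
    (hK : n * P.lip ρ ≤ K) (hw : IsWeight K P.Λ α μ) (hM : 0 ≤ M)
    (hUV : WBound T α μ M fun i x t => U i x t - V i x t) :
    WBound T α μ (M / 2) fun i x t => P.step U i x t - P.step V i x t := by
  intro i x hx t ht
  have hlip := P.lip_nonneg hρ
  have hK0 : 0 ≤ K := le_trans (by positivity) hK
  have hiU := (P.intervalIntegrable_char i hx ht (P.continuousOn_src hU i)).intervalIntegrable
    (μ := MeasureTheory.volume)
  have hiV := (P.intervalIntegrable_char i hx ht (P.continuousOn_src hV i)).intervalIntegrable
    (μ := MeasureTheory.volume)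
  have key := (P.flow i).abs_integral_le (P.speed i) hx ht (κ := fun _ => 1) (A := 0) (E := 1)
    (K := K) (M := M) (α := α) (μ := μ)
    (θ := (P.flow i).inflow (P.φ i) (P.bdry U i) ((P.flow i).Y x t)
      - (P.flow i).inflow (P.φ i) (P.bdry V i) ((P.flow i).Y x t))
    (G := fun s => P.src U i ((P.flow i).Ψ ((P.flow i).Y x t) s) s
      - P.src V i ((P.flow i).Ψ ((P.flow i).Y x t) s) s) le_rfl hK0 hM
    (by rwa [one_mul]) (fun _ _ => ⟨zero_le_one, le_rfl⟩) ?_ ?_ ?_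
  · simp only [one_mul, zero_mul, mul_zero, zero_add, intervalIntegral.integral_sub hiU hiV] at key
    refine le_trans (le_of_eq ?_) key
    simp only [step, CharFlow.sol]
    congr 1
    ring
  · intro hy
    simp [CharFlow.inflow, hy]
  · intro hy
    have he := (P.char_mem i hx ht ⟨le_rfl, (P.flow i).entry_le (P.speed i) hx.1 ht.1⟩).2
    rw [(P.flow i).entry_of_neg (P.speed i) hy] at he ⊢
    set τ := (P.flow i).τ ((P.flow i).Y x t)
    simp only [CharFlow.inflow, not_le.2 hy, if_false, zero_add, bdry]
    calc |P.h τ (outgoing U τ) i - P.h τ (outgoing V τ) i|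
        = |(P.h τ (outgoing U τ) - P.h τ (outgoing V τ)) i| := by simp
      _ ≤ ‖P.h τ (outgoing U τ) - P.h τ (outgoing V τ)‖ := EVec.abs_apply_le _ i
      _ ≤ P.lip ρ * ‖outgoing U τ - outgoing V τ‖ :=
          P.norm_h_sub_le (hUρ x hx τ he).2 (hVρ x hx τ he).2 τ
      _ ≤ P.lip ρ * (n * (M * Real.exp (μ * τ - α))) := by
          rw [outgoing_sub]
          exact mul_le_mul_of_nonneg_left (hUV.norm_outgoing hM he) hlip
      _ = n * P.lip ρ * (M * Real.exp (μ * τ - α)) := by ring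
      _ ≤ K * (M * Real.exp (μ * τ - α)) := mul_le_mul_of_nonneg_right hK (by positivity)
  · intro s hs
    obtain ⟨hξ, hs'⟩ := P.char_mem i hx ht hs
    set ξ := flipCoord k i ((P.flow i).Ψ ((P.flow i).Y x t) s) with hξdef
    have hξ' : ξ ∈ Icc (0 : ℝ) 1 := flipCoord_mem hξ
    simp only [zero_add, src, ← hξdef]
    calc |P.f ξ s (profile k U ξ s) i - P.f ξ s (profile k V ξ s) i|
        = |(P.f ξ s (profile k U ξ s) - P.f ξ s (profile k V ξ s)) i| := by simp
      _ ≤ ‖P.f ξ s (profile k U ξ s) - P.f ξ s (profile k V ξ s)‖ := EVec.abs_apply_le _ i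
      _ ≤ P.lip ρ * ‖profile k U ξ s - profile k V ξ s‖ :=
          P.norm_f_sub_le (hUρ ξ hξ' s hs').1 (hVρ ξ hξ' s hs').1 ξ s
      _ ≤ P.lip ρ * (n * (M * Real.exp (μ * s))) := by
          rw [profile_sub]
          exact mul_le_mul_of_nonneg_left (hUV.norm_profile hw hM hξ' hs') hlip
      _ = n * P.lip ρ * (M * Real.exp (μ * s)) := by ring
      _ ≤ K * (M * Real.exp (μ * s)) := mul_le_mul_of_nonneg_right hK (by positivity)

theorem _root_.WBound.norm_le_radius {K Λ : ℝ} (hU : WBound T α μ M U) (hw : IsWeight K Λ α μ)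
    (hM : 0 ≤ M) {x t : ℝ} (hx : x ∈ Icc (0 : ℝ) 1) (ht : t ∈ Icc 0 T) :
    ‖profile k U x t‖ ≤ n * (M * Real.exp (μ * T)) ∧
      ‖outgoing U t‖ ≤ n * (M * Real.exp (μ * T)) := by
  have hn : (0 : ℝ) ≤ n := n.cast_nonneg
  have h1 := mul_le_mul_of_nonneg_left ht.2 hw.μ_pos.le
  have h2 := hw.α_nonneg
  constructor
  · refine (hU.norm_profile hw hM hx ht).trans ?_
    gcongr
  · refine (hU.norm_outgoing hM ht).trans ?_
    gcongr
    linarith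

/-- The Picard iteration preserves the weighted ball of radius `R`. -/
theorem step_invariant {A R : ℝ} (hU : WBound T α μ R U)
    (hA : 0 ≤ A) (hfA : ∀ x ∈ Icc (0 : ℝ) 1, ∀ t ∈ Icc 0 T, ‖P.f x t 0‖ ≤ A)
    (hhA : ∀ t ∈ Icc 0 T, ‖P.h t 0‖ ≤ A) (hφA : ∀ i, ∀ x ∈ Icc (0 : ℝ) 1, |P.φ i x| ≤ A)
    (hR : 0 ≤ R) (hw : IsWeight K P.Λ α μ)
    (hK : n * P.lip (n * (R * Real.exp (μ * T))) ≤ K)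
    (hRA : 2 * A * (1 + T) * Real.exp α ≤ R) :
    WBound T α μ R (P.step U) := by
  intro i x hx t ht
  have hT := P.T_pos
  set ρ := n * (R * Real.exp (μ * T)) with hρdef
  have hρ : 0 ≤ ρ := by positivity
  have hlip := P.lip_nonneg hρ
  have hK0 : 0 ≤ K := le_trans (by positivity) hK
  have hUρ := fun x hx t ht => WBound.norm_le_radius (k := k) hU hw hR (x := x) (t := t) hx ht
  have key := (P.flow i).abs_integral_le (P.speed i) hx ht (κ := fun _ => 1) (A := A) (E := 1)
    (K := K) (M := R) (α := α) (μ := μ)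
    (θ := (P.flow i).inflow (P.φ i) (P.bdry U i) ((P.flow i).Y x t))
    (G := fun s => P.src U i ((P.flow i).Ψ ((P.flow i).Y x t) s) s) hA hK0 hR
    (by rwa [one_mul]) (fun _ _ => ⟨zero_le_one, le_rfl⟩) ?_ ?_ ?_
  · simp only [one_mul] at key
    refine key.trans ?_
    have h1 : A * (1 + T) ≤ R / 2 * Real.exp (μ * t - α * x) := by
      have h2 := hw.exp_neg_le hx.2 ht.1
      have h3 : A * (1 + T) ≤ R / 2 * Real.exp (-α) := by
        rw [Real.exp_neg, ← div_eq_mul_inv, le_div_iff₀ (Real.exp_pos _)]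
        linarith
      exact h3.trans (mul_le_mul_of_nonneg_left h2 (by positivity))
    linarith
  · intro hy
    have hyle : (P.flow i).Y x t ∈ Icc (0 : ℝ) 1 := by
      have := (P.char_mem i hx ht ⟨le_rfl, (P.flow i).entry_le (P.speed i) hx.1 ht.1⟩).1
      rwa [(P.flow i).entry_of_nonneg (P.speed i) hy, (P.flow i).zero] at this
    simp only [CharFlow.inflow, hy, if_true]
    exact hφA i _ hyle
  · intro hy
    have he := (P.char_mem i hx ht ⟨le_rfl, (P.flow i).entry_le (P.speed i) hx.1 ht.1⟩).2
    rw [(P.flow i).entry_of_neg (P.speed i) hy] at he ⊢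
    set τ := (P.flow i).τ ((P.flow i).Y x t)
    simp only [CharFlow.inflow, not_le.2 hy, if_false, bdry]
    calc |P.h τ (outgoing U τ) i| ≤ ‖P.h τ (outgoing U τ)‖ := EVec.abs_apply_le _ i
      _ = ‖P.h τ 0 + (P.h τ (outgoing U τ) - P.h τ 0)‖ := by simp
      _ ≤ ‖P.h τ 0‖ + ‖P.h τ (outgoing U τ) - P.h τ 0‖ := norm_add_le _ _
      _ ≤ A + P.lip ρ * ‖outgoing U τ - 0‖ :=
          add_le_add (hhA τ he) (P.norm_h_sub_le (hUρ x hx τ he).2 (by simpa using hρ) τ)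
      _ ≤ A + P.lip ρ * (n * (R * Real.exp (μ * τ - α))) := by
          rw [sub_zero]
          exact add_le_add le_rfl (mul_le_mul_of_nonneg_left (hU.norm_outgoing hR he) hlip)
      _ = A + n * P.lip ρ * (R * Real.exp (μ * τ - α)) := by ring
      _ ≤ A + K * (R * Real.exp (μ * τ - α)) :=
          add_le_add le_rfl (mul_le_mul_of_nonneg_right hK (by positivity))
  · intro s hs
    obtain ⟨hξ, hs'⟩ := P.char_mem i hx ht hs
    set ξ := flipCoord k i ((P.flow i).Ψ ((P.flow i).Y x t) s) with hξdef
    have hξ' : ξ ∈ Icc (0 : ℝ) 1 := flipCoord_mem hξ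
    simp only [src, ← hξdef]
    calc |P.f ξ s (profile k U ξ s) i| ≤ ‖P.f ξ s (profile k U ξ s)‖ := EVec.abs_apply_le _ i
      _ = ‖P.f ξ s 0 + (P.f ξ s (profile k U ξ s) - P.f ξ s 0)‖ := by simp
      _ ≤ ‖P.f ξ s 0‖ + ‖P.f ξ s (profile k U ξ s) - P.f ξ s 0‖ := norm_add_le _ _
      _ ≤ A + P.lip ρ * ‖profile k U ξ s - 0‖ :=
          add_le_add (hfA ξ hξ' s hs') (P.norm_f_sub_le (hUρ ξ hξ' s hs').1 (by simpa using hρ) ξ s)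
      _ ≤ A + P.lip ρ * (n * (R * Real.exp (μ * s))) := by
          rw [sub_zero]
          exact add_le_add le_rfl (mul_le_mul_of_nonneg_left (hU.norm_profile hw hR hξ' hs') hlip)
      _ = A + n * P.lip ρ * (R * Real.exp (μ * s)) := by ring
      _ ≤ A + K * (R * Real.exp (μ * s)) :=
          add_le_add le_rfl (mul_le_mul_of_nonneg_right hK (by positivity))

/-- Fixed points of the Picard iteration are unique. -/
theorem eq_of_step_eq (hU : ContOnRect T U) (hV : ContOnRect T V)
    (hUs : ∀ i, ∀ x ∈ Icc (0 : ℝ) 1, ∀ t ∈ Icc 0 T, P.step U i x t = U i x t)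
    (hVs : ∀ i, ∀ x ∈ Icc (0 : ℝ) 1, ∀ t ∈ Icc 0 T, P.step V i x t = V i x t) :
    ∀ i, ∀ x ∈ Icc (0 : ℝ) 1, ∀ t ∈ Icc 0 T, U i x t = V i x t := by
  obtain ⟨ρ, hρ, hUρ, hVρ⟩ : ∃ ρ, 0 ≤ ρ ∧
      (∀ x ∈ Icc (0 : ℝ) 1, ∀ t ∈ Icc 0 T, ‖profile k U x t‖ ≤ ρ ∧ ‖outgoing U t‖ ≤ ρ) ∧
      (∀ x ∈ Icc (0 : ℝ) 1, ∀ t ∈ Icc 0 T, ‖profile k V x t‖ ≤ ρ ∧ ‖outgoing V t‖ ≤ ρ) := by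
    obtain ⟨α, μ, hw⟩ := exists_isWeight 0 0
    obtain ⟨M₁, hM₁, h₁⟩ := hU.exists_wbound hw
    obtain ⟨M₂, hM₂, h₂⟩ := hV.exists_wbound hw
    refine ⟨n * (max M₁ M₂ * Real.exp (μ * T)), by positivity, fun x hx t ht => ?_,
      fun x hx t ht => ?_⟩
    · exact WBound.norm_le_radius (h₁.mono (le_max_left _ _)) hw (by positivity) hx ht
    · exact WBound.norm_le_radius (h₂.mono (le_max_right _ _)) hw (by positivity) hx ht
  obtain ⟨α, μ, hw⟩ := exists_isWeight (n * P.lip ρ) P.Λ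
  have hUV : ContOnRect T fun i x t => U i x t - V i x t := fun i => (hU i).sub (hV i)
  obtain ⟨M, hM, hb⟩ := hUV.exists_wbound hw
  have hm : ∀ m : ℕ, WBound T α μ (M / 2 ^ m) fun i x t => U i x t - V i x t := by
    intro m
    induction m with
    | zero => simpa using hb
    | succ m ih =>
      have := P.step_contraction hU hV hρ hUρ hVρ le_rfl hw (by positivity) ih
      intro i x hx t ht
      have := this i x hx t ht
      simp only [hUs i x hx t ht, hVs i x hx t ht] at this
      rwa [pow_succ, ← div_div]
  intro i x hx t ht
  have hlim : Filter.Tendsto (fun m : ℕ => M / 2 ^ m * Real.exp (μ * t - α * x)) Filter.atTop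
      (nhds 0) := by
    have h1 : Filter.Tendsto (fun m : ℕ => M * (1 / 2 : ℝ) ^ m) Filter.atTop (nhds (M * 0)) :=
      (tendsto_pow_atTop_nhds_zero_of_lt_one (by norm_num) (by norm_num)).const_mul M
    have h2 := h1.mul_const (Real.exp (μ * t - α * x))
    rw [mul_zero, zero_mul] at h2
    refine h2.congr fun m => ?_
    rw [one_div, inv_pow, div_eq_mul_inv]
  have := ge_of_tendsto' hlim fun m => hm m i x hx t ht
  exact sub_eq_zero.1 (abs_nonpos_iff.1 this)

end RectProblem

/-! ### Differentiability of the iterates -/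

/-- The derivative in `x` of `profile k U x t`, where `w` is the derivative of `U`. -/
def profilex {n : ℕ} (k : ℕ) (w : Fin n → ℝ → ℝ → ℝ) (x t : ℝ) : EVec n :=
  WithLp.toLp 2 fun j => flipSign k j * w j (flipCoord k j x) t

namespace RectProblem

variable {n k : ℕ} {T : ℝ} (P : RectProblem n k T) {U w : Fin n → ℝ → ℝ → ℝ} {r : Fin n → ℝ → ℝ}

/-- The derivative in `ξ` of the source `P.src U i ξ t`. -/
def srcx (U w : Fin n → ℝ → ℝ → ℝ) (i : Fin n) (ξ t : ℝ) : ℝ :=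
  flipSign k i * (P.fx (flipCoord k i ξ) t (profile k U (flipCoord k i ξ) t) +
    P.fy (flipCoord k i ξ) t (profile k U (flipCoord k i ξ) t)
      (profilex k w (flipCoord k i ξ) t)) i

/-- The derivative of the boundary datum `P.bdry U i`, where `r` is the derivative of the outgoing
values. -/
def bdryt (U : Fin n → ℝ → ℝ → ℝ) (r : Fin n → ℝ → ℝ) (i : Fin n) (t : ℝ) : ℝ :=
  (P.ht t (outgoing U t) + P.hz t (outgoing U t) (WithLp.toLp 2 fun j => r j t)) i

/-- The `x`-derivative of `P.step U`. -/
def stepx (U : Fin n → ℝ → ℝ → ℝ) (r : Fin n → ℝ → ℝ) (w : Fin n → ℝ → ℝ → ℝ) (i : Fin n) :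
    ℝ → ℝ → ℝ :=
  (P.flow i).solx (P.φ' i) (P.bdryt U r i) (P.src U i) (P.srcx U w i)

/-- The derivative of the outgoing values at time `0`, as prescribed by the equations. -/
def rate (i : Fin n) : ℝ :=
  P.f (flipCoord k i 1) 0 (WithLp.toLp 2 fun m => P.φ m (flipCoord k m (flipCoord k i 1))) i
    - P.l i 1 0 * P.φ' i 1

/-- `U` is continuously differentiable in `x` with derivative `w`, its outgoing values are
continuously differentiable in `t` with derivative `r`, and the values at time `0` are those which
the initial data and the system prescribe. -/
structure Admissible (U w : Fin n → ℝ → ℝ → ℝ) (r : Fin n → ℝ → ℝ) : Prop where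
  contU : ContOnRect T U
  contw : ContOnRect T w
  contr : ∀ i, ContinuousOn (r i) (Icc 0 T)
  derivx : ∀ i, ∀ x ∈ Icc (0 : ℝ) 1, ∀ t ∈ Icc 0 T,
    HasDerivWithinAt (fun x => U i x t) (w i x t) (Icc 0 1) x
  derivt : ∀ i, ∀ t ∈ Icc 0 T, HasDerivWithinAt (fun t => U i 1 t) (r i t) (Icc 0 T) t
  init : ∀ i, ∀ x ∈ Icc (0 : ℝ) 1, U i x 0 = P.φ i x
  init_rate : ∀ i, r i 0 = P.rate i

theorem _root_.ContOnRect.profilex {w : Fin n → ℝ → ℝ → ℝ} (hw : ContOnRect T w) :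
    ContinuousOn (fun p : ℝ × ℝ => profilex k w p.1 p.2) (rectBar T) := by
  refine continuous_toLp_iff.2 fun j => continuousOn_const.mul ?_
  refine (hw j).comp (f := fun p : ℝ × ℝ => (flipCoord k j p.1, p.2)) (by fun_prop) ?_
  exact fun p hp => ⟨flipCoord_mem hp.1, hp.2⟩

theorem hasDerivWithinAt_src (h : P.Admissible U w r) (i : Fin n) {ξ t : ℝ}
    (hξ : ξ ∈ Icc (0 : ℝ) 1) (ht : t ∈ Icc 0 T) :
    HasDerivWithinAt (fun ξ => P.src U i ξ t) (P.srcx U w i ξ t) (Icc 0 1) ξ := by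
  have h1 : ∀ x ∈ Icc (0 : ℝ) 1, HasDerivWithinAt (fun x => profile k U x t) (profilex k w x t)
      (Icc 0 1) x := by
    intro x hx
    refine hasDerivWithinAt_toLp fun j => ?_
    rw [mul_comm]
    exact (h.derivx j _ (flipCoord_mem hx) t ht).comp x (hasDerivAt_flipCoord j x).hasDerivWithinAt
      fun y hy => flipCoord_mem hy
  have hx := flipCoord_mem (k := k) (i := i) hξ
  have h2 := HasDerivWithinAt.comp_partial (F := fun x y => P.f x t y)
    (P.derivfx _ hx t ht _) (fun x y => P.derivfy x t y)
    (P.contfy.comp (f := fun p : ℝ × EVec n => ((p.1, t), p.2)) (by fun_prop)) (h1 _ hx)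
  have h3 := (EuclideanSpace.proj (𝕜 := ℝ) i).hasFDerivAt.comp_hasDerivWithinAt _ h2
  have h4 := h3.comp ξ (hasDerivAt_flipCoord i ξ).hasDerivWithinAt
    (fun y hy => flipCoord_mem (k := k) (i := i) hy)
  rw [mul_comm] at h4
  exact h4

theorem hasDerivWithinAt_bdry (h : P.Admissible U w r) (i : Fin n) {t : ℝ} (ht : t ∈ Icc 0 T) :
    HasDerivWithinAt (P.bdry U i) (P.bdryt U r i t) (Icc 0 T) t := by
  have h1 : HasDerivWithinAt (fun t => outgoing U t) (WithLp.toLp 2 fun j => r j t) (Icc 0 T) t :=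
    hasDerivWithinAt_toLp fun j => h.derivt j t ht
  have h2 := HasDerivWithinAt.comp_partial (F := P.h) (P.derivht t ht _) P.derivhz P.conthz h1
  exact (EuclideanSpace.proj (𝕜 := ℝ) i).hasFDerivAt.comp_hasDerivWithinAt _ h2

theorem continuousOn_srcx (hU : ContOnRect T U) (hw : ContOnRect T w) (i : Fin n) :
    ContinuousOn (fun p : ℝ × ℝ => P.srcx U w i p.1 p.2) (rectBar T) := by
  have hm : MapsTo (fun p : ℝ × ℝ => (flipCoord k i p.1, p.2)) (rectBar T) (rectBar T) :=
    fun p hp => ⟨flipCoord_mem hp.1, hp.2⟩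
  have h1 : ContinuousOn (fun p : ℝ × ℝ => profile k U (flipCoord k i p.1) p.2) (rectBar T) :=
    hU.profile.comp (f := fun p : ℝ × ℝ => (flipCoord k i p.1, p.2)) (by fun_prop) hm
  have h1' : ContinuousOn (fun p : ℝ × ℝ => profilex k w (flipCoord k i p.1) p.2) (rectBar T) :=
    hw.profilex.comp (f := fun p : ℝ × ℝ => (flipCoord k i p.1, p.2)) (by fun_prop) hm
  have h2 : ContinuousOn
      (fun p : ℝ × ℝ => ((flipCoord k i p.1, p.2), profile k U (flipCoord k i p.1) p.2))
      (rectBar T) := ContinuousOn.prodMk (by fun_prop) h1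
  exact continuousOn_const.mul ((PiLp.continuous_apply 2 (fun _ : Fin n => ℝ) i).comp_continuousOn
    ((P.contfx.comp_continuousOn h2).add ((P.contfy.comp_continuousOn h2).clm_apply h1')))

theorem continuousOn_bdryt (hU : ContOnRect T U) (hr : ∀ i, ContinuousOn (r i) (Icc 0 T))
    (i : Fin n) : ContinuousOn (P.bdryt U r i) (Icc 0 T) := by
  have h2 : ContinuousOn (fun t : ℝ => (t, outgoing U t)) (Icc 0 T) :=
    ContinuousOn.prodMk (by fun_prop) hU.outgoing
  exact (PiLp.continuous_apply 2 (fun _ : Fin n => ℝ) i).comp_continuousOn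
    ((P.contht.comp_continuousOn h2).add ((P.conthz.comp_continuousOn h2).clm_apply
      (continuous_toLp_iff.2 hr)))

theorem profile_zero (h : P.Admissible U w r) {x : ℝ} (hx : x ∈ Icc (0 : ℝ) 1) :
    profile k U x 0 = WithLp.toLp 2 fun m => P.φ m (flipCoord k m x) := by
  ext m
  exact h.init m _ (flipCoord_mem hx)

theorem outgoing_zero (h : P.Admissible U w r) :
    outgoing U 0 = WithLp.toLp 2 fun m => P.φ m 1 := by
  ext m
  exact h.init m 1 ⟨zero_le_one, le_rfl⟩

/-- The Picard iterate of an admissible function coincides on the rectangle with a continuously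
differentiable function on the plane. -/
theorem exists_smooth_step (h : P.Admissible U w r) (i : Fin n) :
    ∃ Z Zx : ℝ → ℝ → ℝ, (ContDiff ℝ 1 fun p : ℝ × ℝ => Z p.1 p.2) ∧
      (∀ x t, HasDerivAt (fun x => Z x t) (Zx x t) x) ∧
      (Continuous fun p : ℝ × ℝ => Zx p.1 p.2) ∧
      (∀ x ∈ Icc (0 : ℝ) 1, ∀ t ∈ Icc 0 T,
        HasDerivAt (Z x) (P.src U i x t - P.l i x t * Zx x t) t) ∧
      (∀ x ∈ Icc (0 : ℝ) 1, ∀ t ∈ Icc 0 T,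
        P.step U i x t = Z x t ∧ P.stepx U r w i x t = Zx x t) ∧
      (∀ x ∈ Icc (0 : ℝ) 1, Z x 0 = P.φ i x) ∧ (∀ t ∈ Icc 0 T, Z 0 t = P.bdry U i t) := by
  have hT := P.T_pos
  have hT0 : (0 : ℝ) ∈ Icc 0 T := ⟨le_rfl, hT.le⟩
  have h01 : (0 : ℝ) ∈ Icc (0 : ℝ) 1 := ⟨le_rfl, zero_le_one⟩
  -- continuing the data by tangents outside of the rectangle does not change the solution inside
  set b : ℝ → ℝ := fun t => P.bdry U i (clamp 0 T t)
    + (t - clamp 0 T t) * P.bdryt U r i (clamp 0 T t) with hb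
  set b' : ℝ → ℝ := fun t => P.bdryt U r i (clamp 0 T t) with hb'
  set g : ℝ → ℝ → ℝ := fun x t => P.src U i (clamp 0 1 x) (clamp 0 T t)
    + (x - clamp 0 1 x) * P.srcx U w i (clamp 0 1 x) (clamp 0 T t) with hg
  set gx : ℝ → ℝ → ℝ := fun x t => P.srcx U w i (clamp 0 1 x) (clamp 0 T t) with hgx
  have ebQ : ∀ t ∈ Icc 0 T, b t = P.bdry U i t := fun t ht => by simp [hb, clamp_of_mem ht]
  have eb'Q : ∀ t ∈ Icc 0 T, b' t = P.bdryt U r i t := fun t ht => by simp [hb', clamp_of_mem ht]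
  have egQ : ∀ x ∈ Icc (0 : ℝ) 1, ∀ t ∈ Icc 0 T, g x t = P.src U i x t := fun x hx t ht => by
    simp [hg, clamp_of_mem ht, clamp_of_mem hx]
  have egxQ : ∀ x ∈ Icc (0 : ℝ) 1, ∀ t ∈ Icc 0 T, gx x t = P.srcx U w i x t := fun x hx t ht => by
    simp [hgx, clamp_of_mem ht, clamp_of_mem hx]
  have hcl : Continuous fun p : ℝ × ℝ => (clamp 0 1 p.1, clamp 0 T p.2) := by fun_prop
  have hclm : ∀ p : ℝ × ℝ, (clamp 0 1 p.1, clamp 0 T p.2) ∈ rectBar T := fun p =>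
    ⟨clamp_mem zero_le_one _, clamp_mem hT.le _⟩
  have cgx : Continuous fun p : ℝ × ℝ => gx p.1 p.2 :=
    (P.continuousOn_srcx h.contU h.contw i).comp_continuous hcl hclm
  have cg : Continuous fun p : ℝ × ℝ => g p.1 p.2 :=
    ((P.continuousOn_src h.contU i).comp_continuous hcl hclm).add
      ((continuous_fst.sub ((continuous_clamp 0 1).comp continuous_fst)).mul cgx)
  have cb' : Continuous b' := (P.continuousOn_bdryt h.contU h.contr i).comp_clamp hT.le
  have hd : TransportData (P.l i) (P.φ i) (P.φ' i) b b' g gx := by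
    refine ⟨P.derivφ i, P.contφ' i, fun t => ?_, cb', cg, fun x t => ?_, cgx, ?_, ?_⟩
    · exact hasDerivAt_clamp_ext hT (fun t ht => P.hasDerivWithinAt_bdry h i ht) t
    · exact hasDerivAt_clamp_ext one_pos
        (fun x hx => P.hasDerivWithinAt_src h i hx (clamp_mem hT.le t)) x
    · rw [ebQ 0 hT0, P.compat₀ i, bdry, P.outgoing_zero h]
    · rw [eb'Q 0 hT0, egQ 0 h01 0 hT0, bdryt, src, P.outgoing_zero h,
        P.profile_zero h (flipCoord_mem h01)]
      have hr : (fun j => r j 0) = P.rate := funext h.init_rate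
      rw [hr]
      exact P.compat₁ i
  have hS := P.speed i
  refine ⟨(P.flow i).sol (P.φ i) b g, (P.flow i).solx (P.φ' i) b' g gx,
    (P.flow i).contDiff_sol hS hd, (P.flow i).hasDerivAt_sol_x hS hd,
    (P.flow i).continuous_solx hS hd, fun x hx t ht => ?_, fun x hx t ht => ?_, fun x hx => ?_,
    fun t ht => ?_⟩
  · rw [← egQ x hx t ht]
    exact (P.flow i).hasDerivAt_sol_t hS hd x t
  · have hle := (P.flow i).entry_le hS hx.1 ht.1
    have hent := (P.char_mem i hx ht ⟨le_rfl, hle⟩).2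
    have hτ : ¬ 0 ≤ (P.flow i).Y x t → (P.flow i).τ ((P.flow i).Y x t) ∈ Icc 0 T := fun hy => by
      rwa [(P.flow i).entry_of_neg hS (not_le.1 hy)] at hent
    constructor
    · simp only [step, CharFlow.sol]
      congr 1
      · simp only [CharFlow.inflow]
        split_ifs with hy
        · rfl
        · exact (ebQ _ (hτ hy)).symm
      · refine intervalIntegral.integral_congr fun s hs => ?_
        rw [uIcc_of_le hle] at hs
        obtain ⟨h1, h2⟩ := P.char_mem i hx ht hs
        exact (egQ _ h1 _ h2).symm
    · simp only [stepx, CharFlow.solx]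
      congr 2
      · simp only [CharFlow.inflowDeriv]
        split_ifs with hy
        · rfl
        · rw [eb'Q _ (hτ hy), egQ 0 h01 _ (hτ hy)]
      · refine intervalIntegral.integral_congr fun s hs => ?_
        rw [uIcc_of_le hle] at hs
        obtain ⟨h1, h2⟩ := P.char_mem i hx ht hs
        simp only [egxQ _ h1 _ h2]
  · exact (P.flow i).sol_initial hS hx.1
  · rw [← ebQ t ht]
    exact (P.flow i).sol_boundary hS hd.compat₀ ht.1

/-- The derivative in time of the outgoing values of the next iterate. -/
def stept (U : Fin n → ℝ → ℝ → ℝ) (r : Fin n → ℝ → ℝ) (w : Fin n → ℝ → ℝ → ℝ) (i : Fin n)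
    (t : ℝ) : ℝ := P.src U i 1 t - P.l i 1 t * P.stepx U r w i 1 t

/-- The Picard iteration preserves admissibility. -/
theorem Admissible.step {P : RectProblem n k T} (h : P.Admissible U w r) :
    P.Admissible (P.step U) (P.stepx U r w) (P.stept U r w) := by
  choose Z Zx hZ hZx hZc hZt hst hZ0 hZb using P.exists_smooth_step h
  have h11 : (1 : ℝ) ∈ Icc (0 : ℝ) 1 := ⟨zero_le_one, le_rfl⟩
  have hT0 : (0 : ℝ) ∈ Icc 0 T := ⟨le_rfl, P.T_pos.le⟩
  have cw : ContOnRect T (P.stepx U r w) := fun i =>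
    (hZc i).continuousOn.congr fun p hp => (hst i p.1 hp.1 p.2 hp.2).2
  have hseg : ContinuousOn (fun t : ℝ => ((1 : ℝ), t)) (Icc 0 T) := by fun_prop
  have hmaps : MapsTo (fun t : ℝ => ((1 : ℝ), t)) (Icc 0 T) (rectBar T) := fun t ht => ⟨h11, ht⟩
  refine ⟨fun i => ?_, cw, fun i => ?_, fun i x hx t ht => ?_, fun i t ht => ?_, fun i x hx => ?_,
    fun i => ?_⟩
  · exact (hZ i).continuous.continuousOn.congr fun p hp => (hst i p.1 hp.1 p.2 hp.2).1
  · exact ((P.continuousOn_src h.contU i).comp hseg hmaps).sub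
      (((P.speed i).cont.continuousOn.comp hseg hmaps).mul ((cw i).comp hseg hmaps))
  · rw [(hst i x hx t ht).2]
    exact (hZx i x t).hasDerivWithinAt.congr_of_mem (fun y hy => (hst i y hy t ht).1) hx
  · rw [stept, (hst i 1 h11 t ht).2]
    exact (hZt i 1 h11 t ht).hasDerivWithinAt.congr_of_mem (fun s hs => (hst i 1 h11 s hs).1) ht
  · rw [(hst i x hx 0 hT0).1, hZ0 i x hx]
  · have e1 : Zx i 1 0 = P.φ' i 1 := by
      have h1 := (hZx i 1 0).hasDerivWithinAt (s := Icc 0 1)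
      have h2 : HasDerivWithinAt (fun x => Z i x 0) (P.φ' i 1) (Icc 0 1) 1 :=
        (P.derivφ i 1).hasDerivWithinAt.congr_of_mem (fun y hy => hZ0 i y hy) h11
      exact (uniqueDiffOn_Icc one_pos 1 h11).eq_deriv _ h1 h2
    rw [stept, (hst i 1 h11 0 hT0).2, e1, src, P.profile_zero h (flipCoord_mem h11), rate]

end RectProblem

/-! ### Uniform convergence of the iterates -/

open Filter Topology in
/-- A family of statements `p N M` (“all differences of terms from the `N`-th on are at most `M`”)
which improves from `M` to `M / 2 + ε` with `N` eventually holds with every positive bound. -/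
theorem exists_of_halving {p : ℕ → ℝ → Prop} {M₀ : ℝ} (hM₀ : 0 ≤ M₀) (h0 : p 0 M₀)
    (hsucc : ∀ N M, p N M → p (N + 1) M) (hmono : ∀ N M M', M ≤ M' → p N M → p N M')
    (hstep : ∀ ε > 0, ∃ N₀, ∀ N ≥ N₀, ∀ M, 0 ≤ M → p N M → p (N + 1) (M / 2 + ε)) :
    ∀ δ > 0, ∃ N, p N δ := by
  intro δ hδ
  obtain ⟨N₀, hN₀⟩ := hstep (δ / 4) (by positivity)
  have h1 : ∀ N, p N M₀ := fun N => by
    induction N with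
    | zero => exact h0
    | succ N ih => exact hsucc _ _ ih
  have h2 : ∀ j : ℕ, p (N₀ + j) (M₀ / 2 ^ j + δ / 2) := by
    intro j
    induction j with
    | zero => exact hmono _ _ _ (by simp; linarith) (h1 _)
    | succ j ih =>
      refine hmono _ _ _ (le_of_eq ?_) (hN₀ (N₀ + j) (by omega) _ (by positivity) ih)
      rw [pow_succ]
      field_simp
      ring
  have h3 : Tendsto (fun j : ℕ => M₀ / 2 ^ j) atTop (𝓝 0) := by
    have h1 : Tendsto (fun m : ℕ => M₀ * (1 / 2 : ℝ) ^ m) atTop (𝓝 (M₀ * 0)) :=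
      (tendsto_pow_atTop_nhds_zero_of_lt_one (by norm_num) (by norm_num)).const_mul M₀
    rw [mul_zero] at h1
    refine h1.congr fun m => ?_
    rw [one_div, inv_pow, div_eq_mul_inv]
  obtain ⟨j, hj⟩ := (h3.eventually (gt_mem_nhds (show 0 < δ / 2 by positivity))).exists
  exact ⟨_, hmono _ _ _ (by linarith) (h2 j)⟩

open Filter in
/-- Composition with a continuous function preserves uniform Cauchy sequences on compact sets. -/
theorem UniformCauchySeqOn.continuous_comp {X E F : Type*} [PseudoMetricSpace X]
    [NormedAddCommGroup E] [ProperSpace E] [PseudoMetricSpace F] {s : Set X} (hs : IsCompact s)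
    {v : ℕ → X → E} {ρ : ℝ} (hρ : ∀ m, ∀ p ∈ s, ‖v m p‖ ≤ ρ) {G : X × E → F} (hG : Continuous G)
    (hv : UniformCauchySeqOn v atTop s) :
    UniformCauchySeqOn (fun m p => G (p, v m p)) atTop s := by
  have hc := (hs.prod (isCompact_closedBall (0 : E) ρ)).uniformContinuousOn_of_continuous
    hG.continuousOn
  rw [Metric.uniformContinuousOn_iff] at hc
  rw [Metric.uniformCauchySeqOn_iff] at hv ⊢
  intro ε hε
  obtain ⟨δ, hδ, h⟩ := hc ε hε
  obtain ⟨N, hN⟩ := hv δ hδ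
  refine ⟨N, fun m hm m' hm' p hp => h _ ⟨hp, ?_⟩ _ ⟨hp, ?_⟩ ?_⟩
  · simpa using hρ m p hp
  · simpa using hρ m' p hp
  · rw [Prod.dist_eq, dist_self]
    exact max_lt hδ (hN m hm m' hm' p hp)

open Filter in
theorem UniformCauchySeqOn.norm_le {X E : Type*} [NormedAddCommGroup E] {s : Set X}
    {v : ℕ → X → E} (hv : UniformCauchySeqOn v atTop s) {ε : ℝ} (hε : 0 < ε) :
    ∃ N, ∀ m ≥ N, ∀ m' ≥ N, ∀ p ∈ s, ‖v m p - v m' p‖ ≤ ε := by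
  rw [Metric.uniformCauchySeqOn_iff] at hv
  obtain ⟨N, hN⟩ := hv ε hε
  refine ⟨N, fun m hm m' hm' p hp => ?_⟩
  rw [← dist_eq_norm]
  exact (hN m hm m' hm' p hp).le

open Filter in
theorem uniformCauchySeqOn_of_norm_le {X E : Type*} [NormedAddCommGroup E] {s : Set X}
    {v : ℕ → X → E} {C : ℝ} (hC : 0 ≤ C)
    (h : ∀ δ > 0, ∃ N, ∀ m ≥ N, ∀ m' ≥ N, ∀ p ∈ s, ‖v m p - v m' p‖ ≤ C * δ) :
    UniformCauchySeqOn v atTop s := by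
  rw [Metric.uniformCauchySeqOn_iff]
  intro ε hε
  obtain ⟨N, hN⟩ := h (ε / (C + 1)) (by positivity)
  refine ⟨N, fun m hm m' hm' p hp => ?_⟩
  rw [dist_eq_norm]
  refine (hN m hm m' hm' p hp).trans_lt ?_
  rw [← mul_div_assoc, div_lt_iff₀ (by positivity)]
  nlinarith

namespace RectProblem

variable {n k : ℕ} {T : ℝ} (P : RectProblem n k T)

/-- The Picard iterates, each with its `x`-derivative and the `t`-derivative of its outgoing
values. The first one is affine in `t`. -/
def picard : ℕ → (Fin n → ℝ → ℝ → ℝ) × (Fin n → ℝ → ℝ → ℝ) × (Fin n → ℝ → ℝ)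
  | 0 => (fun i x t => P.φ i x + t * P.rate i, fun i x _ => P.φ' i x, fun i _ => P.rate i)
  | m + 1 => (P.step (picard m).1, P.stepx (picard m).1 (picard m).2.2 (picard m).2.1,
      P.stept (picard m).1 (picard m).2.2 (picard m).2.1)

/-- The Picard iterates. -/
def iter (m : ℕ) : Fin n → ℝ → ℝ → ℝ := (P.picard m).1

/-- The `x`-derivatives of the Picard iterates. -/
def iterx (m : ℕ) : Fin n → ℝ → ℝ → ℝ := (P.picard m).2.1

/-- The `t`-derivatives of the outgoing values of the Picard iterates. -/
def itert (m : ℕ) : Fin n → ℝ → ℝ := (P.picard m).2.2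

theorem iterx_succ (m : ℕ) : P.iterx (m + 1) = P.stepx (P.iter m) (P.itert m) (P.iterx m) := rfl

theorem itert_succ (m : ℕ) : P.itert (m + 1) = P.stept (P.iter m) (P.itert m) (P.iterx m) := rfl

theorem admissible_iter (m : ℕ) : P.Admissible (P.iter m) (P.iterx m) (P.itert m) := by
  induction m with
  | zero =>
    have hc : ∀ i, Continuous (P.φ i) := fun i =>
      continuous_iff_continuousAt.2 fun x => (P.derivφ i x).continuousAt
    refine ⟨fun i => ?_, fun i => ?_, fun i => continuousOn_const, fun i x _ t _ => ?_,
      fun i t _ => ?_, fun i x _ => ?_, fun i => rfl⟩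
    · have := hc i
      exact Continuous.continuousOn (by simp only [iter, picard]; fun_prop)
    · exact ((P.contφ' i).comp continuous_fst).continuousOn
    · exact ((P.derivφ i x).add_const (t * P.rate i)).hasDerivWithinAt
    · have := (((hasDerivAt_id t).mul_const (P.rate i)).const_add (P.φ i 1)).hasDerivWithinAt
        (s := Icc 0 T)
      rw [one_mul] at this
      exact this
    · simp [iter, picard]
  | succ m ih => exact ih.step

open Filter in
/-- The iterates stay bounded and converge uniformly. -/
theorem exists_bound_iter : ∃ ρ, 0 ≤ ρ ∧
    (∀ m, ∀ x ∈ Icc (0 : ℝ) 1, ∀ t ∈ Icc 0 T,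
      ‖profile k (P.iter m) x t‖ ≤ ρ ∧ ‖outgoing (P.iter m) t‖ ≤ ρ) ∧
    UniformCauchySeqOn (fun m (p : ℝ × ℝ) => profile k (P.iter m) p.1 p.2) atTop (rectBar T) ∧
    UniformCauchySeqOn (fun m t => outgoing (P.iter m) t) atTop (Icc 0 T) ∧
    (∀ i, UniformCauchySeqOn (fun m (p : ℝ × ℝ) => P.iter m i p.1 p.2) atTop (rectBar T)) := by
  have hT := P.T_pos
  obtain ⟨A₀, hA₀, hf, hh, hφ⟩ := P.exists_data_bound
  have hs : 0 ≤ ∑ i, |P.rate i| := Finset.sum_nonneg fun i _ => abs_nonneg _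
  set A := A₀ + ∑ i, |P.rate i| with hAdef
  have hA : 0 ≤ A := by positivity
  have hrA : ∀ i, |P.rate i| ≤ A := fun i =>
    (Finset.single_le_sum (f := fun i => |P.rate i|) (fun i _ => abs_nonneg _)
      (Finset.mem_univ i)).trans (by linarith)
  have hΛ : 0 ≤ |P.Λ| := abs_nonneg _
  obtain ⟨K, α, μ, R, hK0, hR, hw', hRA, hK⟩ := exists_invariant_radius n (C := P.C) hA hΛ hT.le
  have hw : IsWeight K P.Λ α μ := { hw' with
    speed_le := (mul_le_mul_of_nonneg_left (le_abs_self _) hw'.α_nonneg).trans hw'.speed_le }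
  have hinv : ∀ m, WBound T α μ R (P.iter m) := by
    intro m
    induction m with
    | zero =>
      intro i x hx t ht
      have h1 : |P.φ i x + t * P.rate i| ≤ A * (1 + T) := by
        have h2 := hφ i x hx
        have h3 : |t * P.rate i| ≤ T * A := by
          rw [abs_mul, abs_of_nonneg ht.1]
          exact mul_le_mul ht.2 (hrA i) (abs_nonneg _) hT.le
        have := abs_add_le (P.φ i x) (t * P.rate i)
        linarith
      refine h1.trans ?_
      have h2 := hw.exp_neg_le hx.2 ht.1
      have h3 : A * (1 + T) ≤ R * Real.exp (-α) := by
        rw [Real.exp_neg, ← div_eq_mul_inv, le_div_iff₀ (Real.exp_pos _)]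
        have : 0 ≤ A * (1 + T) * Real.exp α := by positivity
        linarith
      exact h3.trans (mul_le_mul_of_nonneg_left h2 hR)
    | succ m ih =>
      exact P.step_invariant ih hA (fun x hx t ht => (hf x hx t ht).trans (by linarith))
        (fun t ht => (hh t ht).trans (by linarith)) (fun i x hx => (hφ i x hx).trans (by linarith))
        hR hw hK hRA
  set ρ := n * (R * Real.exp (μ * T)) with hρdef
  have hρ : 0 ≤ ρ := by positivity
  have hb : ∀ m, ∀ x ∈ Icc (0 : ℝ) 1, ∀ t ∈ Icc 0 T,
      ‖profile k (P.iter m) x t‖ ≤ ρ ∧ ‖outgoing (P.iter m) t‖ ≤ ρ := fun m x hx t ht =>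
    WBound.norm_le_radius (hinv m) hw hR hx ht
  have hconv : ∀ δ > 0, ∃ N : ℕ, ∀ m ≥ N, ∀ m' ≥ N,
      WBound T α μ δ fun i x t => P.iter m i x t - P.iter m' i x t := by
    refine exists_of_halving (p := fun N M => ∀ m ≥ N, ∀ m' ≥ N,
      WBound T α μ M fun i x t => P.iter m i x t - P.iter m' i x t) (M₀ := 2 * R) (by positivity)
      ?_ ?_ ?_ ?_
    · intro m _ m' _ i x hx t ht
      have h1 := hinv m i x hx t ht
      have h2 := hinv m' i x hx t ht
      have := abs_sub (P.iter m i x t) (P.iter m' i x t)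
      linarith
    · exact fun N M h m hm m' hm' => h m (by omega) m' (by omega)
    · exact fun N M M' hM h m hm m' hm' => (h m hm m' hm').mono hM
    · intro ε hε
      refine ⟨0, fun N _ M hM h m hm m' hm' => ?_⟩
      obtain ⟨m, rfl⟩ : ∃ j, m = j + 1 := ⟨m - 1, by omega⟩
      obtain ⟨m', rfl⟩ : ∃ j, m' = j + 1 := ⟨m' - 1, by omega⟩
      exact (P.step_contraction (P.admissible_iter m).contU (P.admissible_iter m').contU hρ (hb m)
        (hb m') hK hw hM (h m (by omega) m' (by omega))).mono (by linarith)
  refine ⟨ρ, hρ, hb, ?_, ?_, fun i => ?_⟩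
  · refine uniformCauchySeqOn_of_norm_le (C := n * Real.exp (μ * T)) (by positivity) fun δ hδ => ?_
    obtain ⟨N, hN⟩ := hconv δ hδ
    refine ⟨N, fun m hm m' hm' p hp => ?_⟩
    rw [profile_sub]
    refine ((WBound.norm_le_radius (hN m hm m' hm') hw hδ.le hp.1 hp.2).1).trans (le_of_eq ?_)
    ring
  · refine uniformCauchySeqOn_of_norm_le (C := n * Real.exp (μ * T)) (by positivity) fun δ hδ => ?_
    obtain ⟨N, hN⟩ := hconv δ hδ
    refine ⟨N, fun m hm m' hm' t ht => ?_⟩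
    rw [outgoing_sub]
    refine ((WBound.norm_le_radius (k := k) (hN m hm m' hm') hw hδ.le
      (x := 0) ⟨le_rfl, zero_le_one⟩ ht).2).trans (le_of_eq ?_)
    ring
  · refine uniformCauchySeqOn_of_norm_le (C := Real.exp (μ * T)) (by positivity) fun δ hδ => ?_
    obtain ⟨N, hN⟩ := hconv δ hδ
    refine ⟨N, fun m hm m' hm' p hp => ?_⟩
    refine ((hN m hm m' hm').abs_le hw hδ.le hp.1 hp.2).trans ?_
    rw [mul_comm]
    have := mul_le_mul_of_nonneg_left hp.2.2 hw.μ_pos.le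
    gcongr

end RectProblem

/-! ### Uniform convergence of the derivatives -/

/-- The weighted estimate for the formula defining `CharFlow.solx`. -/
theorem CharFlow.abs_div_le {l lx : ℝ → ℝ → ℝ} {l₀ Λ D : ℝ} (c : CharFlow l l₀ Λ D)
    (h : IsSpeed l lx l₀ Λ D) {T x t : ℝ} (hx : x ∈ Icc (0 : ℝ) 1) (ht : t ∈ Icc 0 T)
    {G : ℝ → ℝ} {θ A K M α μ : ℝ} (hA : 0 ≤ A) (hK : 0 ≤ K) (hM : 0 ≤ M)
    (hw : IsWeight (Real.exp (D * T) * K) Λ α μ)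
    (hθ₀ : 0 ≤ c.Y x t → |θ| ≤ A)
    (hθ₁ : c.Y x t < 0 → |θ| ≤ A + K * (M * Real.exp (μ * c.entry (c.Y x t) - α)))
    (hG : ∀ s ∈ Icc (c.entry (c.Y x t)) t, |G s| ≤ A + K * (M * Real.exp (μ * s))) :
    |(c.J (c.Y x t) (c.entry (c.Y x t)) * θ
        + ∫ s in c.entry (c.Y x t)..t, c.J (c.Y x t) s * G s) / c.J (c.Y x t) t|
      ≤ (Real.exp (D * T) * A * (1 + T) * Real.exp α + M / 2) * Real.exp (μ * t - α * x) := by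
  have hJ := c.J_pos (c.Y x t) t
  have hD : 0 ≤ D := (abs_nonneg _).trans (h.bound 0 0)
  have hT : 0 ≤ T := ht.1.trans ht.2
  have key := c.abs_integral_le h hx ht (κ := fun s => c.J (c.Y x t) s / c.J (c.Y x t) t)
    hA hK hM hw (fun s hs => ⟨(div_pos (c.J_pos _ _) hJ).le, ?_⟩) hθ₀ hθ₁ hG
  · have e1 : (c.J (c.Y x t) (c.entry (c.Y x t)) * θ
        + ∫ s in c.entry (c.Y x t)..t, c.J (c.Y x t) s * G s) / c.J (c.Y x t) t
        = c.J (c.Y x t) (c.entry (c.Y x t)) / c.J (c.Y x t) t * θ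
          + ∫ s in c.entry (c.Y x t)..t, c.J (c.Y x t) s / c.J (c.Y x t) t * G s := by
      rw [add_div, ← intervalIntegral.integral_div, mul_div_right_comm]
      simp only [mul_div_right_comm]
    rw [e1]
    refine key.trans ?_
    have h1 : 1 ≤ Real.exp α * Real.exp (μ * t - α * x) := by
      have h3 := hw.exp_neg_le hx.2 ht.1
      calc (1 : ℝ) = Real.exp α * Real.exp (-α) := by rw [← Real.exp_add]; simp
        _ ≤ _ := mul_le_mul_of_nonneg_left h3 (Real.exp_pos _).le
    have h2 : 0 ≤ Real.exp (D * T) * A * (1 + T) := by positivity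
    have h3 := mul_le_mul_of_nonneg_left h1 h2
    linarith
  · rw [div_le_iff₀ hJ]
    refine (c.J_le _ s t hs.2).trans (mul_le_mul_of_nonneg_right (Real.exp_le_exp.2 ?_) hJ.le)
    refine mul_le_mul_of_nonneg_left ?_ hD
    have := c.entry_nonneg (c.Y x t)
    linarith [hs.1, ht.2]

theorem EVec.abs_sub_apply_le {n : ℕ} (y z : EVec n) (i : Fin n) : |y i - z i| ≤ ‖y - z‖ :=
  EVec.abs_apply_le (y - z) i

namespace RectProblem

variable {n k : ℕ} {T : ℝ} (P : RectProblem n k T)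
  {U w U' w' : Fin n → ℝ → ℝ → ℝ} {r r' : Fin n → ℝ → ℝ} {A K M α μ : ℝ}

/-- The `x`-derivative at the inflow boundary which the equation and the boundary condition
prescribe. -/
def inflowx (U : Fin n → ℝ → ℝ → ℝ) (r : Fin n → ℝ → ℝ) (i : Fin n) (t : ℝ) : ℝ :=
  (P.src U i 0 t - P.bdryt U r i t) / P.l i 0 t

/-- The largest ratio `J y s / J y t` for `0 ≤ s ≤ t ≤ T`. -/
def jac : ℝ := Real.exp (P.D * T)

/-- Weighted bound of the derivatives of the next iterate. -/
theorem wbound_stepx (hA : 0 ≤ A) (hK : 0 ≤ K) (hM : 0 ≤ M)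
    (hwt : IsWeight (P.jac * K) P.Λ α μ)
    (hφ : ∀ i, ∀ x ∈ Icc (0 : ℝ) 1, |P.φ' i x| ≤ A)
    (hη : ∀ i, ∀ t ∈ Icc 0 T, |P.inflowx U r i t| ≤ A + K * (M * Real.exp (μ * t - α)))
    (hg : ∀ i, ∀ x ∈ Icc (0 : ℝ) 1, ∀ t ∈ Icc 0 T,
      |P.srcx U w i x t| ≤ A + K * (M * Real.exp (μ * t))) :
    WBound T α μ (P.jac * A * (1 + T) * Real.exp α + M / 2) (P.stepx U r w) := by
  intro i x hx t ht
  have hent := P.char_mem i hx ht ⟨le_rfl, (P.flow i).entry_le (P.speed i) hx.1 ht.1⟩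
  refine (P.flow i).abs_div_le (P.speed i) hx ht hA hK hM hwt (fun hy => ?_) (fun hy => ?_)
    fun s hs => ?_
  · have := hent.1
    rw [(P.flow i).entry_of_nonneg (P.speed i) hy, (P.flow i).zero] at this
    simp only [CharFlow.inflowDeriv, hy, if_true]
    exact hφ i _ this
  · have := hent.2
    rw [(P.flow i).entry_of_neg (P.speed i) hy] at this ⊢
    simp only [CharFlow.inflowDeriv, not_le.2 hy, if_false]
    exact hη i _ this
  · obtain ⟨h1, h2⟩ := P.char_mem i hx ht hs
    exact hg i _ h1 _ h2

/-- The map `P.stepx` is affine in the derivatives `w`, `r`, so differences obey the same estimate,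
without a contribution of the initial data. -/
theorem wbound_stepx_sub (hU : ContOnRect T U) (hw : ContOnRect T w)
    (hU' : ContOnRect T U') (hw' : ContOnRect T w') (hA : 0 ≤ A) (hK : 0 ≤ K) (hM : 0 ≤ M)
    (hwt : IsWeight (P.jac * K) P.Λ α μ)
    (hη : ∀ i, ∀ t ∈ Icc 0 T,
      |P.inflowx U r i t - P.inflowx U' r' i t| ≤ A + K * (M * Real.exp (μ * t - α)))
    (hg : ∀ i, ∀ x ∈ Icc (0 : ℝ) 1, ∀ t ∈ Icc 0 T,
      |P.srcx U w i x t - P.srcx U' w' i x t| ≤ A + K * (M * Real.exp (μ * t))) :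
    WBound T α μ (P.jac * A * (1 + T) * Real.exp α + M / 2)
      fun i x t => P.stepx U r w i x t - P.stepx U' r' w' i x t := by
  intro i x hx t ht
  have hent := P.char_mem i hx ht ⟨le_rfl, (P.flow i).entry_le (P.speed i) hx.1 ht.1⟩
  have hJ : Continuous fun s => (P.flow i).J ((P.flow i).Y x t) s :=
    (P.flow i).contJ.comp (continuous_const.prodMk continuous_id)
  have i1 : IntervalIntegrable (fun s => (P.flow i).J ((P.flow i).Y x t) s
      * P.srcx U w i ((P.flow i).Ψ ((P.flow i).Y x t) s) s) MeasureTheory.volume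
      ((P.flow i).entry ((P.flow i).Y x t)) t :=
    (hJ.continuousOn.mul (P.intervalIntegrable_char i hx ht
      (P.continuousOn_srcx hU hw i))).intervalIntegrable
  have i2 : IntervalIntegrable (fun s => (P.flow i).J ((P.flow i).Y x t) s
      * P.srcx U' w' i ((P.flow i).Ψ ((P.flow i).Y x t) s) s) MeasureTheory.volume
      ((P.flow i).entry ((P.flow i).Y x t)) t :=
    (hJ.continuousOn.mul (P.intervalIntegrable_char i hx ht
      (P.continuousOn_srcx hU' hw' i))).intervalIntegrable
  have key := (P.flow i).abs_div_le (P.speed i) hx ht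
    (θ := (P.flow i).inflowDeriv (P.φ' i) (P.bdryt U r i) (P.src U i) ((P.flow i).Y x t)
      - (P.flow i).inflowDeriv (P.φ' i) (P.bdryt U' r' i) (P.src U' i) ((P.flow i).Y x t))
    (G := fun s => P.srcx U w i ((P.flow i).Ψ ((P.flow i).Y x t) s) s
      - P.srcx U' w' i ((P.flow i).Ψ ((P.flow i).Y x t) s) s)
    hA hK hM hwt (fun hy => ?_) (fun hy => ?_) fun s hs => ?_
  · refine le_trans (le_of_eq ?_) key
    simp only [stepx, CharFlow.solx, mul_sub, intervalIntegral.integral_sub i1 i2]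
    congr 1
    ring
  · simpa [CharFlow.inflowDeriv, hy] using hA
  · have := hent.2
    rw [(P.flow i).entry_of_neg (P.speed i) hy] at this ⊢
    simp only [CharFlow.inflowDeriv, not_le.2 hy, if_false]
    exact hη i _ this
  · obtain ⟨h1, h2⟩ := P.char_mem i hx ht hs
    exact hg i _ h1 _ h2

theorem norm_profilex_le {w : Fin n → ℝ → ℝ → ℝ} {B x t : ℝ} (hB : 0 ≤ B)
    (hx : x ∈ Icc (0 : ℝ) 1) (hw : ∀ j, ∀ ξ ∈ Icc (0 : ℝ) 1, |w j ξ t| ≤ B) :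
    ‖profilex k w x t‖ ≤ n * B :=
  EVec.norm_le hB fun j => by
    simp only [profilex, abs_mul, abs_flipSign, one_mul]
    exact hw j _ (flipCoord_mem hx)

theorem profilex_sub (x t : ℝ) : profilex k w x t - profilex k w' x t
    = profilex k (fun i x t => w i x t - w' i x t) x t := by
  ext j
  simp [profilex, mul_sub]

/-- Bounds of the coefficients on the ball of radius `ρ`. -/
theorem exists_coeff_bound (ρ : ℝ) : ∃ B, 0 ≤ B ∧
    (∀ x ∈ Icc (0 : ℝ) 1, ∀ t ∈ Icc 0 T, ∀ y : EVec n, ‖y‖ ≤ ρ →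
      ‖P.f x t y‖ ≤ B ∧ ‖P.fx x t y‖ ≤ B ∧ ‖P.fy x t y‖ ≤ B) ∧
    (∀ t ∈ Icc 0 T, ∀ z : EVec n, ‖z‖ ≤ ρ → ‖P.ht t z‖ ≤ B ∧ ‖P.hz t z‖ ≤ B) ∧
    (∀ i, ∀ x ∈ Icc (0 : ℝ) 1, |P.φ' i x| ≤ B) ∧ (∀ i, |P.rate i| ≤ B) := by
  have hc₁ := (isCompact_rectBar T).prod (isCompact_closedBall (0 : EVec n) ρ)
  have hc₂ := (isCompact_Icc (a := 0) (b := T)).prod (isCompact_closedBall (0 : EVec n) ρ)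
  obtain ⟨B₁, h₁⟩ := hc₁.exists_bound_of_continuousOn P.contf.continuousOn
  obtain ⟨B₂, h₂⟩ := hc₁.exists_bound_of_continuousOn P.contfx.continuousOn
  obtain ⟨B₃, h₃⟩ := hc₁.exists_bound_of_continuousOn P.contfy.continuousOn
  obtain ⟨B₄, h₄⟩ := hc₂.exists_bound_of_continuousOn P.contht.continuousOn
  obtain ⟨B₅, h₅⟩ := hc₂.exists_bound_of_continuousOn P.conthz.continuousOn
  choose B₆ h₆ using fun i => (isCompact_Icc (a := (0 : ℝ)) (b := 1)).exists_bound_of_continuousOn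
    (P.contφ' i).continuousOn
  have s₁ := abs_nonneg B₁
  have s₂ := abs_nonneg B₂
  have s₃ := abs_nonneg B₃
  have s₄ := abs_nonneg B₄
  have s₅ := abs_nonneg B₅
  have s₆ : 0 ≤ ∑ i, |B₆ i| := Finset.sum_nonneg fun i _ => abs_nonneg _
  have s₇ : 0 ≤ ∑ i, |P.rate i| := Finset.sum_nonneg fun i _ => abs_nonneg _
  refine ⟨|B₁| + |B₂| + |B₃| + |B₄| + |B₅| + (∑ i, |B₆ i|) + ∑ i, |P.rate i|, by positivity,
    fun x hx t ht y hy => ?_, fun t ht z hz => ?_, fun i x hx => ?_, fun i => ?_⟩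
  · have hm : ((x, t), y) ∈ rectBar T ×ˢ Metric.closedBall (0 : EVec n) ρ :=
      ⟨⟨hx, ht⟩, by simpa using hy⟩
    have a₁ := (h₁ _ hm).trans (le_abs_self _)
    have a₂ := (h₂ _ hm).trans (le_abs_self _)
    have a₃ := (h₃ _ hm).trans (le_abs_self _)
    simp only at a₁ a₂ a₃
    refine ⟨?_, ?_, ?_⟩ <;> linarith
  · have hm : (t, z) ∈ Icc 0 T ×ˢ Metric.closedBall (0 : EVec n) ρ := ⟨ht, by simpa using hz⟩
    have a₁ := (h₄ _ hm).trans (le_abs_self _)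
    have a₂ := (h₅ _ hm).trans (le_abs_self _)
    simp only at a₁ a₂
    refine ⟨?_, ?_⟩ <;> linarith
  · have := ((h₆ i x hx).trans (le_abs_self _)).trans
      (Finset.single_le_sum (f := fun i => |B₆ i|) (fun i _ => abs_nonneg _) (Finset.mem_univ i))
    rw [Real.norm_eq_abs] at this
    linarith
  · have := Finset.single_le_sum (f := fun i => |P.rate i|) (fun i _ => abs_nonneg _)
      (Finset.mem_univ i)
    linarith

/-- A difference of products of linear maps and vectors. -/
theorem norm_clm_sub_le {E F : Type*} [NormedAddCommGroup E] [NormedSpace ℝ E]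
    [NormedAddCommGroup F] [NormedSpace ℝ F] {L L' : E →L[ℝ] F} {v v' : E} {B ε S d : ℝ}
    (hL : ‖L‖ ≤ B) (hLL : ‖L - L'‖ ≤ ε) (hv : ‖v'‖ ≤ S) (hvv : ‖v - v'‖ ≤ d) (hB : 0 ≤ B)
    (hε : 0 ≤ ε) :
    ‖L v - L' v'‖ ≤ B * d + ε * S := by
  have e : L v - L' v' = L (v - v') + (L - L') v' := by simp
  rw [e]
  refine norm_add_le_of_le ?_ ?_
  · exact (L.le_opNorm _).trans (mul_le_mul hL hvv (norm_nonneg _) hB)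
  · exact ((L - L').le_opNorm _).trans (mul_le_mul hLL hv (norm_nonneg _) hε)

theorem abs_srcx_sub_le (i : Fin n) {x t B ε S d : ℝ} (hB : 0 ≤ B) (hε : 0 ≤ ε)
    (h₁ : ‖P.fx (flipCoord k i x) t (profile k U (flipCoord k i x) t)
      - P.fx (flipCoord k i x) t (profile k U' (flipCoord k i x) t)‖ ≤ ε)
    (h₂ : ‖P.fy (flipCoord k i x) t (profile k U (flipCoord k i x) t)‖ ≤ B)
    (h₃ : ‖P.fy (flipCoord k i x) t (profile k U (flipCoord k i x) t)
      - P.fy (flipCoord k i x) t (profile k U' (flipCoord k i x) t)‖ ≤ ε)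
    (h₄ : ‖profilex k w' (flipCoord k i x) t‖ ≤ S)
    (h₅ : ‖profilex k w (flipCoord k i x) t - profilex k w' (flipCoord k i x) t‖ ≤ d) :
    |P.srcx U w i x t - P.srcx U' w' i x t| ≤ ε + (B * d + ε * S) := by
  rw [srcx, srcx, ← mul_sub, abs_mul, abs_flipSign, one_mul]
  refine le_trans (EVec.abs_sub_apply_le _ _ i) ?_
  rw [add_sub_add_comm]
  exact norm_add_le_of_le h₁ (norm_clm_sub_le h₂ h₃ h₄ h₅ hB hε)

theorem abs_bdryt_sub_le (i : Fin n) {t B ε S d : ℝ} (hB : 0 ≤ B) (hε : 0 ≤ ε)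
    (h₁ : ‖P.ht t (outgoing U t) - P.ht t (outgoing U' t)‖ ≤ ε)
    (h₂ : ‖P.hz t (outgoing U t)‖ ≤ B) (h₃ : ‖P.hz t (outgoing U t) - P.hz t (outgoing U' t)‖ ≤ ε)
    (h₄ : ‖(WithLp.toLp 2 fun j => r' j t : EVec n)‖ ≤ S)
    (h₅ : ‖(WithLp.toLp 2 fun j => r j t : EVec n) - WithLp.toLp 2 fun j => r' j t‖ ≤ d) :
    |P.bdryt U r i t - P.bdryt U' r' i t| ≤ ε + (B * d + ε * S) := by
  refine le_trans (EVec.abs_sub_apply_le _ _ i) ?_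
  rw [add_sub_add_comm]
  exact norm_add_le_of_le h₁ (norm_clm_sub_le h₂ h₃ h₄ h₅ hB hε)

/-- The part of `P.itert m` that does not involve `P.iterx m`. From the second iterate on it is a
source term, hence bounded and uniformly convergent. -/
def outflowRate (m : ℕ) (i : Fin n) (t : ℝ) : ℝ := P.itert m i t + P.l i 1 t * P.iterx m i 1 t

theorem outflowRate_succ (m : ℕ) (i : Fin n) (t : ℝ) :
    P.outflowRate (m + 1) i t = P.src (P.iter m) i 1 t := by
  rw [outflowRate, itert_succ, iterx_succ, stept]
  ring

theorem itert_eq (m : ℕ) (i : Fin n) (t : ℝ) :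
    P.itert m i t = P.outflowRate m i t - P.l i 1 t * P.iterx m i 1 t := by
  rw [outflowRate]; ring

theorem abs_l_le (i : Fin n) (x t : ℝ) : |P.l i x t| ≤ P.Λ := by
  rw [abs_of_nonneg ((P.speed i).pos.le.trans ((P.speed i).lower x t))]
  exact (P.speed i).upper x t

theorem abs_inflowx_le (i : Fin n) {a t b : ℝ} (hb : |a| ≤ b) :
    |a / P.l i 0 t| ≤ b / P.l₀ := by
  have h0 := (P.speed i).pos
  have h1 := (P.speed i).lower 0 t
  rw [abs_div, abs_of_pos (h0.trans_le h1)]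
  have h2 := (abs_nonneg a).trans hb
  gcongr

set_option maxHeartbeats 400000 in
open Filter in
/-- The `x`-derivatives of the iterates converge uniformly. They satisfy a linear recursion whose
coefficients depend on the iterates only, so the weighted estimate applies to their differences
up to an error that tends to zero. -/
theorem uniformCauchySeqOn_iterx (i : Fin n) :
    UniformCauchySeqOn (fun m (p : ℝ × ℝ) => P.iterx m i p.1 p.2) atTop (rectBar T) := by
  have hT := P.T_pos
  have hn : (0 : ℝ) ≤ n := n.cast_nonneg
  have hΛ := P.Λ_nonneg i
  have hl₀ := (P.speed i).pos
  obtain ⟨ρ, hρ, hb, hcp, hco, -⟩ := P.exists_bound_iter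
  have hbp : ∀ m, ∀ p ∈ rectBar T, ‖profile k (P.iter m) p.1 p.2‖ ≤ ρ := fun m p hp =>
    (hb m p.1 hp.1 p.2 hp.2).1
  have hbo : ∀ m, ∀ t ∈ Icc 0 T, ‖outgoing (P.iter m) t‖ ≤ ρ := fun m t ht =>
    (hb m 0 ⟨le_rfl, zero_le_one⟩ t ht).2
  obtain ⟨B, hB, hfB, hhB, hφB, hrB⟩ := P.exists_coeff_bound ρ
  have h0m : (0 : ℝ) ∈ Icc (0 : ℝ) 1 := ⟨le_rfl, zero_le_one⟩
  have h1m : (1 : ℝ) ∈ Icc (0 : ℝ) 1 := ⟨zero_le_one, le_rfl⟩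
  have hE : 1 ≤ P.jac :=
    Real.one_le_exp (mul_nonneg ((abs_nonneg _).trans ((P.speed i).bound 0 0)) hT.le)
  have hsrcB : ∀ m j, ∀ x ∈ Icc (0 : ℝ) 1, ∀ t ∈ Icc 0 T, |P.src (P.iter m) j x t| ≤ B :=
    fun m j x hx t ht => (EVec.abs_apply_le _ j).trans
      (hfB _ (flipCoord_mem hx) t ht _ (hb m _ (flipCoord_mem hx) t ht).1).1
  -- `B₁` also covers the first iterate, which does not come from a transport equation
  obtain ⟨B₁, hB₁⟩ : ∃ a, a = B + P.Λ * B := ⟨_, rfl⟩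
  have hB₁0 : 0 ≤ B₁ := by rw [hB₁]; positivity
  have hBB₁ : B ≤ B₁ := by
    have : 0 ≤ P.Λ * B := by positivity
    linarith
  have houtB : ∀ m j, ∀ t ∈ Icc 0 T, |P.outflowRate m j t| ≤ B₁ := by
    intro m j t ht
    cases m with
    | zero =>
      have h1 : |P.l j 1 t * P.iterx 0 j 1 t| ≤ P.Λ * B := by
        rw [abs_mul]
        exact mul_le_mul (P.abs_l_le j 1 t) (hφB j 1 h1m) (abs_nonneg _) hΛ
      exact (abs_add_le _ _).trans (hB₁ ▸ add_le_add (hrB j) h1)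
    | succ m =>
      rw [outflowRate_succ]
      exact (hsrcB m j 1 h1m t ht).trans hBB₁
  -- `K` collects the coefficients of `P.iterx m` in the boundary and in the source terms
  obtain ⟨K, hKdef⟩ : ∃ a, a = B * (n * P.Λ) / P.l₀ + B * n := ⟨_, rfl⟩
  have hK : 0 ≤ K := by rw [hKdef]; positivity
  have hK1 : B * (n * P.Λ) / P.l₀ ≤ K := by
    have : 0 ≤ B * n := by positivity
    linarith
  have hK2 : B * n ≤ K := by
    have : 0 ≤ B * (n * P.Λ) / P.l₀ := by positivity
    linarith
  obtain ⟨α, μ, hwt⟩ := exists_isWeight (P.jac * K) P.Λ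
  have hrM : ∀ (M : ℝ) (m : ℕ), 0 ≤ M → WBound T α μ M (P.iterx m) → ∀ t ∈ Icc 0 T,
      ‖(WithLp.toLp 2 fun j => P.itert m j t : EVec n)‖
        ≤ n * (B₁ + P.Λ * (M * Real.exp (μ * t - α))) := by
    intro M m hM hbm t ht
    refine EVec.norm_le (by positivity) fun j => ?_
    change |P.itert m j t| ≤ _
    rw [itert_eq]
    refine (abs_sub _ _).trans (add_le_add (houtB m j t ht) ?_)
    rw [abs_mul]
    refine mul_le_mul (P.abs_l_le j 1 t) ?_ (abs_nonneg _) hΛ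
    simpa using hbm j 1 h1m t ht
  -- all derivatives lie in the weighted ball of radius `M₁`, the fixed point of
  -- `M ↦ P.jac * A * (1 + T) * exp α + M / 2`
  obtain ⟨A, hA⟩ : ∃ a, a = B + (B + (B + B * (n * B₁))) / P.l₀ := ⟨_, rfl⟩
  have hA0 : 0 ≤ A := by rw [hA]; positivity
  have hBA : B ≤ A := by
    have : 0 ≤ (B + (B + B * (n * B₁))) / P.l₀ := by positivity
    linarith
  obtain ⟨M₁, hM₁⟩ : ∃ a, a = 2 * (P.jac * A * (1 + T) * Real.exp α) := ⟨_, rfl⟩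
  have hM₁0 : 0 ≤ M₁ := by rw [hM₁]; positivity
  have hbd : ∀ m, WBound T α μ M₁ (P.iterx m) := by
    intro m
    induction m with
    | zero =>
      intro j x hx t ht
      have h1 : 1 ≤ Real.exp α * Real.exp (μ * t - α * x) := by
        have h3 := hwt.exp_neg_le hx.2 ht.1
        calc (1 : ℝ) = Real.exp α * Real.exp (-α) := by rw [← Real.exp_add]; simp
          _ ≤ _ := mul_le_mul_of_nonneg_left h3 (Real.exp_pos _).le
      have h2 : A ≤ 2 * (P.jac * A * (1 + T)) := by
        have : A ≤ P.jac * A := le_mul_of_one_le_left hA0 hE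
        have : 0 ≤ P.jac * A * T := by positivity
        linarith
      calc |P.iterx 0 j x t| ≤ A := (hφB j x hx).trans hBA
        _ ≤ 2 * (P.jac * A * (1 + T)) * 1 := by rw [mul_one]; exact h2
        _ ≤ 2 * (P.jac * A * (1 + T)) * (Real.exp α * Real.exp (μ * t - α * x)) :=
            mul_le_mul_of_nonneg_left h1 (by positivity)
        _ = M₁ * Real.exp (μ * t - α * x) := by rw [hM₁]; ring
    | succ m ih =>
      refine (P.wbound_stepx hA0 hK hM₁0 hwt (fun j x hx => (hφB j x hx).trans hBA) ?_ ?_).mono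
        (M := P.jac * A * (1 + T) * Real.exp α + M₁ / 2) (le_of_eq (by rw [hM₁]; ring))
      · intro j t ht
        obtain ⟨W, hW⟩ : ∃ a, a = M₁ * Real.exp (μ * t - α) := ⟨_, rfl⟩
        have hW0 : 0 ≤ W := by rw [hW]; positivity
        have h1 : |P.bdryt (P.iter m) (P.itert m) j t| ≤ B + B * (n * (B₁ + P.Λ * W)) := by
          refine (EVec.abs_apply_le _ j).trans (norm_add_le_of_le (hhB t ht _ (hbo m t ht)).1 ?_)
          exact (ContinuousLinearMap.le_opNorm _ _).trans (mul_le_mul (hhB t ht _ (hbo m t ht)).2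
            (by rw [hW]; exact hrM M₁ m hM₁0 ih t ht) (norm_nonneg _) hB)
        refine (P.abs_inflowx_le j ((abs_sub _ _).trans
          (add_le_add (hsrcB m j 0 h0m t ht) h1))).trans ?_
        have h2 : (B + (B + B * (n * (B₁ + P.Λ * W)))) / P.l₀
            = (B + (B + B * (n * B₁))) / P.l₀ + B * (n * P.Λ) / P.l₀ * W := by
          field_simp; ring
        rw [h2, ← hW]
        exact add_le_add (by linarith) (mul_le_mul_of_nonneg_right hK1 hW0)
      · intro j x hx t ht
        have hx' := flipCoord_mem (k := k) (i := j) hx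
        have hc := hfB _ hx' t ht _ (hb m _ hx' t ht).1
        rw [srcx, abs_mul, abs_flipSign, one_mul]
        refine (EVec.abs_apply_le _ j).trans (norm_add_le_of_le (hc.2.1.trans hBA) ?_)
        refine (ContinuousLinearMap.le_opNorm _ _).trans ?_
        refine (mul_le_mul hc.2.2 (norm_profilex_le (B := M₁ * Real.exp (μ * t)) (by positivity) hx'
          fun j ξ hξ => ih.abs_le hwt hM₁0 hξ ht) (norm_nonneg _) hB).trans ?_
        rw [← mul_assoc]
        exact mul_le_mul_of_nonneg_right hK2 (by positivity)
  -- the coefficients of the recursion converge uniformly, so they differ by at most `ε` eventually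
  have cf := hcp.continuous_comp (isCompact_rectBar T) hbp P.contf
  have cfx := hcp.continuous_comp (isCompact_rectBar T) hbp P.contfx
  have cfy := hcp.continuous_comp (isCompact_rectBar T) hbp P.contfy
  have cht := hco.continuous_comp isCompact_Icc hbo P.contht
  have chz := hco.continuous_comp isCompact_Icc hbo P.conthz
  obtain ⟨S, hS⟩ : ∃ a, a = n * (M₁ * Real.exp (μ * T))
    + n * (B₁ + P.Λ * (M₁ * Real.exp (μ * T))) := ⟨_, rfl⟩
  have hS1 : 0 ≤ n * (M₁ * Real.exp (μ * T)) := by positivity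
  have hS2 : 0 ≤ n * (B₁ + P.Λ * (M₁ * Real.exp (μ * T))) := by positivity
  have hexpT : ∀ t ∈ Icc 0 T, Real.exp (μ * t) ≤ Real.exp (μ * T) := fun t ht =>
    Real.exp_le_exp.2 (mul_le_mul_of_nonneg_left ht.2 hwt.μ_pos.le)
  have hexpα : ∀ t, Real.exp (μ * t - α) ≤ Real.exp (μ * t) := fun t =>
    Real.exp_le_exp.2 (by linarith [hwt.α_nonneg])
  have hpxS : ∀ m, ∀ x ∈ Icc (0 : ℝ) 1, ∀ t ∈ Icc 0 T, ‖profilex k (P.iterx m) x t‖ ≤ S := by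
    intro m x hx t ht
    refine (norm_profilex_le (B := M₁ * Real.exp (μ * T)) (by positivity) hx fun j ξ hξ =>
      ((hbd m).abs_le hwt hM₁0 hξ ht).trans (mul_le_mul_of_nonneg_left (hexpT t ht) hM₁0)).trans ?_
    linarith
  have hrS : ∀ m, ∀ t ∈ Icc 0 T,
      ‖(WithLp.toLp 2 fun j => P.itert m j t : EVec n)‖ ≤ S := by
    intro m t ht
    refine (hrM M₁ m hM₁0 (hbd m) t ht).trans ?_
    have : n * (B₁ + P.Λ * (M₁ * Real.exp (μ * t - α)))
        ≤ n * (B₁ + P.Λ * (M₁ * Real.exp (μ * T))) := by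
      have := (hexpα t).trans (hexpT t ht)
      gcongr
    linarith
  obtain ⟨c, hc⟩ : ∃ a, a = 1 + S + (2 + B * n + S) / P.l₀ := ⟨_, rfl⟩
  have hSnn : 0 ≤ S := by rw [hS]; positivity
  have hc1 : 0 ≤ (2 + B * n + S) / P.l₀ := by positivity
  have hc0 : 0 < c := by rw [hc]; positivity
  obtain ⟨Q, hQ⟩ : ∃ a, a = P.jac * c * (1 + T) * Real.exp α := ⟨_, rfl⟩
  have hQ0 : 0 < Q := by rw [hQ]; positivity
  have hconv : ∀ δ > 0, ∃ N : ℕ, ∀ m ≥ N, ∀ m' ≥ N,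
      WBound T α μ δ fun i x t => P.iterx m i x t - P.iterx m' i x t := by
    refine exists_of_halving (p := fun N M => ∀ m ≥ N, ∀ m' ≥ N,
      WBound T α μ M fun i x t => P.iterx m i x t - P.iterx m' i x t) (M₀ := 2 * M₁)
      (by positivity) ?_ ?_ ?_ ?_
    · intro m _ m' _ j x hx t ht
      have h1 := hbd m j x hx t ht
      have h2 := hbd m' j x hx t ht
      have := abs_sub (P.iterx m j x t) (P.iterx m' j x t)
      linarith
    · exact fun N M h m hm m' hm' => h m (by omega) m' (by omega)
    · exact fun N M M' hM h m hm m' hm' => (h m hm m' hm').mono hM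
    · intro ε₀ hε₀
      obtain ⟨ε, hε⟩ : ∃ ε, ε = ε₀ / Q := ⟨_, rfl⟩
      have hε0 : 0 < ε := by rw [hε]; positivity
      obtain ⟨N₁, h₁⟩ := cf.norm_le hε0
      obtain ⟨N₂, h₂⟩ := cfx.norm_le hε0
      obtain ⟨N₃, h₃⟩ := cfy.norm_le hε0
      obtain ⟨N₄, h₄⟩ := cht.norm_le hε0
      obtain ⟨N₅, h₅⟩ := chz.norm_le hε0
      have hsrcε : ∀ m ≥ N₁, ∀ m' ≥ N₁, ∀ j, ∀ x ∈ Icc (0 : ℝ) 1, ∀ t ∈ Icc 0 T,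
          |P.src (P.iter m) j x t - P.src (P.iter m') j x t| ≤ ε := fun m hm m' hm' j x hx t ht =>
        (EVec.abs_sub_apply_le _ _ j).trans
          (h₁ m hm m' hm' (flipCoord k j x, t) ⟨flipCoord_mem hx, ht⟩)
      refine ⟨N₁ + N₂ + N₃ + N₄ + N₅ + 1, fun N hN M hM h => ?_⟩
      intro m hm m' hm'
      obtain ⟨m, rfl⟩ : ∃ j, m = j + 1 := ⟨m - 1, by omega⟩
      obtain ⟨m', rfl⟩ : ∃ j, m' = j + 1 := ⟨m' - 1, by omega⟩
      have hmm := h m (by omega) m' (by omega)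
      have ad := P.admissible_iter m
      have ad' := P.admissible_iter m'
      have hrr : ∀ t ∈ Icc 0 T, ‖(WithLp.toLp 2 fun j => P.itert m j t : EVec n)
          - WithLp.toLp 2 fun j => P.itert m' j t‖
          ≤ n * (ε + P.Λ * (M * Real.exp (μ * t - α))) := by
        intro t ht
        refine EVec.norm_le (by positivity) fun j => ?_
        change |P.itert m j t - P.itert m' j t| ≤ _
        obtain ⟨a, rfl⟩ : ∃ j, m = j + 1 := ⟨m - 1, by omega⟩
        obtain ⟨a', rfl⟩ : ∃ j, m' = j + 1 := ⟨m' - 1, by omega⟩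
        rw [itert_eq, itert_eq, outflowRate_succ, outflowRate_succ]
        have e : ∀ p p' q w w' : ℝ, p - q * w - (p' - q * w') = (p - p') - q * (w - w') := by
          intros; ring
        rw [e]
        refine (abs_sub _ _).trans (add_le_add
          (hsrcε a (by omega) a' (by omega) j 1 h1m t ht) ?_)
        rw [abs_mul]
        refine mul_le_mul (P.abs_l_le j 1 t) ?_ (abs_nonneg _) hΛ
        simpa using hmm j 1 h1m t ht
      refine (P.wbound_stepx_sub (A := ε * c) ad.contU ad.contw ad'.contU ad'.contw (by positivity)
        hK hM hwt ?_ ?_).mono (le_of_eq ?_)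
      · intro j t ht
        obtain ⟨W, hW⟩ : ∃ a, a = M * Real.exp (μ * t - α) := ⟨_, rfl⟩
        have hW0 : 0 ≤ W := by rw [hW]; positivity
        have d1 : |P.bdryt (P.iter m) (P.itert m) j t - P.bdryt (P.iter m') (P.itert m') j t|
            ≤ ε + (B * (n * (ε + P.Λ * W)) + ε * S) := by
          exact P.abs_bdryt_sub_le j hB hε0.le (h₄ m (by omega) m' (by omega) t ht)
            (hhB t ht _ (hbo m t ht)).2 (h₅ m (by omega) m' (by omega) t ht)
            (hrS m' t ht) (by rw [hW]; exact hrr t ht)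
        rw [inflowx, inflowx, ← sub_div, sub_sub_sub_comm]
        refine (P.abs_inflowx_le j ((abs_sub _ _).trans
          (add_le_add (hsrcε m (by omega) m' (by omega) j 0 h0m t ht) d1))).trans ?_
        have e2 : (ε + (ε + (B * (n * (ε + P.Λ * W)) + ε * S))) / P.l₀
            = ε * ((2 + B * n + S) / P.l₀) + B * (n * P.Λ) / P.l₀ * W := by
          field_simp; ring
        rw [e2, ← hW]
        exact add_le_add (mul_le_mul_of_nonneg_left (by linarith) hε0.le)
          (mul_le_mul_of_nonneg_right hK1 hW0)
      · intro j x hx t ht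
        have hx' := flipCoord_mem (k := k) (i := j) hx
        have hq : (flipCoord k j x, t) ∈ rectBar T := ⟨hx', ht⟩
        have d1 : ‖profilex k (P.iterx m) (flipCoord k j x) t
            - profilex k (P.iterx m') (flipCoord k j x) t‖ ≤ n * (M * Real.exp (μ * t)) := by
          rw [profilex_sub]
          exact norm_profilex_le (by positivity) hx' fun j ξ hξ => hmm.abs_le hwt hM hξ ht
        have q₂ := h₂ m (by omega) m' (by omega) _ hq
        have q₃ := h₃ m (by omega) m' (by omega) _ hq
        have q₄ := (hfB _ hx' t ht _ (hb m _ hx' t ht).1).2.2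
        have q₅ := hpxS m' _ hx' t ht
        refine (P.abs_srcx_sub_le (U := P.iter m) (w := P.iterx m) (U' := P.iter m')
          (w' := P.iterx m') j hB hε0.le q₂ q₄ q₃ q₅ d1).trans ?_
        have e3 : ε + (B * (n * (M * Real.exp (μ * t))) + ε * S)
            = ε * (1 + S) + B * n * (M * Real.exp (μ * t)) := by ring
        rw [e3]
        exact add_le_add (mul_le_mul_of_nonneg_left (by linarith) hε0.le)
          (mul_le_mul_of_nonneg_right hK2 (by positivity))
      · have e4 : P.jac * (ε * c) * (1 + T) * Real.exp α = ε * Q := by rw [hQ]; ring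
        have e5 : ε * Q = ε₀ := by rw [hε]; field_simp
        rw [e4, e5]; ring
  refine uniformCauchySeqOn_of_norm_le (C := Real.exp (μ * T)) (by positivity) fun δ hδ => ?_
  obtain ⟨N, hN⟩ := hconv δ hδ
  refine ⟨N, fun m hm m' hm' p hp => ?_⟩
  refine ((hN m hm m' hm').abs_le hwt hδ.le hp.1 hp.2).trans ?_
  rw [mul_comm]
  exact mul_le_mul_of_nonneg_right (hexpT _ hp.2) hδ.le

end RectProblem

/-! ### Existence on a rectangle -/

open Filter Topology in
theorem UniformCauchySeqOn.exists_tendstoUniformlyOn {X : Type*} {s : Set X} {v : ℕ → X → ℝ}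
    (hv : UniformCauchySeqOn v atTop s) : ∃ u : X → ℝ, TendstoUniformlyOn v u atTop s :=
  ⟨fun p => limUnder atTop fun m => v m p, hv.tendstoUniformlyOn_of_tendsto fun _ hp =>
    CauchySeq.tendsto_limUnder (hv.cauchySeq hp)⟩

namespace RectProblem

variable {n k : ℕ} {T : ℝ} (P : RectProblem n k T)

open Filter Topology in
theorem tendsto_profile {V : ℕ → Fin n → ℝ → ℝ → ℝ} {U : Fin n → ℝ → ℝ → ℝ} {x t : ℝ}
    (hx : x ∈ Icc (0 : ℝ) 1)
    (h : ∀ i, ∀ ξ ∈ Icc (0 : ℝ) 1, Tendsto (fun m => V m i ξ t) atTop (𝓝 (U i ξ t))) :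
    Tendsto (fun m => profile k (V m) x t) atTop (𝓝 (profile k U x t)) :=
  ((PiLp.continuous_toLp 2 (fun _ : Fin n => ℝ)).tendsto _).comp
    (tendsto_pi_nhds.2 fun i => h i _ (flipCoord_mem hx))

open Filter Topology in
theorem tendsto_outgoing {V : ℕ → Fin n → ℝ → ℝ → ℝ} {U : Fin n → ℝ → ℝ → ℝ} {t : ℝ}
    (h : ∀ i, Tendsto (fun m => V m i 1 t) atTop (𝓝 (U i 1 t))) :
    Tendsto (fun m => outgoing (V m) t) atTop (𝓝 (outgoing U t)) :=
  ((PiLp.continuous_toLp 2 (fun _ : Fin n => ℝ)).tendsto _).comp (tendsto_pi_nhds.2 h)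

open Filter in
/-- The `t`-derivatives of the outgoing values of the iterates converge uniformly. -/
theorem uniformCauchySeqOn_itert (i : Fin n) :
    UniformCauchySeqOn (fun m t => P.itert (m + 1) i t) atTop (Icc 0 T) := by
  obtain ⟨ρ, hρ, hb, hcp, -, -⟩ := P.exists_bound_iter
  have h1m : (1 : ℝ) ∈ Icc (0 : ℝ) 1 := ⟨zero_le_one, le_rfl⟩
  have cf := hcp.continuous_comp (isCompact_rectBar T) (fun m p hp => (hb m p.1 hp.1 p.2 hp.2).1)
    P.contf
  have hΛ := P.Λ_nonneg i
  refine uniformCauchySeqOn_of_norm_le (C := 1 + P.Λ) (by positivity) fun δ hδ => ?_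
  obtain ⟨N₁, h₁⟩ := cf.norm_le hδ
  obtain ⟨N₂, h₂⟩ := (P.uniformCauchySeqOn_iterx i).norm_le hδ
  refine ⟨N₁ + N₂, fun m hm m' hm' t ht => ?_⟩
  rw [itert_eq, itert_eq, outflowRate_succ, outflowRate_succ]
  have e : ∀ p p' q w w' : ℝ, p - q * w - (p' - q * w') = (p - p') - q * (w - w') := by
    intros; ring
  have a₁ : |P.src (P.iter m) i 1 t - P.src (P.iter m') i 1 t| ≤ δ :=
    (EVec.abs_sub_apply_le _ _ i).trans
      (h₁ m (by omega) m' (by omega) (flipCoord k i 1, t) ⟨flipCoord_mem h1m, ht⟩)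
  have a₂ : |P.iterx (m + 1) i 1 t - P.iterx (m' + 1) i 1 t| ≤ δ :=
    h₂ (m + 1) (by omega) (m' + 1) (by omega) (1, t) ⟨h1m, ht⟩
  rw [e, Real.norm_eq_abs]
  refine (abs_sub _ _).trans ?_
  rw [abs_mul]
  have := mul_le_mul (P.abs_l_le i 1 t) a₂ (abs_nonneg _) hΛ
  linarith

open Filter Topology in
/-- The limit of the Picard iterates is admissible. -/
theorem exists_admissible_limit : ∃ U w r, P.Admissible U w r ∧
    ∀ i, TendstoUniformlyOn (fun m (p : ℝ × ℝ) => P.iter m i p.1 p.2) (fun p => U i p.1 p.2) atTop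
      (rectBar T) := by
  have hT := P.T_pos
  have h1m : (1 : ℝ) ∈ Icc (0 : ℝ) 1 := ⟨zero_le_one, le_rfl⟩
  have hT0 : (0 : ℝ) ∈ Icc 0 T := ⟨le_rfl, hT.le⟩
  obtain ⟨ρ, hρ, hb, -, -, hc⟩ := P.exists_bound_iter
  choose U hu using fun i => (hc i).exists_tendstoUniformlyOn
  choose w hx using fun i => (P.uniformCauchySeqOn_iterx i).exists_tendstoUniformlyOn
  choose r ht using fun i => (P.uniformCauchySeqOn_itert i).exists_tendstoUniformlyOn
  have ad := P.admissible_iter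
  refine ⟨fun i x t => U i (x, t), fun i x t => w i (x, t), r,
    ⟨fun i => ?_, fun i => ?_, fun i => ?_, fun i x hx' t ht' => ?_, fun i => ?_,
      fun i x hx' => ?_, fun i => ?_⟩, hu⟩
  · exact (hu i).continuousOn (Frequently.of_forall fun m => (ad m).contU i)
  · exact (hx i).continuousOn (Frequently.of_forall fun m => (ad m).contw i)
  · exact (ht i).continuousOn (Frequently.of_forall fun m => (ad (m + 1)).contr i)
  · have hseg : ContinuousOn (fun x : ℝ => (x, t)) (Icc 0 1) := by fun_prop
    have hmaps : MapsTo (fun x : ℝ => (x, t)) (Icc (0 : ℝ) 1) (rectBar T) := fun y hy => ⟨hy, ht'⟩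
    refine hasDerivWithinAt_of_tendstoUniformlyOn zero_le_one
      (F := fun m x => P.iter m i x t) (F' := fun m x => P.iterx m i x t)
      (G := fun x => U i (x, t)) (G' := fun x => w i (x, t))
      (fun m y hy => (ad m).derivx i y hy t ht') (fun m => ((ad m).contw i).comp hseg hmaps)
      (fun y hy => (hu i).tendsto_at ⟨hy, ht'⟩) ?_ x hx'
    rw [Metric.tendstoUniformlyOn_iff]
    intro ε hε
    filter_upwards [Metric.tendstoUniformlyOn_iff.1 (hx i) ε hε] with m hm y hy
    exact hm (y, t) ⟨hy, ht'⟩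
  · exact hasDerivWithinAt_of_tendstoUniformlyOn hT.le
      (F := fun m t => P.iter (m + 1) i 1 t) (F' := fun m t => P.itert (m + 1) i t)
      (G := fun t => U i (1, t)) (G' := r i)
      (fun m t ht' => (ad (m + 1)).derivt i t ht') (fun m => (ad (m + 1)).contr i)
      (fun t ht' => ((hu i).tendsto_at (x := (1, t)) ⟨h1m, ht'⟩).comp (tendsto_add_atTop_nat 1))
      (ht i)
  · refine tendsto_nhds_unique ((hu i).tendsto_at (x := (x, 0)) ⟨hx', hT0⟩) ?_
    simp only [(ad _).init i x hx']
    exact tendsto_const_nhds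
  · refine tendsto_nhds_unique ((ht i).tendsto_at hT0) ?_
    simp only [(ad _).init_rate i]
    exact tendsto_const_nhds

open Filter Topology in
/-- The limit of the Picard iterates is a fixed point of the iteration. -/
theorem step_limit {U : Fin n → ℝ → ℝ → ℝ} (hU : ContOnRect T U)
    (hlim : ∀ i, TendstoUniformlyOn (fun m (p : ℝ × ℝ) => P.iter m i p.1 p.2)
      (fun p => U i p.1 p.2) atTop (rectBar T)) :
    ∀ i, ∀ x ∈ Icc (0 : ℝ) 1, ∀ t ∈ Icc 0 T, P.step U i x t = U i x t := by
  intro i x hx t ht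
  obtain ⟨ρ, hρ, hb, -, -, -⟩ := P.exists_bound_iter
  have hpt : ∀ i, ∀ x ∈ Icc (0 : ℝ) 1, ∀ t ∈ Icc 0 T,
      Tendsto (fun m => P.iter m i x t) atTop (𝓝 (U i x t)) :=
    fun i x hx t ht => (hlim i).tendsto_at (x := (x, t)) ⟨hx, ht⟩
  have hbU : ∀ x ∈ Icc (0 : ℝ) 1, ∀ t ∈ Icc 0 T, ‖profile k U x t‖ ≤ ρ ∧ ‖outgoing U t‖ ≤ ρ :=
    fun x hx t ht => ⟨le_of_tendsto' (tendsto_profile hx fun i ξ hξ => hpt i ξ hξ t ht).norm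
      fun m => (hb m x hx t ht).1, le_of_tendsto' (tendsto_outgoing fun i =>
        hpt i 1 ⟨zero_le_one, le_rfl⟩ t ht).norm fun m => (hb m x hx t ht).2⟩
  obtain ⟨α, μ, hw⟩ := exists_isWeight (n * P.lip ρ) P.Λ
  have key : Tendsto (fun m => P.step (P.iter m) i x t) atTop (𝓝 (P.step U i x t)) := by
    rw [Metric.tendsto_nhds]
    intro ε hε
    obtain ⟨δ, hδ⟩ : ∃ δ, δ = ε / (Real.exp α * Real.exp (μ * t - α * x)) := ⟨_, rfl⟩
    have hδ0 : 0 < δ := by rw [hδ]; positivity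
    filter_upwards [eventually_all.2 fun i => Metric.tendstoUniformlyOn_iff.1 (hlim i) δ hδ0]
      with m hm
    have hW : WBound T α μ (δ * Real.exp α) fun i x t => P.iter m i x t - U i x t := by
      intro j y hy s hs
      have h1 : |P.iter m j y s - U j y s| < δ := by
        have := hm j (y, s) ⟨hy, hs⟩
        rwa [dist_comm, Real.dist_eq] at this
      have h2 := hw.exp_neg_le hy.2 hs.1
      calc |P.iter m j y s - U j y s| ≤ δ * (Real.exp α * Real.exp (-α)) := by
            rw [← Real.exp_add]; simpa using h1.le
        _ ≤ δ * (Real.exp α * Real.exp (μ * s - α * y)) := by gcongr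
        _ = _ := by ring
    have h3 := P.step_contraction (P.admissible_iter m).contU hU hρ (hb m) hbU le_rfl hw
      (by positivity) hW i x hx t ht
    have h4 : δ * Real.exp α / 2 * Real.exp (μ * t - α * x) = ε / 2 := by
      rw [hδ]; field_simp
    rw [h4] at h3
    rw [Real.dist_eq]
    linarith
  exact tendsto_nhds_unique key ((hpt i x hx t ht).comp (tendsto_add_atTop_nat 1))

theorem profile_congr {U V : Fin n → ℝ → ℝ → ℝ} {x t : ℝ} (hx : x ∈ Icc (0 : ℝ) 1)
    (h : ∀ i, ∀ x ∈ Icc (0 : ℝ) 1, U i x t = V i x t) : profile k U x t = profile k V x t := by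
  ext j
  exact h j _ (flipCoord_mem hx)

theorem outgoing_congr {U V : Fin n → ℝ → ℝ → ℝ} {t : ℝ}
    (h : ∀ i, ∀ x ∈ Icc (0 : ℝ) 1, U i x t = V i x t) : outgoing U t = outgoing V t := by
  ext j
  exact h j 1 ⟨zero_le_one, le_rfl⟩

/-- Existence of a classical solution on the rectangle, given as a continuously differentiable
function on the plane. -/
theorem exists_solution : ∃ Z Zx : Fin n → ℝ → ℝ → ℝ,
    (∀ i, ContDiff ℝ 1 fun p : ℝ × ℝ => Z i p.1 p.2) ∧
    (∀ i x t, HasDerivAt (fun x => Z i x t) (Zx i x t) x) ∧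
    (∀ i, ∀ x ∈ Icc (0 : ℝ) 1, ∀ t ∈ Icc 0 T,
      HasDerivAt (Z i x) (P.src Z i x t - P.l i x t * Zx i x t) t) ∧
    (∀ i, ∀ x ∈ Icc (0 : ℝ) 1, Z i x 0 = P.φ i x) ∧
    (∀ i, ∀ t ∈ Icc 0 T, Z i 0 t = P.bdry Z i t) := by
  obtain ⟨U, w, r, had, hlim⟩ := P.exists_admissible_limit
  have hfix := P.step_limit had.contU hlim
  choose Z Zx hZ hZx _ hZt hst hZ0 hZb using P.exists_smooth_step had
  have hUZ : ∀ i, ∀ x ∈ Icc (0 : ℝ) 1, ∀ t ∈ Icc 0 T, U i x t = Z i x t := fun i x hx t ht => by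
    rw [← hfix i x hx t ht, (hst i x hx t ht).1]
  refine ⟨Z, Zx, hZ, hZx, fun i x hx t ht => ?_, hZ0, fun i t ht => ?_⟩
  · have e : P.src Z i x t = P.src U i x t := by
      rw [src, src, profile_congr (flipCoord_mem hx) fun j ξ hξ => (hUZ j ξ hξ t ht).symm]
    rw [e]
    exact hZt i x hx t ht
  · rw [hZb i t ht, bdry, bdry, outgoing_congr fun j ξ hξ => hUZ j ξ hξ t ht]

end RectProblem

/-! ### Extension of the data of the problem from a rectangle -/

theorem IsSpeed.mono {l lx : ℝ → ℝ → ℝ} {l₀ Λ D l₀' Λ' D' : ℝ} (h : IsSpeed l lx l₀ Λ D)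
    (hpos : 0 < l₀') (hl : l₀' ≤ l₀) (hΛ : Λ ≤ Λ') (hD : D ≤ D') : IsSpeed l lx l₀' Λ' D' where
  cont := h.cont
  contx := h.contx
  deriv := h.deriv
  pos := hpos
  lower x t := hl.trans (h.lower x t)
  upper x t := (h.upper x t).trans hΛ
  bound x t := (h.bound x t).trans hD

/-- A positive speed on the rectangle extends to a speed on the plane: outside of `[0, 1]` the
factor `1 + sin (2 a (x - c)) / 2` continues it with the right derivative and keeps it bounded and
bounded away from zero. -/
theorem exists_isSpeed_extension {T : ℝ} (hT : 0 < T) {m mx : ℝ → ℝ → ℝ}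
    (hm : ContinuousOn (fun p : ℝ × ℝ => m p.1 p.2) (rectBar T))
    (hmx : ContinuousOn (fun p : ℝ × ℝ => mx p.1 p.2) (rectBar T))
    (hd : ∀ x ∈ Icc (0 : ℝ) 1, ∀ t ∈ Icc 0 T,
      HasDerivWithinAt (fun x => m x t) (mx x t) (Icc 0 1) x)
    (hpos : ∀ x ∈ Icc (0 : ℝ) 1, ∀ t ∈ Icc 0 T, 0 < m x t) :
    ∃ l lx l₀ Λ D, IsSpeed l lx l₀ Λ D ∧
      ∀ x ∈ Icc (0 : ℝ) 1, ∀ t ∈ Icc 0 T, l x t = m x t := by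
  have hcl : Continuous fun p : ℝ × ℝ => (clamp 0 1 p.1, clamp 0 T p.2) := by fun_prop
  have hclm : ∀ p : ℝ × ℝ, (clamp 0 1 p.1, clamp 0 T p.2) ∈ rectBar T := fun p =>
    ⟨clamp_mem zero_le_one _, clamp_mem hT.le _⟩
  have cm : Continuous fun p : ℝ × ℝ => m (clamp 0 1 p.1) (clamp 0 T p.2) :=
    hm.comp_continuous hcl hclm
  have cmx : Continuous fun p : ℝ × ℝ => mx (clamp 0 1 p.1) (clamp 0 T p.2) :=
    hmx.comp_continuous hcl hclm
  have pm : ∀ x t, 0 < m (clamp 0 1 x) (clamp 0 T t) := fun x t =>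
    hpos _ (clamp_mem zero_le_one _) _ (clamp_mem hT.le _)
  have ca : Continuous fun p : ℝ × ℝ => 2 * (mx (clamp 0 1 p.1) (clamp 0 T p.2)
      / m (clamp 0 1 p.1) (clamp 0 T p.2)) * (p.1 - clamp 0 1 p.1) :=
    (continuous_const.mul (cmx.div cm fun p => (pm p.1 p.2).ne')).mul (by fun_prop)
  have hne : (rectBar T).Nonempty := ⟨(0, 0), ⟨le_rfl, zero_le_one⟩, ⟨le_rfl, hT.le⟩⟩
  obtain ⟨q, hq, hmin⟩ := (isCompact_rectBar T).exists_isMinOn hne hm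
  obtain ⟨B, hB⟩ := (isCompact_rectBar T).exists_bound_of_continuousOn hm
  obtain ⟨D, hD⟩ := (isCompact_rectBar T).exists_bound_of_continuousOn hmx
  refine ⟨fun x t => m (clamp 0 1 x) (clamp 0 T t)
      * (1 + Real.sin (2 * (mx (clamp 0 1 x) (clamp 0 T t) / m (clamp 0 1 x) (clamp 0 T t))
        * (x - clamp 0 1 x)) / 2),
    fun x t => mx (clamp 0 1 x) (clamp 0 T t) * Real.cos (2 * (mx (clamp 0 1 x) (clamp 0 T t)
      / m (clamp 0 1 x) (clamp 0 T t)) * (x - clamp 0 1 x)), m q.1 q.2 / 2, 2 * B, D,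
    ⟨?_, ?_, fun x t => ?_, half_pos (hpos _ hq.1 _ hq.2), fun x t => ?_, fun x t => ?_,
      fun x t => ?_⟩, fun x hx t ht => ?_⟩
  · exact cm.mul (continuous_const.add ((Real.continuous_sin.comp ca).div_const 2))
  · exact cmx.mul (Real.continuous_cos.comp ca)
  · have key : ∀ c x : ℝ, 0 < m c (clamp 0 T t) → HasDerivAt
        (fun x => m c (clamp 0 T t) * (1 + Real.sin
        (2 * (mx c (clamp 0 T t) / m c (clamp 0 T t)) * (x - c)) / 2))
        (mx c (clamp 0 T t)
          * Real.cos (2 * (mx c (clamp 0 T t) / m c (clamp 0 T t)) * (x - c))) x := by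
      intro c x hc
      have h1 : HasDerivAt (fun x => 2 * (mx c (clamp 0 T t) / m c (clamp 0 T t)) * (x - c))
          (2 * (mx c (clamp 0 T t) / m c (clamp 0 T t)) * 1) x :=
        ((hasDerivAt_id x).sub_const c).const_mul _
      refine (((h1.sin.div_const 2).const_add 1).const_mul (m c (clamp 0 T t))).congr_deriv ?_
      field_simp
    have h01 : (0 : ℝ) ∈ Icc (0 : ℝ) 1 := ⟨le_rfl, zero_le_one⟩
    have h11 : (1 : ℝ) ∈ Icc (0 : ℝ) 1 := ⟨zero_le_one, le_rfl⟩
    have htm := clamp_mem hT.le t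
    refine hasDerivAt_of_three_pieces one_pos (F' := fun x => mx (clamp 0 1 x) (clamp 0 T t)
      * Real.cos (2 * (mx (clamp 0 1 x) (clamp 0 T t) / m (clamp 0 1 x) (clamp 0 T t))
        * (x - clamp 0 1 x))) (fun x hx => ?_) (fun x hx => ?_) (fun x hx => ?_) x
    · rw [clamp_of_le zero_le_one hx]
      refine (key 0 x (hpos 0 h01 _ htm)).hasDerivWithinAt.congr_of_mem (fun y hy => ?_) hx
      rw [clamp_of_le zero_le_one hy]
    · rw [clamp_of_mem hx, sub_self, mul_zero, Real.cos_zero, mul_one]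
      refine (hd x hx _ htm).congr_of_mem (fun y hy => ?_) hx
      rw [clamp_of_mem hy]
      simp
    · rw [clamp_of_ge zero_le_one hx]
      refine (key 1 x (hpos 1 h11 _ htm)).hasDerivWithinAt.congr_of_mem (fun y hy => ?_) hx
      rw [clamp_of_ge zero_le_one hy]
  · have h1 := isMinOn_iff.1 hmin _ (hclm (x, t))
    simp only at h1
    have h2 := Real.neg_one_le_sin (2 * (mx (clamp 0 1 x) (clamp 0 T t)
      / m (clamp 0 1 x) (clamp 0 T t)) * (x - clamp 0 1 x))
    have h3 := pm x t
    nlinarith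
  · have h1 := (le_abs_self _).trans (hB _ (hclm (x, t)))
    simp only at h1
    have h2 := Real.sin_le_one (2 * (mx (clamp 0 1 x) (clamp 0 T t)
      / m (clamp 0 1 x) (clamp 0 T t)) * (x - clamp 0 1 x))
    have h3 := pm x t
    nlinarith
  · rw [abs_mul]
    have h1 := hD _ (hclm (x, t))
    exact (mul_le_of_le_one_right (abs_nonneg _) (Real.abs_cos_le_one _)).trans h1
  · simp [clamp_of_mem hx, clamp_of_mem ht]

/-- An iterated logarithm of a polynomial in `r` grows at most like a logarithm of `r`. -/
theorem exists_loglog_bound {X : Type*} [TopologicalSpace X] {S : Set X} (hS : IsCompact S)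
    {N : ℕ} {a : ℕ → X → ℝ} (ha : ∀ j, ContinuousOn (a j) S) :
    ∃ C, 0 ≤ C ∧ ∀ q ∈ S, ∀ r, 0 ≤ r →
      Real.exp 1 ≤ ∑ j ∈ Finset.range (N + 1), a j q * r ^ j →
      (Real.log (Real.log (∑ j ∈ Finset.range (N + 1), a j q * r ^ j))) ^ (1 / 4 : ℝ)
        ≤ C * (1 + Real.log (1 + r)) ^ (1 / 4 : ℝ) := by
  choose B hB using fun j => hS.exists_bound_of_continuousOn (ha j)
  obtain ⟨b, hb⟩ : ∃ b, b = 1 + ∑ j ∈ Finset.range (N + 1), |B j| := ⟨_, rfl⟩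
  have hs : 0 ≤ ∑ j ∈ Finset.range (N + 1), |B j| := Finset.sum_nonneg fun _ _ => abs_nonneg _
  have hb1 : 1 ≤ b := by linarith
  have hlb := Real.log_nonneg hb1
  have hN : (0 : ℝ) ≤ N := N.cast_nonneg
  refine ⟨(Real.log b + N) ^ (1 / 4 : ℝ), by positivity, fun q hq r hr he => ?_⟩
  have hr1 : 1 ≤ 1 + r := by linarith
  have hlr := Real.log_nonneg hr1
  obtain ⟨p, hp⟩ : ∃ p, p = ∑ j ∈ Finset.range (N + 1), a j q * r ^ j := ⟨_, rfl⟩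
  rw [← hp] at he ⊢
  have hp0 : 0 < p := (Real.exp_pos 1).trans_le he
  have hlp : 1 ≤ Real.log p := (Real.le_log_iff_exp_le hp0).2 he
  have hpb : p ≤ b * (1 + r) ^ N := by
    have h1 : ∀ j ∈ Finset.range (N + 1), a j q * r ^ j ≤ |B j| * (1 + r) ^ N := by
      intro j hj
      have h2 : a j q ≤ |B j| := ((le_abs_self _).trans (hB j q hq)).trans (le_abs_self _)
      have h3 : r ^ j ≤ (1 + r) ^ N :=
        (pow_le_pow_left₀ hr (by linarith) j).trans
          (pow_le_pow_right₀ hr1 (Nat.lt_succ_iff.1 (Finset.mem_range.1 hj)))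
      exact (mul_le_mul_of_nonneg_right h2 (by positivity)).trans
        (mul_le_mul_of_nonneg_left h3 (abs_nonneg _))
    rw [hp]
    refine (Finset.sum_le_sum h1).trans ?_
    rw [← Finset.sum_mul, hb]
    have : 0 ≤ (1 + r) ^ N := by positivity
    linarith
  have hlog : Real.log p ≤ Real.log b + N * Real.log (1 + r) := by
    refine (Real.log_le_log hp0 hpb).trans (le_of_eq ?_)
    rw [Real.log_mul (by positivity) (by positivity), Real.log_pow]
  rw [← Real.mul_rpow (by positivity) (by positivity)]
  refine Real.rpow_le_rpow (Real.log_nonneg hlp) ?_ (by norm_num)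
  -- the outer logarithm is simply dropped
  have h5 := Real.log_le_self (zero_le_one.trans hlp)
  have h6 := mul_nonneg hlb hlr
  linarith

/-! ### Reflection of the original problem -/

/-- On the rectangle the data of `P` are those of the original problem, written in reflected
coordinates. -/
structure RectProblem.IsReflectionOf {n k : ℕ} {T : ℝ} (P : RectProblem n k T)
    (lam : Fin n → ℝ → ℝ → ℝ) (f : ℝ → ℝ → EVec n → EVec n) (φ : ℝ → EVec n)
    (h : ℝ → EVec n → EVec n) : Prop where
  speed_eq : ∀ i, ∀ x ∈ Icc (0 : ℝ) 1, ∀ t ∈ Icc 0 T,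
    P.l i x t = flipSign k i * lam i (flipCoord k i x) t
  source_eq : ∀ x ∈ Icc (0 : ℝ) 1, ∀ t ∈ Icc 0 T, P.f x t = f x t
  boundary_eq : ∀ t ∈ Icc 0 T, P.h t = h t
  initial_eq : ∀ i, ∀ x ∈ Icc (0 : ℝ) 1, P.φ i x = φ (flipCoord k i x) i

section

variable {n k : ℕ} {T : ℝ} {lam : Fin n → ℝ → ℝ → ℝ} {f : ℝ → ℝ → EVec n → EVec n}
  {φ : ℝ → EVec n} {h : ℝ → EVec n → EVec n}

theorem rectBar_subset_stripBar : rectBar T ⊆ stripBar := fun _ hp => ⟨hp.1, hp.2.1⟩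

theorem SpeedsOK.exists_isSpeed (hlam : SpeedsOK k lam) (hn : 0 < n) (hT : 0 < T) :
    ∃ (l lx : Fin n → ℝ → ℝ → ℝ) (l₀ Λ D : ℝ), ∀ i : Fin n, IsSpeed (l i) (lx i) l₀ Λ D ∧
      ∀ x ∈ Icc (0 : ℝ) 1, ∀ t ∈ Icc 0 T, l i x t = flipSign k i * lam i (flipCoord k i x) t := by
  have hmaps : ∀ i : Fin n,
      MapsTo (fun p : ℝ × ℝ => (flipCoord k i p.1, p.2)) (rectBar T) stripBar :=
    fun i p hp => ⟨flipCoord_mem hp.1, hp.2.1⟩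
  have key : ∀ i : Fin n, ∃ l lx l₀ Λ D, IsSpeed l lx l₀ Λ D ∧
      ∀ x ∈ Icc (0 : ℝ) 1, ∀ t ∈ Icc 0 T, l x t = flipSign k i * lam i (flipCoord k i x) t := by
    intro i
    refine exists_isSpeed_extension hT (m := fun x t => flipSign k i * lam i (flipCoord k i x) t)
      (mx := fun x t => flipSign k i * (derivWithin (fun x => lam i x t) (Icc 0 1) (flipCoord k i x)
        * flipSign k i)) ?_ ?_ ?_ ?_
    · exact continuousOn_const.mul ((hlam.cont i).comp (by fun_prop) (hmaps i))
    · exact continuousOn_const.mul (((hlam.cont_deriv i).comp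
        (f := fun p : ℝ × ℝ => (flipCoord k i p.1, p.2)) (by fun_prop) (hmaps i)).mul
          continuousOn_const)
    · intro x hx t ht
      have h1 := (hlam.diff i t ht.1 _ (flipCoord_mem (k := k) (i := i) hx)).hasDerivWithinAt
      exact (h1.comp x (hasDerivAt_flipCoord i x).hasDerivWithinAt
        fun y hy => flipCoord_mem hy).const_mul _
    · intro x hx t ht
      have hm : (flipCoord k i x, t) ∈ stripBar := ⟨flipCoord_mem hx, ht.1⟩
      by_cases hi : (i : ℕ) < k
      · simpa [flipSign, hi] using hlam.neg i hi _ _ hm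
      · simpa [flipSign, hi] using hlam.pos i (not_lt.1 hi) _ _ hm
  choose l lx l₀ Λ D hs heq using key
  have : Nonempty (Fin n) := ⟨⟨0, hn⟩⟩
  obtain ⟨i₁, h₁⟩ := Finite.exists_min l₀
  obtain ⟨i₂, h₂⟩ := Finite.exists_max Λ
  obtain ⟨i₃, h₃⟩ := Finite.exists_max D
  exact ⟨l, lx, l₀ i₁, Λ i₂, D i₃, fun i =>
    ⟨(hs i).mono (hs i₁).pos (h₁ i) (h₂ i) (h₃ i), heq i⟩⟩

theorem SourceGrowth.exists_bound (hf : SourceGrowth f) (hT : 0 < T) : ∃ C, 0 ≤ C ∧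
    ∀ x ∈ Icc (0 : ℝ) 1, ∀ t ∈ Icc 0 T, ∀ y,
      ‖fderiv ℝ (f x t) y‖ ≤ C * (1 + Real.log (1 + ‖y‖)) ^ (1 / 4 : ℝ) := by
  obtain ⟨C, hC, N, a, ha, hb⟩ := hf T hT
  obtain ⟨B, hB, hlog⟩ := exists_loglog_bound (isCompact_rectBar T) (N := N)
    fun j => (ha j).continuousOn
  refine ⟨C * B, by positivity, fun x hx t ht y => ?_⟩
  obtain ⟨h1, h2⟩ := hb x t ⟨hx, ht⟩ y
  rw [mul_assoc]
  exact h2.trans (mul_le_mul_of_nonneg_left (hlog _ ⟨hx, ht⟩ _ (norm_nonneg _) h1) hC.le)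

theorem BoundaryGrowth.exists_bound (hh : BoundaryGrowth h) (hT : 0 < T) : ∃ C, 0 ≤ C ∧
    ∀ t ∈ Icc 0 T, ∀ z,
      ‖fderiv ℝ (h t) z‖ ≤ C * (1 + Real.log (1 + ‖z‖)) ^ (1 / 4 : ℝ) := by
  obtain ⟨C, hC, N, b, hb, hbd⟩ := hh T hT
  obtain ⟨B, hB, hlog⟩ := exists_loglog_bound (isCompact_Icc (a := 0) (b := T)) (N := N)
    fun j => (hb j).continuousOn
  refine ⟨C * B, by positivity, fun t ht z => ?_⟩
  obtain ⟨h1, h2⟩ := hbd t ht z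
  rw [mul_assoc]
  exact h2.trans (mul_le_mul_of_nonneg_left (hlog _ ht _ (norm_nonneg _) h1) hC.le)

/-- The partial derivatives of the boundary function. -/
theorem exists_boundary_partials
    (hh : ContDiffOn ℝ 1 (fun p : ℝ × EVec n => h p.1 p.2) (Ici 0 ×ˢ univ)) :
    (∀ t, 0 ≤ t → ∀ z, HasDerivWithinAt (fun t => h t z)
      (derivWithin (fun t => h t z) (Ici 0) t) (Ici 0) t) ∧
    (∀ t, 0 ≤ t → ∀ z, HasFDerivAt (h t) (fderiv ℝ (h t) z) z) ∧
    ContinuousOn (fun p : ℝ × EVec n => derivWithin (fun t => h t p.2) (Ici 0) p.1)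
      (Ici 0 ×ˢ univ) ∧
    ContinuousOn (fun p : ℝ × EVec n => fderiv ℝ (h p.1) p.2) (Ici 0 ×ˢ univ) := by
  have hu : UniqueDiffOn ℝ (Ici (0 : ℝ) ×ˢ (univ : Set (EVec n))) :=
    (uniqueDiffOn_Ici 0).prod uniqueDiffOn_univ
  have hc := hh.continuousOn_fderivWithin hu le_rfl
  have hd : ∀ t, 0 ≤ t → ∀ z, HasFDerivWithinAt (fun p : ℝ × EVec n => h p.1 p.2)
      (fderivWithin ℝ (fun p : ℝ × EVec n => h p.1 p.2) (Ici 0 ×ˢ univ) (t, z)) (Ici 0 ×ˢ univ)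
      (t, z) := fun t ht z =>
    (hh.differentiableOn one_ne_zero (t, z) ⟨ht, trivial⟩).hasFDerivWithinAt
  have ht : ∀ t, 0 ≤ t → ∀ z, HasDerivWithinAt (fun t => h t z)
      (fderivWithin ℝ (fun p : ℝ × EVec n => h p.1 p.2) (Ici 0 ×ˢ univ) (t, z) (1, 0))
      (Ici 0) t := fun t ht z =>
    (hd t ht z).comp_hasDerivWithinAt (f := fun s => (s, z)) t
      ((hasDerivWithinAt_id t _).prodMk (hasDerivWithinAt_const t _ z)) fun s hs => ⟨hs, trivial⟩
  have hz : ∀ t, 0 ≤ t → ∀ z, HasFDerivAt (h t)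
      ((fderivWithin ℝ (fun p : ℝ × EVec n => h p.1 p.2) (Ici 0 ×ˢ univ) (t, z)).comp
        (ContinuousLinearMap.inr ℝ ℝ (EVec n))) z := by
    intro t ht z
    have h1 := (hd t ht z).comp (s := univ) (f := fun y => (t, y)) z
      (hasFDerivAt_prodMk_right t z).hasFDerivWithinAt fun y _ => ⟨ht, trivial⟩
    exact hasFDerivWithinAt_univ.1 h1
  refine ⟨fun t h0 z => ?_, fun t h0 z => (hz t h0 z).differentiableAt.hasFDerivAt, ?_, ?_⟩
  · exact (ht t h0 z).differentiableWithinAt.hasDerivWithinAt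
  · exact (hc.clm_apply continuousOn_const).congr fun p hp =>
      (ht p.1 hp.1 p.2).derivWithin (uniqueDiffOn_Ici 0 p.1 hp.1)
  · exact (hc.clm_comp continuousOn_const).congr fun p hp => (hz p.1 hp.1 p.2).fderiv

/-- Every rectangle carries a reflected problem with the data of the original one. -/
theorem exists_rectProblem (hn : 0 < n) (hlam : SpeedsOK k lam) (hf : SourceOK f)
    (hφ : ContDiffOn ℝ 1 φ (Icc 0 1))
    (hh : ContDiffOn ℝ 1 (fun p : ℝ × EVec n => h p.1 p.2) (Ici 0 ×ˢ univ))
    (hfg : SourceGrowth f) (hhg : BoundaryGrowth h) (hc₀ : CompatZero k φ h)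
    (hc₁ : CompatOne k lam f φ h) (hT : 0 < T) :
    ∃ P : RectProblem n k T, P.IsReflectionOf lam f φ h := by
  obtain ⟨l, lx, l₀, Λ, D, hl⟩ := hlam.exists_isSpeed hn hT
  obtain ⟨C₁, hC₁, hg₁⟩ := hfg.exists_bound hT
  obtain ⟨C₂, hC₂, hg₂⟩ := hhg.exists_bound hT
  obtain ⟨dht, dhz, cht, chz⟩ := exists_boundary_partials hh
  have hTm := fun t => clamp_mem hT.le t
  have h1m := fun x => clamp_mem (zero_le_one (α := ℝ)) x
  have h01 : (0 : ℝ) ∈ Icc (0 : ℝ) 1 := ⟨le_rfl, zero_le_one⟩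
  have h11 : (1 : ℝ) ∈ Icc (0 : ℝ) 1 := ⟨zero_le_one, le_rfl⟩
  have hT0 : (0 : ℝ) ∈ Icc 0 T := ⟨le_rfl, hT.le⟩
  have hcl : Continuous fun p : (ℝ × ℝ) × EVec n => ((clamp 0 1 p.1.1, clamp 0 T p.1.2), p.2) := by
    fun_prop
  have hclm : ∀ p : (ℝ × ℝ) × EVec n, ((clamp 0 1 p.1.1, clamp 0 T p.1.2), p.2)
      ∈ stripBar ×ˢ (univ : Set (EVec n)) := fun p => ⟨⟨h1m _, (hTm _).1⟩, trivial⟩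
  have hcl₂ : Continuous fun p : ℝ × EVec n => (clamp 0 T p.1, p.2) := by fun_prop
  have hcl₂m : ∀ p : ℝ × EVec n, (clamp 0 T p.1, p.2) ∈ Ici 0 ×ˢ (univ : Set (EVec n)) :=
    fun p => ⟨(hTm _).1, trivial⟩
  have hpow : ∀ y : EVec n, 0 ≤ (1 + Real.log (1 + ‖y‖)) ^ (1 / 4 : ℝ) := fun y => by
    have := Real.log_nonneg (show 1 ≤ 1 + ‖y‖ by linarith [norm_nonneg y])
    positivity
  -- the initial data, extended by tangents
  have dφ : ∀ x ∈ Icc (0 : ℝ) 1, ∀ i, HasDerivWithinAt (fun x => φ x i)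
      (derivWithin φ (Icc 0 1) x i) (Icc 0 1) x := fun x hx i =>
    (EuclideanSpace.proj (𝕜 := ℝ) i).hasFDerivAt.comp_hasDerivWithinAt x
      (hφ.differentiableOn one_ne_zero x hx).hasDerivWithinAt
  have cφ : ContinuousOn (derivWithin φ (Icc 0 1)) (Icc (0 : ℝ) 1) :=
    hφ.continuousOn_derivWithin (uniqueDiffOn_Icc one_pos) le_rfl
  obtain ⟨G, hG⟩ : ∃ G : Fin n → ℝ → ℝ, ∀ i x, G i x = φ (flipCoord k i x) i :=
    ⟨fun i x => φ (flipCoord k i x) i, fun _ _ => rfl⟩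
  obtain ⟨G', hG'⟩ : ∃ G' : Fin n → ℝ → ℝ, ∀ i x,
      G' i x = derivWithin φ (Icc 0 1) (flipCoord k i x) i * flipSign k i := ⟨_, fun _ _ => rfl⟩
  have dG : ∀ i, ∀ x ∈ Icc (0 : ℝ) 1, HasDerivWithinAt (G i) (G' i x) (Icc 0 1) x := by
    intro i x hx
    rw [hG', show G i = (fun x => φ x i) ∘ flipCoord k i from funext (hG i)]
    exact (dφ _ (flipCoord_mem hx) i).comp x (hasDerivAt_flipCoord i x).hasDerivWithinAt
      fun y hy => flipCoord_mem hy
  have cG' : ∀ i, ContinuousOn (G' i) (Icc 0 1) := by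
    intro i
    rw [show G' i = _ from funext (hG' i)]
    exact ((PiLp.continuous_apply 2 (fun _ : Fin n => ℝ) i).comp_continuousOn
      (cφ.comp (continuous_flipCoord i).continuousOn fun y hy => flipCoord_mem hy)).mul
        continuousOn_const
  obtain ⟨φE, hφE⟩ : ∃ φE : Fin n → ℝ → ℝ, ∀ i x, φE i x = G i (clamp 0 1 x)
    + (x - clamp 0 1 x) * G' i (clamp 0 1 x) := ⟨_, fun _ _ => rfl⟩
  have eφ : ∀ i, ∀ x ∈ Icc (0 : ℝ) 1, φE i x = φ (flipCoord k i x) i := fun i x hx => by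
    rw [hφE, clamp_of_mem hx, sub_self, zero_mul, add_zero, hG]
  -- the values at time `0`
  have eprof : ∀ x ∈ Icc (0 : ℝ) 1,
      (WithLp.toLp 2 fun m => φE m (flipCoord k m x) : EVec n) = φ x := by
    intro x hx
    ext m
    change φE m (flipCoord k m x) = φ x m
    rw [eφ m _ (flipCoord_mem hx), flipCoord_flipCoord]
  have eout : (WithLp.toLp 2 fun m => φE m 1 : EVec n) = outVec k (φ 0) (φ 1) := by
    ext m
    change φE m 1 = if (m : ℕ) < k then φ 0 m else φ 1 m
    rw [eφ m 1 h11, flipCoord]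
    split_ifs <;> simp
  have erate : ∀ i : Fin n, ∀ x ∈ Icc (0 : ℝ) 1,
      f (flipCoord k i x) 0 (φ (flipCoord k i x)) i - l i x 0 * G' i (clamp 0 1 x)
        = initialRate lam f φ (flipCoord k i x) i := by
    intro i x hx
    rw [(hl i).2 x hx 0 hT0, hG', clamp_of_mem hx]
    have := flipSign_mul_self (k := k) i
    simp only [initialRate]
    linear_combination (-lam i (flipCoord k i x) 0
      * derivWithin φ (Icc 0 1) (flipCoord k i x) i) * this
  have eoutrate : (WithLp.toLp 2 fun j => initialRate lam f φ (flipCoord k j 1) j : EVec n)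
      = outVec k (initialRate lam f φ 0) (initialRate lam f φ 1) := by
    ext m
    change initialRate lam f φ (flipCoord k m 1) m
      = if (m : ℕ) < k then initialRate lam f φ 0 m else initialRate lam f φ 1 m
    rw [flipCoord]
    split_ifs <;> simp
  refine ⟨{
    T_pos := hT
    l := l
    lx := lx
    l₀ := l₀
    Λ := Λ
    D := D
    speed := fun i => (hl i).1
    flow := fun i => (hl i).1.exists_charFlow.some
    f := fun x t => f (clamp 0 1 x) (clamp 0 T t)
    fx := fun x t y => derivWithin (fun x => f x (clamp 0 T t) y) (Icc 0 1) (clamp 0 1 x)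
    fy := fun x t => fderiv ℝ (f (clamp 0 1 x) (clamp 0 T t))
    h := fun t => h (clamp 0 T t)
    ht := fun t z => derivWithin (fun t => h t z) (Ici 0) (clamp 0 T t)
    hz := fun t => fderiv ℝ (h (clamp 0 T t))
    φ := φE
    φ' := fun i x => G' i (clamp 0 1 x)
    C := C₁ + C₂
    contf := hf.cont.comp_continuous hcl hclm
    contfx := hf.cont_deriv_x.comp_continuous hcl hclm
    contfy := hf.cont_deriv_y.comp_continuous hcl hclm
    derivfx := fun x hx t ht y => ?_
    derivfy := fun x t y => (hf.diff_y _ _ ⟨h1m x, (hTm t).1⟩ y).hasFDerivAt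
    conth := hh.continuousOn.comp_continuous hcl₂ hcl₂m
    contht := cht.comp_continuous hcl₂ hcl₂m
    conthz := chz.comp_continuous hcl₂ hcl₂m
    derivht := fun t ht z => ?_
    derivhz := fun t z => dhz _ (hTm t).1 z
    derivφ := fun i x => ?_
    contφ' := fun i => (cG' i).comp_clamp zero_le_one
    growthf := fun x t y => (hg₁ _ (h1m x) _ (hTm t) y).trans
      (mul_le_mul_of_nonneg_right (by linarith) (hpow y))
    growthh := fun t z => (hg₂ _ (hTm t) z).trans
      (mul_le_mul_of_nonneg_right (by linarith) (hpow z))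
    compat₀ := fun i => ?_
    compat₁ := fun i => ?_ }, ⟨fun i => (hl i).2, fun x hx t ht => ?_, fun t ht => ?_, eφ⟩⟩
  · simp only [clamp_of_mem hx]
    exact (hf.diff_x _ (hTm t).1 y x hx).hasDerivWithinAt.congr_of_mem
      (fun x' hx' => by rw [clamp_of_mem hx']) hx
  · simp only [clamp_of_mem ht]
    exact ((dht t ht.1 z).mono fun s hs => hs.1).congr_of_mem
      (fun s hs => by rw [clamp_of_mem hs]) ht
  · rw [show φE i = _ from funext (hφE i)]
    exact hasDerivAt_clamp_ext one_pos (dG i) x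
  · simp only [clamp_of_mem hT0]
    rw [eout, eφ i 0 h01, flipCoord]
    by_cases hi : (i : ℕ) < k
    · simpa [hi] using (hc₀ i).2 hi
    · simpa [hi] using (hc₀ i).1 (not_lt.1 hi)
  · simp only [clamp_of_mem hT0, eout]
    have e1 : (fun j => f (clamp 0 1 (flipCoord k j 1)) 0
        (WithLp.toLp 2 fun m => φE m (flipCoord k m (flipCoord k j 1))) j
          - l j 1 0 * G' j (clamp 0 1 1)) = fun j => initialRate lam f φ (flipCoord k j 1) j := by
      funext j
      rw [clamp_of_mem (flipCoord_mem h11), eprof _ (flipCoord_mem h11), erate j 1 h11]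
    rw [e1, eoutrate, clamp_of_mem (flipCoord_mem h01), eprof _ (flipCoord_mem h01), erate i 0 h01,
      flipCoord]
    by_cases hi : (i : ℕ) < k
    · simpa [hi, boundaryRate] using ((hc₁ i).2 hi).symm
    · simpa [hi, boundaryRate] using ((hc₁ i).1 (not_lt.1 hi)).symm
  · simp only [clamp_of_mem hx, clamp_of_mem ht]
  · simp only [clamp_of_mem ht]

end

/-! ### Classical solutions on a rectangle -/

namespace RectProblem

variable {n k : ℕ} {T : ℝ} (P : RectProblem n k T)

/-- A function which satisfies the transport equations along the characteristics is a fixed point of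
the Picard iteration. -/
theorem step_eq_of_transport {W : Fin n → ℝ → ℝ → ℝ} (hW : ContOnRect T W)
    (hd : ∀ i, ∀ x ∈ Ioo (0 : ℝ) 1, ∀ t ∈ Ioo 0 T, ∃ L : ℝ × ℝ →L[ℝ] ℝ,
      HasFDerivAt (fun p : ℝ × ℝ => W i p.1 p.2) L (x, t) ∧ L (P.l i x t, 1) = P.src W i x t)
    (h0 : ∀ i, ∀ x ∈ Icc (0 : ℝ) 1, W i x 0 = P.φ i x)
    (hb : ∀ i, ∀ t ∈ Icc 0 T, W i 0 t = P.bdry W i t) :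
    ∀ i, ∀ x ∈ Icc (0 : ℝ) 1, ∀ t ∈ Icc 0 T, P.step W i x t = W i x t := by
  intro i x hx t ht
  have hS := P.speed i
  obtain ⟨c, hc⟩ : ∃ c, c = P.flow i := ⟨_, rfl⟩
  obtain ⟨y, hy⟩ : ∃ y, y = c.Y x t := ⟨_, rfl⟩
  have hle : c.entry y ≤ t := by rw [hy]; exact c.entry_le hS hx.1 ht.1
  have hxt : c.Ψ y t = x := by rw [hy, c.ΨY]
  have hmem : ∀ s ∈ Icc (c.entry y) t, c.Ψ y s ∈ Icc (0 : ℝ) 1 ∧ s ∈ Icc 0 T := by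
    subst hc hy
    exact fun s hs => P.char_mem i hx ht hs
  have hcΨ : Continuous fun s => (c.Ψ y s, s) :=
    (c.contΨ.comp (continuous_const.prodMk continuous_id)).prodMk continuous_id
  have hcont : ContinuousOn (fun s => W i (c.Ψ y s) s) (Icc (c.entry y) t) :=
    (hW i).comp (f := fun s => (c.Ψ y s, s)) hcΨ.continuousOn hmem
  have hcont' : ContinuousOn (fun s => P.src W i (c.Ψ y s) s) (Icc (c.entry y) t) :=
    (P.continuousOn_src hW i).comp (f := fun s => (c.Ψ y s, s)) hcΨ.continuousOn hmem
  have hderiv : ∀ s ∈ Ioo (c.entry y) t,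
      HasDerivAt (fun s => W i (c.Ψ y s) s) (P.src W i (c.Ψ y s) s) s := by
    intro s hs
    have h1 := (hmem _ ⟨le_rfl, hle⟩).1.1
    have h2 := c.le_sub y _ _ hs.1.le
    have h3 := c.le_sub y _ _ hs.2.le
    have h4 := mul_pos hS.pos (sub_pos.2 hs.1)
    have h5 := mul_pos hS.pos (sub_pos.2 hs.2)
    have h6 := c.entry_nonneg y
    obtain ⟨L, hL, hLe⟩ := hd i (c.Ψ y s) ⟨by linarith, by linarith [hx.2]⟩ s
      ⟨by linarith [hs.1], by linarith [hs.2, ht.2]⟩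
    rw [← hLe]
    exact hL.comp_hasDerivAt (f := fun s => (c.Ψ y s, s)) s
      ((c.deriv_t y s).prodMk (hasDerivAt_id s))
  have hftc : ∫ s in c.entry y..t, P.src W i (c.Ψ y s) s
      = W i (c.Ψ y t) t - W i (c.Ψ y (c.entry y)) (c.entry y) :=
    intervalIntegral.integral_eq_sub_of_hasDeriv_right_of_le hle hcont
      (fun s hs => (hderiv s hs).hasDerivWithinAt) (hcont'.intervalIntegrable_of_Icc hle)
  have hin : c.inflow (P.φ i) (P.bdry W i) y = W i (c.Ψ y (c.entry y)) (c.entry y) := by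
    have h1 := hmem _ ⟨le_rfl, hle⟩
    rcases le_or_gt 0 y with h | h
    · rw [c.entry_of_nonneg hS h, c.zero] at h1 ⊢
      rw [CharFlow.inflow, if_pos h, h0 i y h1.1]
    · rw [c.entry_of_neg hS h] at h1 ⊢
      rw [CharFlow.inflow, if_neg (not_le.2 h), c.Ψτ, hb i _ h1.2]
  change (P.flow i).sol (P.φ i) (P.bdry W i) (P.src W i) x t = W i x t
  rw [← hc, CharFlow.sol, ← hy, hin, hftc, hxt]
  ring

end RectProblem

/-- `u` is a classical solution of the problem up to time `T`. In the interior only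
differentiability is asked for, which is all that uniqueness needs. -/
structure IsSolutionOn {n : ℕ} (T : ℝ) (k : ℕ) (lam : Fin n → ℝ → ℝ → ℝ)
    (f : ℝ → ℝ → EVec n → EVec n) (φ : ℝ → EVec n) (h : ℝ → EVec n → EVec n)
    (u : ℝ × ℝ → EVec n) : Prop where
  cont : ContinuousOn u (rectBar T)
  diff : ∀ x ∈ Ioo (0 : ℝ) 1, ∀ t ∈ Ioo 0 T, DifferentiableAt ℝ u (x, t)
  system : ∀ x ∈ Ioo (0 : ℝ) 1, ∀ t ∈ Ioo 0 T, ∀ i : Fin n,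
    deriv (fun s => u (x, s) i) t + lam i x t * deriv (fun ξ => u (ξ, t) i) x
      = f x t (u (x, t)) i
  initial : ∀ x ∈ Ioo (0 : ℝ) 1, u (x, 0) = φ x
  left : ∀ t ∈ Ioo 0 T, ∀ i : Fin n, k ≤ (i : ℕ) →
    u (0, t) i = h t (outVec k (u (0, t)) (u (1, t))) i
  right : ∀ t ∈ Ioo 0 T, ∀ i : Fin n, (i : ℕ) < k →
    u (1, t) i = h t (outVec k (u (0, t)) (u (1, t))) i

section

variable {n k : ℕ} {T : ℝ} {lam : Fin n → ℝ → ℝ → ℝ} {f : ℝ → ℝ → EVec n → EVec n}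
  {φ : ℝ → EVec n} {h : ℝ → EVec n → EVec n} {u w : ℝ × ℝ → EVec n}

theorem isOpen_strip : IsOpen strip := isOpen_Ioo.prod isOpen_Ioi

theorem IsClassicalSolution.isSolutionOn (hu : IsClassicalSolution k lam f φ h u) (T : ℝ) :
    IsSolutionOn T k lam f φ h u where
  cont := hu.cont.mono rectBar_subset_stripBar
  diff _ hx _ ht := (hu.smooth.differentiableOn one_ne_zero).differentiableAt
    (isOpen_strip.mem_nhds ⟨hx, ht.1⟩)
  system x hx t ht := hu.system x t ⟨hx, ht.1⟩
  initial := hu.initial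
  left t ht := hu.left t ht.1
  right t ht := hu.right t ht.1

theorem IsSolutionOn.mono {T' : ℝ} (hu : IsSolutionOn T k lam f φ h u) (hT : T' ≤ T) :
    IsSolutionOn T' k lam f φ h u where
  cont := hu.cont.mono fun _ hp => ⟨hp.1, hp.2.1, hp.2.2.trans hT⟩
  diff x hx t ht := hu.diff x hx t ⟨ht.1, ht.2.trans_le hT⟩
  system x hx t ht := hu.system x hx t ⟨ht.1, ht.2.trans_le hT⟩
  initial := hu.initial
  left t ht := hu.left t ⟨ht.1, ht.2.trans_le hT⟩
  right t ht := hu.right t ⟨ht.1, ht.2.trans_le hT⟩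

/-- The components of `u` in reflected coordinates. -/
def reflected (k : ℕ) (u : ℝ × ℝ → EVec n) (i : Fin n) (x t : ℝ) : ℝ := u (flipCoord k i x, t) i

theorem profile_reflected (x t : ℝ) : profile k (reflected k u) x t = u (x, t) := by
  ext j
  change u (flipCoord k j (flipCoord k j x), t) j = _
  rw [flipCoord_flipCoord]

theorem outgoing_reflected (t : ℝ) :
    outgoing (reflected k u) t = outVec k (u (0, t)) (u (1, t)) := by
  ext j
  change u (flipCoord k j 1, t) j = if (j : ℕ) < k then u (0, t) j else u (1, t) j
  rw [flipCoord]
  split_ifs <;> simp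

theorem flipCoord_mem_Ioo {i : Fin n} {x : ℝ} (hx : x ∈ Ioo (0 : ℝ) 1) :
    flipCoord k i x ∈ Ioo (0 : ℝ) 1 := by
  unfold flipCoord; split_ifs
  · exact ⟨by linarith [hx.2], by linarith [hx.1]⟩
  · exact hx

/-- A classical solution is, in reflected coordinates, a fixed point of the Picard iteration. -/
theorem IsSolutionOn.step_reflected (hu : IsSolutionOn T k lam f φ h u) {P : RectProblem n k T}
    (hP : P.IsReflectionOf lam f φ h) :
    ContOnRect T (reflected k u) ∧
    ∀ i, ∀ x ∈ Icc (0 : ℝ) 1, ∀ t ∈ Icc 0 T,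
      P.step (reflected k u) i x t = reflected k u i x t := by
  have h01 : (0 : ℝ) ∈ Icc (0 : ℝ) 1 := ⟨le_rfl, zero_le_one⟩
  have hT0 : (0 : ℝ) ∈ Icc 0 T := ⟨le_rfl, P.T_pos.le⟩
  have hc : ContOnRect T (reflected k u) := fun i =>
    (PiLp.continuous_apply 2 (fun _ : Fin n => ℝ) i).comp_continuousOn
      (hu.cont.comp (f := fun p : ℝ × ℝ => (flipCoord k i p.1, p.2)) (by fun_prop)
        fun p hp => ⟨flipCoord_mem hp.1, hp.2⟩)
  refine ⟨hc, P.step_eq_of_transport hc (fun i x hx t ht => ?_) (fun i => ?_) fun i => ?_⟩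
  · have hx' : flipCoord k i x ∈ Ioo (0 : ℝ) 1 := flipCoord_mem_Ioo hx
    have hd := (hu.diff _ hx' t ht).hasFDerivAt
    obtain ⟨L, hL⟩ : ∃ L, L = fderiv ℝ u (flipCoord k i x, t) := ⟨_, rfl⟩
    rw [← hL] at hd
    have hflip : HasFDerivAt (fun p : ℝ × ℝ => (flipCoord k i p.1, p.2))
        ((flipSign k i • ContinuousLinearMap.fst ℝ ℝ ℝ).prod (ContinuousLinearMap.snd ℝ ℝ ℝ))
        (x, t) :=
      HasFDerivAt.prodMk (HasDerivAt.comp_hasFDerivAt (h₂ := flipCoord k i) (f := Prod.fst) (x, t)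
        (hasDerivAt_flipCoord i x) hasFDerivAt_fst) hasFDerivAt_snd
    refine ⟨_, (EuclideanSpace.proj (𝕜 := ℝ) i).hasFDerivAt.comp (x, t)
      (HasFDerivAt.comp (g := u) (f := fun p : ℝ × ℝ => (flipCoord k i p.1, p.2)) (x, t) hd hflip),
      ?_⟩
    have e1 : deriv (fun s => u (flipCoord k i x, s) i) t = L (0, 1) i :=
      ((EuclideanSpace.proj (𝕜 := ℝ) i).hasFDerivAt.comp_hasDerivAt t
        (hd.comp_hasDerivAt (f := fun s => (flipCoord k i x, s)) t
          ((hasDerivAt_const t _).prodMk (hasDerivAt_id t)))).deriv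
    have e2 : deriv (fun ξ => u (ξ, t) i) (flipCoord k i x) = L (1, 0) i :=
      ((EuclideanSpace.proj (𝕜 := ℝ) i).hasFDerivAt.comp_hasDerivAt (flipCoord k i x)
        (hd.comp_hasDerivAt (f := fun ξ => (ξ, t)) (flipCoord k i x)
          ((hasDerivAt_id _).prodMk (hasDerivAt_const _ t)))).deriv
    have e3 := hu.system _ hx' t ht i
    have e4 := hP.speed_eq i x (Ioo_subset_Icc_self hx) t (Ioo_subset_Icc_self ht)
    have e5 := hP.source_eq _ (Ioo_subset_Icc_self hx') t (Ioo_subset_Icc_self ht)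
    change L (flipSign k i * P.l i x t, 1) i = P.src (reflected k u) i x t
    rw [RectProblem.src, profile_reflected, e5, ← e3, e1, e2, e4, ← mul_assoc, flipSign_mul_self,
      one_mul]
    have e6 : (lam i (flipCoord k i x) t, (1 : ℝ))
        = (0, 1) + lam i (flipCoord k i x) t • (1, 0) := by simp
    rw [e6, map_add, map_smul]
    rfl
  · have hφ : Continuous (P.φ i) :=
      continuous_iff_continuousAt.2 fun x => (P.derivφ i x).continuousAt
    -- the initial condition holds on the open interval and extends to its ends by continuity
    refine EqOn.of_subset_closure (s := Ioo (0 : ℝ) 1) (f := fun x => reflected k u i x 0)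
      (fun x hx => ?_) ?_ hφ.continuousOn Ioo_subset_Icc_self (by rw [closure_Ioo zero_ne_one])
    · simp only [reflected]
      rw [hu.initial _ (flipCoord_mem_Ioo hx), hP.initial_eq i x (Ioo_subset_Icc_self hx)]
    · exact (hc i).comp (f := fun x : ℝ => (x, (0 : ℝ))) (by fun_prop) fun x hx => ⟨hx, hT0⟩
  · refine EqOn.of_subset_closure (s := Ioo 0 T) (f := fun t => reflected k u i 0 t)
      (fun t ht => ?_) ?_ ?_ Ioo_subset_Icc_self (by rw [closure_Ioo P.T_pos.ne])
    · rw [RectProblem.bdry, outgoing_reflected, hP.boundary_eq t (Ioo_subset_Icc_self ht)]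
      by_cases hi : (i : ℕ) < k
      · simpa [reflected, flipCoord, hi] using hu.right t ht i hi
      · simpa [reflected, flipCoord, hi] using hu.left t ht i (not_lt.1 hi)
    · exact (hc i).comp (f := fun t : ℝ => ((0 : ℝ), t)) (by fun_prop) fun t ht => ⟨h01, ht⟩
    · exact (PiLp.continuous_apply 2 (fun _ : Fin n => ℝ) i).comp_continuousOn
        (P.conth.comp_continuousOn (f := fun t => (t, outgoing (reflected k u) t))
          (continuousOn_id.prodMk hc.outgoing))

/-- Uniqueness of classical solutions on the rectangle. -/
theorem IsSolutionOn.eqOn (hu : IsSolutionOn T k lam f φ h u) (hw : IsSolutionOn T k lam f φ h w)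
    {P : RectProblem n k T} (hP : P.IsReflectionOf lam f φ h) : EqOn u w (rectBar T) := by
  obtain ⟨hu₁, hu₂⟩ := hu.step_reflected hP
  obtain ⟨hw₁, hw₂⟩ := hw.step_reflected hP
  have heq := P.eq_of_step_eq hu₁ hw₁ hu₂ hw₂
  rintro ⟨x, t⟩ hp
  rw [← profile_reflected (k := k) (u := u), ← profile_reflected (k := k) (u := w)]
  exact RectProblem.profile_congr hp.1 fun i ξ hξ => heq i ξ hξ t hp.2

theorem contDiff_flipCoord (i : Fin n) : ContDiff ℝ 1 (flipCoord k i) := by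
  unfold flipCoord; split_ifs <;> fun_prop

/-- Existence of a classical solution on the rectangle. -/
theorem RectProblem.exists_isSolutionOn (P : RectProblem n k T)
    (hP : P.IsReflectionOf lam f φ h) :
    ∃ u : ℝ × ℝ → EVec n, ContDiff ℝ 1 u ∧ IsSolutionOn T k lam f φ h u := by
  obtain ⟨Z, Zx, hZ, hZx, hZt, hZ0, hZb⟩ := P.exists_solution
  have hsm : ContDiff ℝ 1 fun p : ℝ × ℝ => profile k Z p.1 p.2 := by
    refine contDiff_euclidean.2 fun j => ?_
    exact (hZ j).comp (((contDiff_flipCoord j).comp contDiff_fst).prodMk contDiff_snd)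
  have hout : ∀ t, outVec k (profile k Z 0 t) (profile k Z 1 t) = outgoing Z t := by
    intro t
    ext j
    change (if (j : ℕ) < k then Z j (flipCoord k j 0) t else Z j (flipCoord k j 1) t) = Z j 1 t
    unfold flipCoord
    split_ifs <;> simp
  have hbd : ∀ t ∈ Ioo 0 T, ∀ i, Z i 0 t = h t (outgoing Z t) i := by
    intro t ht i
    rw [hZb i t (Ioo_subset_Icc_self ht), bdry, hP.boundary_eq t (Ioo_subset_Icc_self ht)]
  refine ⟨fun p => profile k Z p.1 p.2, hsm, hsm.continuous.continuousOn,
    fun x _ t _ => hsm.differentiable one_ne_zero _, fun x hx t ht i => ?_, fun x hx => ?_,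
    fun t ht i hi => ?_, fun t ht i hi => ?_⟩
  · have hx' := flipCoord_mem (k := k) (i := i) (Ioo_subset_Icc_self hx)
    have ht' := Ioo_subset_Icc_self ht
    have d1 : deriv (fun s => profile k Z x s i) t
        = P.src Z i (flipCoord k i x) t - P.l i (flipCoord k i x) t * Zx i (flipCoord k i x) t :=
      (hZt i _ hx' t ht').deriv
    have d2 : deriv (fun ξ => profile k Z ξ t i) x = Zx i (flipCoord k i x) t * flipSign k i :=
      ((hZx i _ t).comp x (hasDerivAt_flipCoord i x)).deriv
    simp only
    rw [d1, d2, src, flipCoord_flipCoord, hP.source_eq x (Ioo_subset_Icc_self hx) t ht',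
      hP.speed_eq i _ hx' t ht', flipCoord_flipCoord]
    ring
  · ext j
    change Z j (flipCoord k j x) 0 = φ x j
    have hx' := flipCoord_mem (k := k) (i := j) (Ioo_subset_Icc_self hx)
    rw [hZ0 j _ hx', hP.initial_eq j _ hx', flipCoord_flipCoord]
  · simp only
    rw [hout, ← hbd t ht]
    change Z i (flipCoord k i 0) t = Z i 0 t
    simp [flipCoord, not_lt.2 hi]
  · simp only
    rw [hout, ← hbd t ht]
    change Z i (flipCoord k i 1) t = Z i 0 t
    simp [flipCoord, hi]

/-! ### Global solutions -/

open Filter Topology in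
/-- Solutions on the rectangles of height `N + 1` which agree where both are defined fit together to
a global solution. -/
theorem exists_global_of_local {v : ℕ → ℝ × ℝ → EVec n} (hv : ∀ N, ContDiff ℝ 1 (v N))
    (hs : ∀ N : ℕ, IsSolutionOn (N + 1) k lam f φ h (v N))
    (heq : ∀ N M : ℕ, N ≤ M → EqOn (v N) (v M) (rectBar (N + 1))) :
    ∃ u : ℝ × ℝ → EVec n, IsClassicalSolution k lam f φ h u ∧ ContDiffOn ℝ 1 u stripBar := by
  obtain ⟨u, hu⟩ : ∃ u : ℝ × ℝ → EVec n, ∀ p, u p = v ⌈p.2⌉₊ p := ⟨_, fun _ => rfl⟩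
  have hN : ∀ N : ℕ, EqOn u (v N) (rectBar (N + 1)) := by
    intro N p hp
    have h1 : p.2 ≤ ⌈p.2⌉₊ := Nat.le_ceil _
    rw [hu]
    rcases le_total ⌈p.2⌉₊ N with h | h
    · exact heq _ _ h ⟨hp.1, hp.2.1, by linarith⟩
    · exact (heq _ _ h hp).symm
  have hlt : ∀ t : ℝ, t < ⌈t⌉₊ + 1 := fun t => (Nat.le_ceil t).trans_lt (lt_add_one _)
  have hmem : ∀ p ∈ stripBar, p ∈ rectBar (⌈p.2⌉₊ + 1) := fun p hp => ⟨hp.1, hp.2, (hlt _).le⟩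
  have hnear : ∀ p ∈ stripBar, u =ᶠ[𝓝[stripBar] p] v ⌈p.2⌉₊ := by
    intro p hp
    have h1 : ∀ᶠ q : ℝ × ℝ in 𝓝[stripBar] p, q.2 < ⌈p.2⌉₊ + 1 :=
      nhdsWithin_le_nhds (continuous_snd.tendsto p (gt_mem_nhds (hlt p.2)))
    filter_upwards [h1, self_mem_nhdsWithin] with q hq hq'
    exact hN _ ⟨hq'.1, hq'.2, hq.le⟩
  have hsub : strip ⊆ stripBar := fun p hp => ⟨Ioo_subset_Icc_self hp.1, (mem_Ioi.1 hp.2).le⟩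
  have hsm : ContDiffOn ℝ 1 u stripBar := fun p hp =>
    (hv _).contDiffAt.contDiffWithinAt.congr_of_eventuallyEq (hnear p hp) (hN _ (hmem p hp))
  have hval : ∀ x ∈ Icc (0 : ℝ) 1, ∀ t, 0 ≤ t → u (x, t) = v ⌈t⌉₊ (x, t) := fun x hx t ht =>
    hN _ (hmem (x, t) ⟨hx, ht⟩)
  have h01 : (0 : ℝ) ∈ Icc (0 : ℝ) 1 := ⟨le_rfl, zero_le_one⟩
  have h11 : (1 : ℝ) ∈ Icc (0 : ℝ) 1 := ⟨zero_le_one, le_rfl⟩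
  refine ⟨u, ⟨hsm.continuousOn, hsm.mono hsub, fun x t hp i => ?_, fun x hx => ?_,
    fun t ht i hi => ?_, fun t ht i hi => ?_⟩, hsm⟩
  · have h1 : u =ᶠ[𝓝 (x, t)] v ⌈t⌉₊ := by
      have := hnear _ (hsub hp)
      rwa [nhdsWithin_eq_nhds.2 (mem_of_superset (isOpen_strip.mem_nhds hp) hsub)] at this
    have c1 : Tendsto (fun s => (x, s)) (𝓝 t) (𝓝 (x, t)) := Continuous.tendsto (by fun_prop) t
    have c2 : Tendsto (fun ξ => (ξ, t)) (𝓝 x) (𝓝 (x, t)) := Continuous.tendsto (by fun_prop) x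
    have d1 : (fun s => u (x, s) i) =ᶠ[𝓝 t] fun s => v ⌈t⌉₊ (x, s) i :=
      (c1.eventually h1).mono fun s hs => by simp only [hs]
    have d2 : (fun ξ => u (ξ, t) i) =ᶠ[𝓝 x] fun ξ => v ⌈t⌉₊ (ξ, t) i :=
      (c2.eventually h1).mono fun s hs => by simp only [hs]
    rw [d1.deriv_eq, d2.deriv_eq, h1.eq_of_nhds]
    exact (hs _).system x hp.1 t ⟨hp.2, hlt t⟩ i
  · rw [hval x (Ioo_subset_Icc_self hx) 0 le_rfl]
    exact (hs _).initial x hx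
  · rw [hval 0 h01 t ht.le, hval 1 h11 t ht.le]
    exact (hs _).left t ⟨ht, hlt t⟩ i hi
  · rw [hval 0 h01 t ht.le, hval 1 h11 t ht.le]
    exact (hs _).right t ⟨ht, hlt t⟩ i hi

end

end

theorem theorem3 (n k : ℕ) (hk1 : 1 ≤ k) (hkn : k ≤ n)
    (lam : Fin n → ℝ → ℝ → ℝ) (f : ℝ → ℝ → EVec n → EVec n)
    (φ : ℝ → EVec n) (h : ℝ → EVec n → EVec n)
    (hlam : SpeedsOK k lam)
    (hf : SourceOK f)
    (hφ : ContDiffOn ℝ 1 φ (Set.Icc 0 1))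
    (hh : ContDiffOn ℝ 1 (fun p : ℝ × EVec n => h p.1 p.2) (Set.Ici 0 ×ˢ Set.univ))
    (hfgrowth : SourceGrowth f)
    (hhgrowth : BoundaryGrowth h)
    (hcompat0 : CompatZero k φ h)
    (hcompat1 : CompatOne k lam f φ h) :
    ∃ u : ℝ × ℝ → EVec n,
      IsClassicalSolution k lam f φ h u ∧ ContDiffOn ℝ 1 u stripBar ∧
      ∀ w : ℝ × ℝ → EVec n, IsClassicalSolution k lam f φ h w → Set.EqOn w u stripBar := by
  have key : ∀ T : ℝ, 0 < T → ∃ P : RectProblem n k T, P.IsReflectionOf lam f φ h := fun T hT =>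
    exists_rectProblem (hk1.trans hkn) hlam hf hφ hh hfgrowth hhgrowth hcompat0 hcompat1 hT
  have hpos : ∀ N : ℕ, (0 : ℝ) < N + 1 := fun N => by positivity
  choose P hP using fun N : ℕ => key (N + 1) (hpos N)
  choose v hv hs using fun N => (P N).exists_isSolutionOn (hP N)
  obtain ⟨u, hu, hu'⟩ := exists_global_of_local hv hs fun N M hNM =>
    (hs N).eqOn ((hs M).mono (by exact_mod_cast Nat.succ_le_succ hNM)) (hP N)
  refine ⟨u, hu, hu', fun w hw p hp => ?_⟩
  have hp2 : (0 : ℝ) < p.2 + 1 := add_pos_of_nonneg_of_pos hp.2 one_pos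
  obtain ⟨Q, hQ⟩ := key (p.2 + 1) hp2
  exact (hw.isSolutionOn _).eqOn (hu.isSolutionOn _) hQ ⟨hp.1, hp.2, (lt_add_one _).le⟩
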